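/- Let $0<\nu\le 1$ and let $\lambda\neq 0$ be real. For $\alpha>0$ and $m=\lceil\alpha\rceil$, let $\frac{d^{\alpha}g}{dt^{\alpha}}$ be the Dzhrbashyan–Caputo derivative: $g^{(m)}(t)$ if $\alpha=m$, and $\frac{1}{\Gamma(m-\alpha)}\int_0^t (t-s)^{m-\alpha-1}g^{(m)}(s)\,ds$ if $m-1<\alpha<m$; it is applied to functions $g\in C^m((0,\infty))$ whose $m$-th derivative is integrable near $0$. For a real constant $c$ and an integer $k\geq 0$, a fundamental solution of $$\frac{\partial^{2\nu}u}{\partial t^{2\nu}}=c\,\frac{\partial^k u}{\partial x^k},\qquad x\in\mathbb R,\ t>0,$$ is a family $(u(\cdot,t))_{t>0}$ of tempered distributions on $\mathbb R$ such that, for every Schwartz function $\varphi$, the function $t\mapsto\langle u(\cdot,t),\varphi\rangle$ is in the above class with $\alpha=2\nu$, has Caputo derivative of order $2\nu$ equal to $c\,\langle \partial_x^k u(\cdot,t),\varphi\rangle$ for all $t>0$, tends to $\varphi(0)$ as $t\to0+$ (that is, $u(x,0)=\delta(x)$), and, if $1/2<\nu\le1$, has first derivative tending to $0$ as $t\to0+$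 (that is, $u_t(x,0)=0$). **Theorem.** (i) The fractional diffusion equation $\frac{\partial^{2\nu}v}{\partial t^{2\nu}}=\lambda^2\frac{\partial^2v}{\partial x^2}$ has exactly one fundamental solution $v_{2\nu}$, and for every $t>0$ it is a finite measure on $\mathbb R$. If $\nu<1$, it has an even, non-negative, integrable density $p(x,t)$. (ii) Let $\bar v_{2\nu}(ds,t)$ be the folded solution, i.e. the image of $v_{2\nu}(\cdot,t)$ under $s\mapsto|s|$; thus, if $\nu<1$, $\bar v_{2\nu}(ds,t)=2p(s,t)\,ds$ on $(0,\infty)$. For all $x\in\mathbb R$ and $t>0$ the integral $$u_{2\nu}(x,t)=\int_{(0,\infty)}\frac{1}{\sqrt{2\pi s}}\cos\Big(\frac{x^2}{2s}-\frac{\pi}{4}\Big)\,\bar v_{2\nu}(ds,t)$$ converges absolutely, and it is continuous in $x$. If $\nu<1$, it equals $\int_0^\infty\frac{1}{\sqrt{2\pi s}}\cos\big(\frac{x^2}{2s}-\frac{\pi}{4}\big)\,2p(s,t)\,ds$. (iii) The fractional equation of vibrations of rods $\frac{\partial^{2\nu}u}{\partial t^{2\nu}}=-\frac{\lambda^2}{2^2}\frac{\partial^4u}{\partial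 x^4}$ has a fundamental solution, and every fundamental solution of it coincides, for each $t>0$, with the function $u_{2\nu}(\cdot,t)$ (as a tempered distribution in $x$). -/

import Mathlib

open MeasureTheory Filter Topology Set
open scoped SchwartzMap

noncomputable section

namespace FracRod

/-- The Dzhrbashyan-Caputo derivative of order `α > 0` (with base point `0`) of `g` at `t > 0`.
With `m = ⌈α⌉`, it is the ordinary derivative `g⁽ᵐ⁾(t)` if `α = m`, and
`Γ(m - α)⁻¹ ∫₀ᵗ (t - s)^(m - α - 1) g⁽ᵐ⁾(s) ds` if `m - 1 < α < m`. -/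
def caputoDeriv (α : ℝ) (g : ℝ → ℂ) (t : ℝ) : ℂ :=
  if α = (⌈α⌉₊ : ℝ) then iteratedDeriv ⌈α⌉₊ g t
  else (Real.Gamma ((⌈α⌉₊ : ℝ) - α))⁻¹ •
    ∫ s in (0 : ℝ)..t, (t - s) ^ ((⌈α⌉₊ : ℝ) - α - 1) • iteratedDeriv ⌈α⌉₊ g s

/-- The functions to which the Caputo derivative of order `α` is applied: with `m = ⌈α⌉`, they are
`m` times continuously differentiable on `(0, ∞)`, and the `m`-th derivative is integrable up
to `0`. -/
def CaputoRegular (α : ℝ) (g : ℝ → ℂ) : Prop :=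
  ContDiffOn ℝ ⌈α⌉₊ g (Ioi 0) ∧
    ∀ t : ℝ, 0 < t → IntervalIntegrable (iteratedDeriv ⌈α⌉₊ g) volume 0 t

/-- `T` is the solution of the Cauchy problem
`∂^α T / ∂t^α = c ∂^k T / ∂x^k` for `t > 0`, `T(0) = δ`, and `∂T/∂t (0) = 0` in case `α > 1`,
where `∂/∂x` is the derivative of tempered distributions on the real line, `∂^α/∂t^α` is the
Caputo derivative, and the time derivatives and the limits at `t = 0+` are taken after pairing with
an arbitrary Schwartz function. Only the values `T t` with `t > 0` matter. -/
structure IsFundamentalSolution (α c : ℝ) (k : ℕ) (T : ℝ → 𝓢'(ℝ, ℂ)) : Prop where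
  regular : ∀ φ : 𝓢(ℝ, ℂ), CaputoRegular α (fun t => T t φ)
  equation : ∀ (φ : 𝓢(ℝ, ℂ)) (t : ℝ), 0 < t →
    caputoDeriv α (fun s => T s φ) t =
      (c : ℂ) * ((TemperedDistribution.derivCLM ℂ)^[k] (T t)) φ
  initial_value : ∀ φ : 𝓢(ℝ, ℂ),
    Tendsto (fun t => T t φ) (𝓝[>] 0) (𝓝 (TemperedDistribution.delta (0 : ℝ) φ))
  initial_velocity : 1 < α → ∀ φ : 𝓢(ℝ, ℂ),
    Tendsto (fun t => deriv (fun s => T s φ) t) (𝓝[>] 0) (𝓝 0)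

/-- The tempered distribution `T` is the function `f`. -/
def IsGivenBy (T : 𝓢'(ℝ, ℂ)) (f : ℝ → ℝ) : Prop :=
  ∀ φ : 𝓢(ℝ, ℂ), Integrable (fun x => φ x * (f x : ℂ)) ∧ T φ = ∫ x, φ x * (f x : ℂ)

/-- The Fresnel function `(2πs)^(-1/2) cos(x²/(2s) - π/4)`. -/
def fresnel (x s : ℝ) : ℝ :=
  1 / √(2 * Real.pi * s) * Real.cos (x ^ 2 / (2 * s) - Real.pi / 4)

/-- The folding of a measure on the line onto `[0, ∞)`: its image under `s ↦ |s|`. An even density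
`p` on the line becomes the density `2 p` on `(0, ∞)`. -/
def folded (μ : Measure ℝ) : Measure ℝ :=
  μ.map (fun s => |s|)

/-- The subordinated function `u(x, t) = ∫_{(0, ∞)} (2πs)^(-1/2) cos(x²/(2s) - π/4) v̄(ds, t)`,
with `v̄(·, t)` the folding of `v(·, t)`. -/
def subordinated (v : ℝ → FiniteMeasure ℝ) (x t : ℝ) : ℝ :=
  ∫ s in Ioi 0, fresnel x s ∂(folded (v t : Measure ℝ))

end FracRod

end

/-! The Fourier transform in `x` turns both equations into `∂^{2ν} û = -b(ξ)² û` with `û = 1` at `t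
= 0`, where `b = 2πξ|λ|` for diffusion and `b = (2πξ)²|λ|/2` for rods. The solution is the
Mittag-Leffler function `E_{2ν}(-b² t^{2ν})`. The heart of the matter is that `E_{2ν}(-x²)` is an
average of cosines, `E cos(xZ)`, for a positive random variable `Z` depending only on `ν`. Hence
`v(·, t)` is the law of `±|λ| t^ν Z` with a fair sign, and its folding is the law of `|λ| t^ν Z`.
The rod multiplier is the average of `cos((2πξ)² s / 2)` over `s = |λ| t^ν Z`. Each such cosine is
the Fourier transform of the Fresnel function `fresnel · s`, so averaging and inverting gives the
subordination integral.

Formally `Z` has Mellin transform `Γ(1+s)/Γ(1+νs)`. Euler's product for `Γ` approximates this by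
products of Mellin transforms of elementary laws, and a weak limit yields the law
(`exists_isMittagLefflerLaw`). It is absolutely continuous for `ν < 1` and has a finite moment of
order `-1/2`, which is what the bound `|fresnel x s| ≤ s^(-1/2)` requires.

That the multipliers solve the Caputo problem is read off from integral equations: multiplying the
test function repeatedly by `-b²` gives a chain of fractional integral equations, and such a chain
forces the regularity (`caputo_fracChain`).

Uniqueness (`IsFundamentalSolution.unique`) is a Volterra iteration on the Fourier side. The symbol
is bounded on the support of a compactly supported test function, so `n` steps gain a factor
`1/Γ(nα+1)`. Uniform boundedness controls the distributions along the iterates well enough not to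
spoil this gain. -/

noncomputable section

namespace FracRod

/-! ### Fractional integrals: Beta integrals, the semigroup law, continuity. -/

/-- The Riemann-Liouville fractional integral of order `a > 0` with base point `0`. -/
def fracInt (a : ℝ) (f : ℝ → ℂ) (t : ℝ) : ℂ :=
  (Real.Gamma a)⁻¹ • ∫ s in (0 : ℝ)..t, (t - s) ^ (a - 1) • f s

/-- The normalised power `t ^ γ / Γ(γ + 1)`. -/
def normPow (γ t : ℝ) : ℝ := t ^ γ / Real.Gamma (γ + 1)

theorem intervalIntegral_congr_uIoc {E : Type*} [NormedAddCommGroup E] [NormedSpace ℝ E] {a b : ℝ}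
    {f g : ℝ → E} (h : ∀ s ∈ uIoc a b, f s = g s) : ∫ s in a..b, f s = ∫ s in a..b, g s :=
  intervalIntegral.integral_congr_ae (Eventually.of_forall h)

theorem beta_kernel_unit {a b : ℝ} (ha : 0 < a) (hb : 0 < b) :
    IntervalIntegrable (fun s : ℝ => (1 - s) ^ (a - 1) * s ^ (b - 1)) volume 0 1 ∧
    ∫ s in (0 : ℝ)..1, (1 - s) ^ (a - 1) * s ^ (b - 1) =
      Real.Gamma a * Real.Gamma b / Real.Gamma (a + b) := by
  have hcongr : ∀ s ∈ uIoc (0 : ℝ) 1,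
      ((s : ℂ) ^ ((b : ℂ) - 1) * (1 - (s : ℂ)) ^ ((a : ℂ) - 1)) =
        (((1 - s) ^ (a - 1) * s ^ (b - 1) : ℝ) : ℂ) := by
    intro s hs
    rw [uIoc_of_le zero_le_one] at hs
    rw [Complex.ofReal_mul, Complex.ofReal_cpow (by linarith [hs.2]),
      Complex.ofReal_cpow hs.1.le]
    push_cast
    ring
  have h1 := Complex.betaIntegral_convergent (u := b) (v := a) (by simpa) (by simpa)
  have h2 := Complex.betaIntegral_eq_Gamma_mul_div (u := b) (v := a) (by simpa) (by simpa)
  rw [Complex.betaIntegral, intervalIntegral_congr_uIoc hcongr,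
    intervalIntegral.integral_ofReal] at h2
  constructor
  · have h3 := h1.congr hcongr
    rw [intervalIntegrable_iff] at h3 ⊢
    exact (by simpa using h3.re : Integrable _ (volume.restrict (uIoc (0 : ℝ) 1)))
  · have : (Complex.Gamma (b : ℂ) * Complex.Gamma (a : ℂ) / Complex.Gamma ((b : ℂ) + a)) =
        ((Real.Gamma a * Real.Gamma b / Real.Gamma (a + b) : ℝ) : ℂ) := by
      push_cast [Complex.Gamma_ofReal]
      rw [← Complex.ofReal_add, Complex.Gamma_ofReal, add_comm b a]
      ring
    rw [this] at h2
    exact_mod_cast h2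

theorem beta_kernel {a b r t : ℝ} (ha : 0 < a) (hb : 0 < b) (hrt : r < t) :
    IntervalIntegrable (fun s : ℝ => (t - s) ^ (a - 1) * (s - r) ^ (b - 1)) volume r t ∧
    ∫ s in r..t, (t - s) ^ (a - 1) * (s - r) ^ (b - 1) =
      (t - r) ^ (a + b - 1) * (Real.Gamma a * Real.Gamma b / Real.Gamma (a + b)) := by
  obtain ⟨h1, h2⟩ := beta_kernel_unit ha hb
  have hd : 0 < t - r := sub_pos.2 hrt
  have key : ∀ u ∈ uIoc (0 : ℝ) 1,
      (t - r) ^ (a + b - 2) * ((1 - u) ^ (a - 1) * u ^ (b - 1)) =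
        (t - ((t - r) * u + r)) ^ (a - 1) * (((t - r) * u + r) - r) ^ (b - 1) := by
    intro u hu
    rw [uIoc_of_le zero_le_one] at hu
    rw [show t - ((t - r) * u + r) = (t - r) * (1 - u) by ring,
      show (t - r) * u + r - r = (t - r) * u by ring,
      Real.mul_rpow hd.le (by linarith [hu.2]), Real.mul_rpow hd.le hu.1.le,
      show a + b - 2 = (a - 1) + (b - 1) by ring, Real.rpow_add hd]
    ring
  constructor
  · have h3 := (h1.const_mul ((t - r) ^ (a + b - 2))).congr key
    have h4 := (h3.comp_mul_right (c := (t - r)⁻¹) ).comp_sub_right r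
    simp only [zero_div, one_div, inv_inv, zero_add] at h4
    convert h4 using 1
    · ext s
      congr 2 <;> field_simp <;> ring
    · ring
  · have h3 := intervalIntegral.integral_comp_mul_add (a := 0) (b := 1)
      (fun s : ℝ => (t - s) ^ (a - 1) * (s - r) ^ (b - 1)) hd.ne' r
    rw [← intervalIntegral_congr_uIoc key, intervalIntegral.integral_const_mul, h2] at h3
    simp only [mul_zero, zero_add, mul_one, sub_add_cancel, smul_eq_mul] at h3
    rw [eq_comm, inv_mul_eq_iff_eq_mul₀ hd.ne'] at h3
    rw [h3, ← mul_assoc, show a + b - 1 = 1 + (a + b - 2) by ring, Real.rpow_add hd, Real.rpow_one]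

theorem intervalIntegrable_sub_rpow {a t : ℝ} (ha : 0 < a) :
    IntervalIntegrable (fun s : ℝ => (t - s) ^ (a - 1)) volume 0 t := by
  have := (intervalIntegral.intervalIntegrable_rpow' (a := 0) (b := t) (r := a - 1) (by linarith)).comp_sub_left t
  simpa using this.symm

theorem fracInt_normPow {a γ t : ℝ} (ha : 0 < a) (hγ : -1 < γ) (ht : 0 < t) :
    fracInt a (fun s => (normPow γ s : ℂ)) t = (normPow (γ + a) t : ℂ) := by
  have h := (beta_kernel ha (b := γ + 1) (by linarith) ht).2
  simp only [sub_zero, add_sub_cancel_right] at h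
  have hg : Real.Gamma a ≠ 0 := (Real.Gamma_pos_of_pos ha).ne'
  have hg' : Real.Gamma (γ + 1) ≠ 0 := (Real.Gamma_pos_of_pos (by linarith)).ne'
  have : ∀ s : ℝ, (t - s) ^ (a - 1) • ((normPow γ s : ℝ) : ℂ) =
      (((t - s) ^ (a - 1) * s ^ γ / Real.Gamma (γ + 1) : ℝ) : ℂ) := by
    intro s; simp [normPow]; ring
  simp only [fracInt, this, intervalIntegral.integral_ofReal, intervalIntegral.integral_div]
  rw [h, Complex.real_smul, ← Complex.ofReal_mul]
  congr 1
  rw [normPow, show a + (γ + 1) - 1 = γ + a by ring, show a + (γ + 1) = γ + a + 1 by ring]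
  field_simp

/-- Fubini on the triangle `r < s ≤ t`: the inner integral over `s` is a Beta integral, equal to a
multiple of `(t - r) ^ (a + b - 1)`. The hypothesis `hf` is thus exactly the absolute integrability
that Fubini asks for. -/
theorem fracInt_comp_of_integrableOn {a b t : ℝ} {f : ℝ → ℂ} (ha : 0 < a) (hb : 0 < b)
    (ht : 0 < t) (hf' : AEStronglyMeasurable f (volume.restrict (Ioc 0 t)))
    (hf : IntegrableOn (fun r => (t - r) ^ (a + b - 1) * ‖f r‖) (Ioc 0 t)) :
    fracInt a (fracInt b f) t = fracInt (a + b) f t := by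
  set μ := volume.restrict (Ioc (0 : ℝ) t) with hμ
  let k : ℝ → ℝ → ℝ := fun s r => if r < s then (t - s) ^ (a - 1) * (s - r) ^ (b - 1) else 0
  have hkm : Measurable (Function.uncurry k) := by
    apply Measurable.ite
    · exact measurableSet_lt measurable_snd measurable_fst
    · fun_prop
    · fun_prop
  have hk : ∀ r ∈ Ioc 0 t, r < t → Integrable (fun s => k s r) μ ∧
      ∫ s, k s r ∂μ = (t - r) ^ (a + b - 1) * (Real.Gamma a * Real.Gamma b / Real.Gamma (a + b)) := by
    intro r hr hrt
    obtain ⟨h1, h2⟩ := beta_kernel ha hb hrt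
    have e : (fun s => k s r) = (Ioi r).indicator
        (fun s => (t - s) ^ (a - 1) * (s - r) ^ (b - 1)) := by
      ext s; simp [k, indicator_apply]
    have hs : Ioi r ∩ Ioc 0 t = Ioc r t := by
      ext s; simp only [mem_inter_iff, mem_Ioi, mem_Ioc]
      constructor
      · rintro ⟨h, h', h''⟩; exact ⟨h, h''⟩
      · rintro ⟨h, h'⟩; exact ⟨h, hr.1.trans h, h'⟩
    rw [e]
    constructor
    · rw [integrable_indicator_iff measurableSet_Ioi, IntegrableOn, hμ,
        Measure.restrict_restrict measurableSet_Ioi, hs]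
      exact (intervalIntegrable_iff_integrableOn_Ioc_of_le hrt.le).1 h1
    · rw [integral_indicator measurableSet_Ioi, hμ, Measure.restrict_restrict measurableSet_Ioi, hs,
        ← intervalIntegral.integral_of_le hrt.le, h2]
  have hk0 : ∀ s r, s ∈ Ioc 0 t → 0 ≤ k s r := by
    intro s r hs
    simp only [k]
    split_ifs with h
    · exact mul_nonneg (Real.rpow_nonneg (by linarith [hs.2]) _) (Real.rpow_nonneg (by linarith) _)
    · exact le_rfl
  have hne : ∀ᵐ r ∂μ, r ∈ Ioc 0 t ∧ r < t := by
    have h1 : ∀ᵐ r ∂μ, r ∈ Ioc 0 t := ae_restrict_mem measurableSet_Ioc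
    have h2 : ∀ᵐ r ∂μ, r ≠ t := ae_restrict_of_ae (Measure.ae_ne volume t)
    filter_upwards [h1, h2] with r h1 h2 using ⟨h1, lt_of_le_of_ne h1.2 h2⟩
  have hint : Integrable (Function.uncurry fun s r => k s r • f r) (μ.prod μ) := by
    rw [integrable_prod_iff']
    · constructor
      · filter_upwards [hne] with r hr
        exact (hk r hr.1 hr.2).1.smul_const (f r)
      · have : (fun r => ∫ s, ‖Function.uncurry (fun s r => k s r • f r) (s, r)‖ ∂μ) =ᵐ[μ]
            fun r => (t - r) ^ (a + b - 1) * (Real.Gamma a * Real.Gamma b / Real.Gamma (a + b)) * ‖f r‖ := by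
          filter_upwards [hne] with r hr
          rw [← (hk r hr.1 hr.2).2, ← integral_mul_const]
          apply integral_congr_ae
          filter_upwards [ae_restrict_mem measurableSet_Ioc] with s hs
          simp [abs_of_nonneg (hk0 s r hs)]
        rw [integrable_congr this]
        have := hf.mul_const (Real.Gamma a * Real.Gamma b / Real.Gamma (a + b))
        convert this using 2
        ring
    · exact (hkm.aestronglyMeasurable).smul hf'.comp_snd
  have hswap := integral_integral_swap hint
  have hl : ∀ s ∈ Ioc 0 t, ∫ r, k s r • f r ∂μ =
      (t - s) ^ (a - 1) • ∫ r in (0:ℝ)..s, (s - r) ^ (b - 1) • f r := by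
    intro s hs
    have e : (fun r => k s r • f r) = (Iio s).indicator
        (fun r => (t - s) ^ (a - 1) • (s - r) ^ (b - 1) • f r) := by
      ext r; by_cases h : r < s <;> simp [k, h, mul_assoc]
    have hs' : Iio s ∩ Ioc 0 t = Ioo 0 s := by
      ext r; simp only [mem_inter_iff, mem_Iio, mem_Ioc, mem_Ioo]
      constructor
      · rintro ⟨h, h', h''⟩; exact ⟨h', h⟩
      · rintro ⟨h, h'⟩; exact ⟨h', h, h'.le.trans hs.2⟩
    rw [e, integral_indicator measurableSet_Iio, hμ, Measure.restrict_restrict measurableSet_Iio, hs',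
      ← integral_Ioc_eq_integral_Ioo, ← intervalIntegral.integral_of_le hs.1.le,
      intervalIntegral.integral_smul]
  have hr : ∫ r, ∫ s, k s r • f r ∂μ ∂μ = (Real.Gamma a * Real.Gamma b / Real.Gamma (a + b)) •
      ∫ r in (0:ℝ)..t, (t - r) ^ (a + b - 1) • f r := by
    rw [intervalIntegral.integral_of_le ht.le, ← integral_smul]
    apply integral_congr_ae
    filter_upwards [hne] with r hr
    rw [integral_smul_const, (hk r hr.1 hr.2).2, mul_comm, mul_smul]
  have ga := (Real.Gamma_pos_of_pos ha).ne'
  have gb := (Real.Gamma_pos_of_pos hb).ne'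
  rw [hr, setIntegral_congr_fun measurableSet_Ioc hl] at hswap
  rw [fracInt, fracInt, intervalIntegral.integral_of_le ht.le]
  simp only [fracInt, smul_comm _ (Real.Gamma b)⁻¹]
  rw [integral_smul, hswap, smul_smul, smul_smul]
  congr 1
  field_simp

/-- For `1 ≤ a + b` the composed kernel is bounded, so integrability of `f` is enough. This is the
case of the top derivative in the Caputo derivative, where `a + b = ⌈α⌉`. -/
theorem fracInt_comp {a b t : ℝ} {f : ℝ → ℂ} (ha : 0 < a) (hb : 0 < b) (hab : 1 ≤ a + b)
    (ht : 0 < t) (hf : IntervalIntegrable f volume 0 t) :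
    fracInt a (fracInt b f) t = fracInt (a + b) f t := by
  rw [intervalIntegrable_iff_integrableOn_Ioc_of_le ht.le] at hf
  refine fracInt_comp_of_integrableOn ha hb ht hf.aestronglyMeasurable ?_
  apply Integrable.bdd_mul (c := t ^ (a + b - 1)) hf.norm
  · exact Measurable.aestronglyMeasurable (by fun_prop)
  · filter_upwards [ae_restrict_mem measurableSet_Ioc] with r hr
    rw [Real.norm_of_nonneg (Real.rpow_nonneg (by linarith [hr.2]) _)]
    exact Real.rpow_le_rpow (by linarith [hr.2]) (by linarith [hr.1]) (by linarith)

theorem intervalIntegrable_kernel_smul {a t : ℝ} {f : ℝ → ℂ} (ha : 0 < a) (ht : 0 ≤ t)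
    (hf : ContinuousOn f (Ici 0)) :
    IntervalIntegrable (fun s => (t - s) ^ (a - 1) • f s) volume 0 t := by
  refine (intervalIntegrable_sub_rpow ha).smul_continuousOn (hf.mono ?_)
  rw [uIcc_of_le ht]
  exact Icc_subset_Ici_self

theorem fracInt_comp_of_continuousOn {a b t : ℝ} {f : ℝ → ℂ} (ha : 0 < a) (hb : 0 < b)
    (ht : 0 < t) (hf : ContinuousOn f (Ici 0)) :
    fracInt a (fracInt b f) t = fracInt (a + b) f t := by
  have hsub : Ioc 0 t ⊆ Ici 0 := fun x hx => hx.1.le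
  refine fracInt_comp_of_integrableOn ha hb ht
    ((hf.mono hsub).aestronglyMeasurable measurableSet_Ioc) ?_
  have h := (intervalIntegrable_iff_integrableOn_Ioc_of_le ht.le).1
    (intervalIntegrable_kernel_smul (add_pos ha hb) ht.le hf).norm
  refine h.congr_fun (fun s hs => ?_) measurableSet_Ioc
  simp only [norm_smul]
  rw [Real.norm_of_nonneg (Real.rpow_nonneg (by linarith [hs.2]) _)]

theorem fracInt_congr {a t : ℝ} {f g : ℝ → ℂ} (ht : 0 ≤ t) (h : ∀ s, 0 < s → s ≤ t → f s = g s) :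
    fracInt a f t = fracInt a g t := by
  rw [fracInt, fracInt]
  congr 1
  apply intervalIntegral_congr_uIoc
  intro s hs
  rw [uIoc_of_le ht] at hs
  rw [h s hs.1 hs.2]

theorem fracInt_add {a t : ℝ} {f g : ℝ → ℂ}
    (hf : IntervalIntegrable (fun s => (t - s) ^ (a - 1) • f s) volume 0 t)
    (hg : IntervalIntegrable (fun s => (t - s) ^ (a - 1) • g s) volume 0 t) :
    fracInt a (fun s => f s + g s) t = fracInt a f t + fracInt a g t := by
  simp only [fracInt, smul_add]
  rw [intervalIntegral.integral_add hf hg, smul_add]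

theorem fracInt_sum_const_mul {ι : Type*} {a t : ℝ} (S : Finset ι) (c : ι → ℂ) {f : ι → ℝ → ℂ}
    (hf : ∀ i ∈ S, IntervalIntegrable (fun s => (t - s) ^ (a - 1) • f i s) volume 0 t) :
    fracInt a (fun s => ∑ i ∈ S, c i * f i s) t = ∑ i ∈ S, c i * fracInt a (f i) t := by
  simp only [fracInt, Finset.smul_sum]
  rw [intervalIntegral.integral_finsetSum fun i hi => by
    simpa only [mul_smul_comm] using (hf i hi).const_mul (c i), Finset.smul_sum]
  refine Finset.sum_congr rfl fun i _ => ?_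
  simp only [← mul_smul_comm]
  rw [intervalIntegral.integral_const_mul, mul_smul_comm]

/-- The substitution `s = t u` moves `t` out of the singular kernel, after which dominated
convergence applies. -/
theorem continuousOn_fracInt {a : ℝ} {f : ℝ → ℂ} (ha : 0 < a) (hf : Continuous f) :
    ContinuousOn (fracInt a f) (Ici 0) := by
  have hG := (Real.Gamma_pos_of_pos ha).ne'
  have e : ∀ t ∈ Ici (0 : ℝ), fracInt a f t =
      ((Real.Gamma a)⁻¹ * t ^ a) • ∫ u in (0 : ℝ)..1, (1 - u) ^ (a - 1) • f (t * u) := by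
    intro t ht
    rcases eq_or_lt_of_le (show (0:ℝ) ≤ t from ht) with rfl | ht
    · simp [fracInt, Real.zero_rpow ha.ne']
    · have h3 := intervalIntegral.integral_comp_mul_left (a := 0) (b := 1)
        (fun s : ℝ => (t - s) ^ (a - 1) • f s) ht.ne'
      have key : ∀ u ∈ uIoc (0 : ℝ) 1,
        t ^ (a - 1) • ((1 - u) ^ (a - 1) • f (t * u)) = (t - t * u) ^ (a - 1) • f (t * u) := by
        intro u hu
        rw [uIoc_of_le zero_le_one] at hu
        rw [show t - t * u = t * (1 - u) by ring, Real.mul_rpow ht.le (by linarith [hu.2]), mul_smul]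
      rw [← intervalIntegral_congr_uIoc key, intervalIntegral.integral_smul] at h3
      simp only [mul_zero, mul_one] at h3
      rw [fracInt, mul_smul]
      congr 1
      rw [eq_inv_smul_iff₀ ht.ne'] at h3
      rw [← h3, smul_smul]
      congr 1
      rw [Real.rpow_sub_one ht.ne']
      field_simp
  refine ContinuousOn.congr ?_ e
  refine ContinuousOn.smul (f := fun t : ℝ => (Real.Gamma a)⁻¹ * t ^ a)
    (g := fun t => ∫ u in (0 : ℝ)..1, (1 - u) ^ (a - 1) • f (t * u)) ?_ ?_
  · exact continuousOn_const.mul (continuousOn_id.rpow_const fun x _ => Or.inr ha.le)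
  · intro t ht
    obtain ⟨C, hC⟩ := (isCompact_Icc (a := -(|t| + 1)) (b := |t| + 1)).exists_bound_of_continuousOn hf.continuousOn
    apply ContinuousAt.continuousWithinAt
    apply intervalIntegral.continuousAt_of_dominated_interval (bound := fun u => (1 - u) ^ (a - 1) * C)
    · refine Eventually.of_forall fun x => ?_
      apply Measurable.aestronglyMeasurable
      have := hf.measurable
      fun_prop
    · have : ∀ᶠ x in 𝓝 t, |x| < |t| + 1 :=
        (continuous_abs.tendsto t).eventually (gt_mem_nhds (by linarith))
      filter_upwards [this] with x hx
      refine Eventually.of_forall fun u hu => ?_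
      rw [uIoc_of_le zero_le_one] at hu
      rw [norm_smul, Real.norm_of_nonneg (Real.rpow_nonneg (by linarith [hu.2]) _)]
      gcongr
      · exact Real.rpow_nonneg (by linarith [hu.2]) _
      · apply hC
        rw [mem_Icc, ← abs_le, abs_mul]
        calc |x| * |u| ≤ |x| * 1 := by gcongr; rw [abs_of_pos hu.1]; exact hu.2
          _ ≤ _ := by linarith
    · exact (intervalIntegrable_sub_rpow (t := 1) ha).mul_const _
    · refine Eventually.of_forall fun u _ => ?_
      fun_prop

/-! ### Growth of the Gamma function. -/

/-- The Gamma function outgrows every exponential. -/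
theorem rpow_mul_exp_le_Gamma {A x : ℝ} (hA : 0 < A) (hx : 0 ≤ x) :
    A ^ x * Real.exp (-A) ≤ Real.Gamma (x + 1) := by
  have hint := Real.GammaIntegral_convergent (s := x + 1) (by linarith)
  rw [Real.Gamma_eq_integral (by linarith)]
  simp only [add_sub_cancel_right] at hint ⊢
  have h1 : ∫ s in Ioi A, Real.exp (-s) * A ^ x = A ^ x * Real.exp (-A) := by
    rw [integral_mul_const, integral_exp_neg_Ioi]; ring
  rw [← h1]
  calc ∫ s in Ioi A, Real.exp (-s) * A ^ x ≤ ∫ s in Ioi A, Real.exp (-s) * s ^ x := by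
        apply setIntegral_mono_on
        · exact (integrableOn_exp_neg_Ioi A).mul_const _
        · exact hint.mono_set (Ioi_subset_Ioi hA.le)
        · exact measurableSet_Ioi
        · intro s hs
          have : A ≤ s := le_of_lt hs
          gcongr
    _ ≤ _ := by
        apply setIntegral_mono_set hint
        · filter_upwards [ae_restrict_mem measurableSet_Ioi] with s hs
          exact mul_nonneg (Real.exp_pos _).le (Real.rpow_nonneg (le_of_lt hs) _)
        · exact (Ioi_subset_Ioi hA.le).eventuallyLE

theorem exists_pow_div_Gamma_le {α : ℝ} (hα : 0 < α) (B : ℝ) (hB : 0 < B) :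
    ∃ C : ℝ, 0 < C ∧ ∀ n : ℕ, B ^ n / Real.Gamma (n * α + 1) ≤ C * (1 / 2) ^ n := by
  -- Chosen so that `A ^ α = 2 B`; the spare factor `2 ^ n` becomes the geometric decay.
  set A := (2 * B) ^ (1 / α)
  have hA : 0 < A := by positivity
  refine ⟨Real.exp A, Real.exp_pos _, fun n => ?_⟩
  have h := rpow_mul_exp_le_Gamma hA (x := n * α) (by positivity)
  have hG : 0 < Real.Gamma (n * α + 1) := Real.Gamma_pos_of_pos (by positivity)
  have hAn : A ^ (n * α) = (2 * B) ^ n := by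
    rw [← Real.rpow_mul (by positivity), ← Real.rpow_natCast]
    congr 1; field_simp
  rw [hAn] at h
  rw [div_le_iff₀ hG]
  calc B ^ n = Real.exp A * (1 / 2) ^ n * ((2 * B) ^ n * Real.exp (-A)) := by
        rw [Real.exp_neg, mul_pow, one_div, inv_pow]; field_simp
    _ ≤ _ := by gcongr

theorem summable_pow_div_Gamma {α : ℝ} (hα : 0 < α) (y : ℝ) :
    Summable fun n : ℕ => |y| ^ n / Real.Gamma (n * α + 1) := by
  obtain ⟨C, hC, h⟩ := exists_pow_div_Gamma_le hα (|y| + 1) (by positivity)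
  refine Summable.of_nonneg_of_le (fun n => ?_) (fun n => le_trans ?_ (h n))
    ((summable_geometric_of_lt_one (by norm_num) (by norm_num)).mul_left C)
  · have : 0 < Real.Gamma (n * α + 1) := Real.Gamma_pos_of_pos (by positivity)
    positivity
  · have : 0 < Real.Gamma (n * α + 1) := Real.Gamma_pos_of_pos (by positivity)
    gcongr
    linarith

/-! ### Fractional integration inverts the Caputo derivative. -/

theorem fracInt_one (f : ℝ → ℂ) (t : ℝ) : fracInt 1 f t = ∫ s in (0 : ℝ)..t, f s := by
  simp [fracInt]

theorem eq_add_integral_deriv {f : ℝ → ℂ} {f0 : ℂ} {t : ℝ} (ht : 0 < t)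
    (hd : DifferentiableOn ℝ f (Ioi 0)) (hi : IntervalIntegrable (deriv f) volume 0 t)
    (h0 : Tendsto f (𝓝[>] 0) (𝓝 f0)) : f t = f0 + ∫ s in (0 : ℝ)..t, deriv f s := by
  have hda : ∀ x, 0 < x → DifferentiableAt ℝ f x := fun x hx => hd.differentiableAt (Ioi_mem_nhds hx)
  rw [intervalIntegral.integral_eq_sub_of_hasDerivAt_of_tendsto ht
    (fun x hx => (hda x hx.1).hasDerivAt) hi h0
    ((hda t ht).continuousAt.tendsto.mono_left nhdsWithin_le_nhds)]
  ring

/-- Taylor's formula with integral remainder. As `α ≤ 2`, only `⌈α⌉ = 1` and `⌈α⌉ = 2` occur, and in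
the second case the linear term vanishes with the initial velocity. -/
theorem eq_add_fracInt_ceil {α t : ℝ} (hα : 0 < α) (hα2 : α ≤ 2) {g : ℝ → ℂ} {g0 : ℂ}
    (hg : CaputoRegular α g) (h0 : Tendsto g (𝓝[>] 0) (𝓝 g0))
    (h1 : 1 < α → Tendsto (deriv g) (𝓝[>] 0) (𝓝 0)) (ht : 0 < t) :
    g t = g0 + fracInt ⌈α⌉₊ (iteratedDeriv ⌈α⌉₊ g) t := by
  obtain ⟨hc, hi⟩ := hg
  rcases le_or_gt α 1 with hle | hlt
  · have hm : ⌈α⌉₊ = 1 := by rw [Nat.ceil_eq_iff one_ne_zero]; simp [hα, hle]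
    rw [hm] at hc hi ⊢
    rw [Nat.cast_one, fracInt_one, iteratedDeriv_one]
    refine eq_add_integral_deriv ht (hc.differentiableOn (by simp)) ?_ h0
    simpa [iteratedDeriv_one] using hi t ht
  · have hm : ⌈α⌉₊ = 2 := by rw [Nat.ceil_eq_iff two_ne_zero]; simp [hlt, hα2]
    rw [hm] at hc hi ⊢
    have hid : iteratedDeriv 2 g = deriv (deriv g) := by
      rw [iteratedDeriv_succ, iteratedDeriv_one]
    rw [hid] at hi ⊢
    have hc' := (contDiffOn_succ_iff_deriv_of_isOpen (n := 1) isOpen_Ioi).1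
      (by simpa [one_add_one_eq_two] using hc)
    have h2 : ∀ s, 0 < s → deriv g s = 0 + ∫ r in (0 : ℝ)..s, deriv (deriv g) r := fun s hs =>
      eq_add_integral_deriv hs (hc'.2.2.differentiableOn (by simp)) (hi s hs) (h1 hlt)
    have hcont : ContinuousOn (fun s => ∫ r in (0 : ℝ)..s, deriv (deriv g) r) (Icc 0 t) := by
      have := intervalIntegral.continuousOn_primitive_interval (a := 0) (b := t) (f := deriv (deriv g))
        (μ := volume) (by
          have := hi t ht
          rw [intervalIntegrable_iff'] at this
          exact this)
      rwa [uIcc_of_le ht.le] at this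
    have hii : IntervalIntegrable (deriv g) volume 0 t := by
      have : IntervalIntegrable (fun s => ∫ r in (0 : ℝ)..s, deriv (deriv g) r) volume 0 t :=
        ContinuousOn.intervalIntegrable (by rwa [uIcc_of_le ht.le])
      refine this.congr fun s hs => ?_
      rw [uIoc_of_le ht.le] at hs
      rw [h2 s hs.1, zero_add]
    rw [eq_add_integral_deriv ht hc'.1 hii h0, ← fracInt_one]
    have h3 := fracInt_comp (a := 1) (b := 1) one_pos one_pos (by norm_num) ht (hi t ht)
    rw [one_add_one_eq_two] at h3
    rw [Nat.cast_ofNat, ← h3, fracInt_congr ht.le fun s hs _ => (h2 s hs).trans ?_]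
    rw [zero_add, fracInt_one]

/-- A regular function is recovered from its initial values and its Caputo derivative by
fractional integration. -/
theorem eq_add_fracInt_caputoDeriv {α t : ℝ} (hα : 0 < α) (hα2 : α ≤ 2) {g : ℝ → ℂ} {g0 : ℂ}
    (hg : CaputoRegular α g) (h0 : Tendsto g (𝓝[>] 0) (𝓝 g0))
    (h1 : 1 < α → Tendsto (deriv g) (𝓝[>] 0) (𝓝 0)) (ht : 0 < t) :
    g t = g0 + fracInt α (caputoDeriv α g) t := by
  rw [eq_add_fracInt_ceil hα hα2 hg h0 h1 ht]
  congr 1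
  by_cases h : α = ⌈α⌉₊
  · have : caputoDeriv α g = iteratedDeriv ⌈α⌉₊ g := by
      ext s; rw [caputoDeriv, if_pos h]
    rw [this, ← h]
  -- With `m = ⌈α⌉`, the semigroup law collapses `I^α I^(m - α) g⁽ᵐ⁾` to the Taylor remainder `I^m
  -- g⁽ᵐ⁾`.
  · have : caputoDeriv α g = fracInt (⌈α⌉₊ - α) (iteratedDeriv ⌈α⌉₊ g) := by
      ext s; rw [caputoDeriv, if_neg h, fracInt]
    have hlt : α < ⌈α⌉₊ := lt_of_le_of_ne (Nat.le_ceil α) h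
    have h1 : (1 : ℝ) ≤ ⌈α⌉₊ := by exact_mod_cast Nat.one_le_ceil_iff.2 hα
    rw [this, fracInt_comp hα (sub_pos.2 hlt) (by linarith) ht (hg.2 t ht), add_sub_cancel]

/-! ### Regularity from chains of fractional integral equations. -/

theorem hasDerivAt_normPow {γ t : ℝ} (hγ : 0 < γ) (ht : 0 < t) :
    HasDerivAt (normPow γ) (normPow (γ - 1) t) t := by
  have h := (Real.hasDerivAt_rpow_const (p := γ) (Or.inl ht.ne')).div_const (Real.Gamma (γ + 1))
  have e : normPow (γ - 1) t = γ * t ^ (γ - 1) / Real.Gamma (γ + 1) := by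
    rw [normPow, sub_add_cancel, Real.Gamma_add_one hγ.ne']
    field_simp
  rw [e]
  exact h

/-- By the semigroup law `I^b f` is the primitive of `I^(b - 1) f`, which is continuous. -/
theorem hasDerivAt_fracInt {b t : ℝ} {f : ℝ → ℂ} (hb : 1 < b) (hf : Continuous f) (ht : 0 < t) :
    HasDerivAt (fracInt b f) (fracInt (b - 1) f t) t := by
  have hc := continuousOn_fracInt (a := b - 1) (by linarith) hf
  have e : ∀ s, 0 < s → fracInt b f s = ∫ r in (0 : ℝ)..s, fracInt (b - 1) f r := by
    intro s hs
    rw [← fracInt_one, fracInt_comp_of_continuousOn one_pos (by linarith) hs hf.continuousOn,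
      add_sub_cancel]
  have h : HasDerivAt (fun s => ∫ r in (0 : ℝ)..s, fracInt (b - 1) f r) (fracInt (b - 1) f t) t := by
    apply intervalIntegral.integral_hasDerivAt_right
    · apply ContinuousOn.intervalIntegrable
      rw [uIcc_of_le ht.le]
      exact hc.mono Icc_subset_Ici_self
    · exact ContinuousOn.stronglyMeasurableAtFilter isOpen_Ioi (hc.mono Ioi_subset_Ici_self) t ht
    · exact hc.continuousAt (Ici_mem_nhds ht)
  refine h.congr_of_eventuallyEq ?_
  filter_upwards [Ioi_mem_nhds ht] with s hs using e s hs

theorem continuousOn_normPow (γ : ℝ) : ContinuousOn (normPow γ) (Ioi 0) := by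
  intro t ht
  exact ((Real.continuousAt_rpow_const t γ (Or.inl (ne_of_gt ht))).div_const _).continuousWithinAt

theorem continuous_normPow {γ : ℝ} (hγ : 0 ≤ γ) : Continuous (normPow γ) :=
  (Real.continuous_rpow_const hγ).div_const _

theorem intervalIntegrable_normPow {γ : ℝ} (hγ : -1 < γ) (a b : ℝ) :
    IntervalIntegrable (fun t => (normPow γ t : ℂ)) volume a b := by
  have := (intervalIntegral.intervalIntegrable_rpow' (a := a) (b := b) hγ).div_const (Real.Gamma (γ + 1))
  rw [intervalIntegrable_iff] at this ⊢
  exact this.ofReal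

section FracChain

variable {α : ℝ} {Φ : ℕ → ℝ → ℂ} {A : ℕ → ℂ}

/-- Substituting the chain into itself gives a Taylor expansion in powers of `t ^ α`. The order `(M
+ 1) α` of the remainder can be made as large as desired, so continuity of the `Φ j` alone yields
any smoothness on `(0, ∞)`. -/
theorem fracChain_expand (hα : 0 < α) (hΦ : ∀ j, Continuous (Φ j))
    (h : ∀ j t, 0 < t → Φ j t = A j + fracInt α (Φ (j + 1)) t) (M j : ℕ) {t : ℝ} (ht : 0 < t) :
    Φ j t = ∑ n ∈ Finset.range (M + 1), A (j + n) * normPow (n * α) t +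
      fracInt ((M + 1) * α) (Φ (j + M + 1)) t := by
  induction M generalizing j t with
  | zero => simp [h j t ht, normPow]
  | succ M ih =>
    have hM : 0 < ((M : ℝ) + 1) * α := by positivity
    rw [h j t ht, fracInt_congr ht.le fun s hs _ => ih (j + 1) hs, fracInt_add,
      fracInt_sum_const_mul, fracInt_comp_of_continuousOn hα hM ht (hΦ _).continuousOn,
      Finset.sum_range_succ' _ (M + 1), add_comm _ (A (j + 0) * _), ← add_assoc]
    · congr 1
      · congr 1
        · simp [normPow]
        · refine Finset.sum_congr rfl fun n _ => ?_
          rw [fracInt_normPow hα (by have : 0 ≤ n * α := by positivity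
                                     linarith) ht]
          push_cast
          rw [add_right_comm, ← add_assoc, show (n : ℝ) * α + α = (n + 1) * α by ring]
      · push_cast
        rw [show α + ((M : ℝ) + 1) * α = (M + 1 + 1) * α by ring,
          show j + 1 + M + 1 = j + (M + 1) + 1 by ring]
    · intro n _
      exact intervalIntegrable_kernel_smul hα ht.le
        (Complex.continuous_ofReal.comp (continuous_normPow (by positivity))).continuousOn
    · refine intervalIntegrable_kernel_smul hα ht.le (Continuous.continuousOn ?_)
      refine continuous_finsetSum _ fun n _ => continuous_const.mul ?_
      exact Complex.continuous_ofReal.comp (continuous_normPow (by positivity))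
    · exact intervalIntegrable_kernel_smul hα ht.le (continuousOn_fracInt hM (hΦ _))

/-- The `i`-th derivative of the expansion of a chain of fractional integrals. -/
def chainDeriv (α : ℝ) (A : ℕ → ℂ) (f : ℝ → ℂ) (M : ℕ) (i : ℝ) (t : ℝ) : ℂ :=
  ∑ n ∈ Finset.range M, A (n + 1) * normPow ((n + 1) * α - i) t + fracInt ((M + 1) * α - i) f t

theorem hasDerivAt_chainDeriv {f : ℝ → ℂ} (hf : Continuous f) {M : ℕ} {i t : ℝ}
    (hα : 0 < α) (hi : i < α) (hM : i + 1 < (M + 1) * α) (ht : 0 < t) :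
    HasDerivAt (chainDeriv α A f M i) (chainDeriv α A f M (i + 1) t) t := by
  unfold chainDeriv
  simp only [← sub_sub]
  refine HasDerivAt.add (HasDerivAt.fun_sum fun n _ => ?_) (hasDerivAt_fracInt (by linarith) hf ht)
  refine HasDerivAt.const_mul _ (hasDerivAt_normPow ?_ ht).ofReal_comp
  have : 0 ≤ n * α := by positivity
  linarith

theorem continuousOn_chainDeriv {f : ℝ → ℂ} (hf : Continuous f) {M : ℕ} {i : ℝ}
    (hM : i < (M + 1) * α) : ContinuousOn (chainDeriv α A f M i) (Ioi 0) := by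
  refine ContinuousOn.add (continuousOn_finsetSum _ fun n _ => continuousOn_const.mul ?_)
    ((continuousOn_fracInt (by linarith) hf).mono Ioi_subset_Ici_self)
  exact Complex.continuous_ofReal.comp_continuousOn (continuousOn_normPow _)

theorem fracInt_zero (a : ℝ) (f : ℝ → ℂ) : fracInt a f 0 = 0 := by simp [fracInt]

theorem tendsto_fracInt_zero {a : ℝ} {f : ℝ → ℂ} (ha : 0 < a) (hf : Continuous f) :
    Tendsto (fracInt a f) (𝓝[>] 0) (𝓝 0) := by
  have := (continuousOn_fracInt ha hf 0 self_mem_Ici).tendsto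
  rw [fracInt_zero] at this
  exact this.mono_left (nhdsWithin_mono _ Ioi_subset_Ici_self)

theorem tendsto_chainDeriv_zero {f : ℝ → ℂ} (hf : Continuous f) {M : ℕ} {i : ℝ} (hα : 0 < α)
    (hi : i < α) : Tendsto (chainDeriv α A f M i) (𝓝[>] 0) (𝓝 0) := by
  have hpos : ∀ n : ℕ, 0 < ((n : ℝ) + 1) * α - i := fun n => by
    have : 0 ≤ n * α := by positivity
    linarith
  rw [← add_zero (0 : ℂ)]
  refine Tendsto.add ?_ (tendsto_fracInt_zero (hpos M) hf)
  rw [← Finset.sum_const_zero (s := Finset.range M) (M := ℂ)]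
  refine tendsto_finsetSum (M := ℂ) (Finset.range M) fun n _ => ?_
  have h : Continuous fun t => A (n + 1) * (normPow ((n + 1) * α - i) t : ℂ) :=
    continuous_const.mul (Complex.continuous_ofReal.comp (continuous_normPow (hpos n).le))
  have h0 := (h.tendsto 0).mono_left (nhdsWithin_le_nhds (s := Ioi 0))
  simpa [normPow, Real.zero_rpow (hpos n).ne'] using h0

/-- The most singular power is `t ^ (α - i)`, integrable at `0` because `i < α + 1`; this covers `i
= ⌈α⌉`. -/
theorem intervalIntegrable_chainDeriv {f : ℝ → ℂ} (hf : Continuous f) {M : ℕ} {i t : ℝ} (hα : 0 < α)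
    (hi : i < α + 1) (hM : i < (M + 1) * α) (ht : 0 < t) :
    IntervalIntegrable (chainDeriv α A f M i) volume 0 t := by
  refine IntervalIntegrable.add ?_ ?_
  · rw [← Finset.sum_fn]
    refine IntervalIntegrable.sum _ fun n _ => (intervalIntegrable_normPow ?_ 0 t).const_mul _
    have : 0 ≤ n * α := by positivity
    linarith
  · apply ContinuousOn.intervalIntegrable
    rw [uIcc_of_le ht.le]
    exact (continuousOn_fracInt (by linarith) hf).mono Icc_subset_Ici_self

theorem fracInt_chainDeriv {f : ℝ → ℂ} (hf : Continuous f) {M : ℕ} {i b t : ℝ} (hα : 0 < α)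
    (hi : i < α + 1) (hM : i < (M + 1) * α) (hb : 0 < b) (ht : 0 < t) :
    fracInt b (chainDeriv α A f M i) t = chainDeriv α A f M (i - b) t := by
  have hpos : ∀ n : ℕ, -1 < ((n : ℝ) + 1) * α - i := fun n => by
    have : 0 ≤ n * α := by positivity
    linarith
  have hk : ∀ n : ℕ, IntervalIntegrable
      (fun s : ℝ => (t - s) ^ (b - 1) • (normPow ((n + 1) * α - i) s : ℂ)) volume 0 t := fun n => by
    have h := ((beta_kernel hb (b := (n + 1) * α - i + 1) (by linarith [hpos n]) ht).1.div_const
      (Real.Gamma ((n + 1) * α - i + 1)))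
    rw [intervalIntegrable_iff] at h ⊢
    refine h.ofReal.congr (Eventually.of_forall fun s => ?_)
    simp [normPow, mul_div_assoc]
  have hsum : IntervalIntegrable (fun s : ℝ => (t - s) ^ (b - 1) •
      ∑ n ∈ Finset.range M, A (n + 1) * (normPow ((n + 1) * α - i) s : ℂ)) volume 0 t := by
    simp only [Finset.smul_sum, ← mul_smul_comm]
    have := IntervalIntegrable.sum (Finset.range M) fun n _ => (hk n).const_mul (A (n + 1))
    rwa [Finset.sum_fn] at this
  unfold chainDeriv
  rw [fracInt_add hsum
    (intervalIntegrable_kernel_smul hb ht.le (continuousOn_fracInt (by linarith) hf)),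
    fracInt_sum_const_mul _ _ fun n _ => hk n,
    fracInt_comp_of_continuousOn hb (by linarith) ht hf.continuousOn]
  congr 1
  · refine Finset.sum_congr rfl fun n _ => ?_
    rw [fracInt_normPow hb (hpos n) ht, sub_sub_eq_add_sub, add_sub_right_comm]
  · congr 1; ring

/-- A converse to `eq_add_fracInt_caputoDeriv`. A single integral equation does not make `g`
differentiable; the whole chain does. -/
theorem caputo_fracChain (hα : 0 < α) (hα2 : α ≤ 2) (hΦ : ∀ j, Continuous (Φ j))
    (h : ∀ j t, 0 < t → Φ j t = A j + fracInt α (Φ (j + 1)) t) {g : ℝ → ℂ}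
    (hg : ∀ t, 0 < t → g t = Φ 0 t) :
    CaputoRegular α g ∧ (∀ t, 0 < t → caputoDeriv α g t = Φ 1 t) ∧
      Tendsto g (𝓝[>] 0) (𝓝 (A 0)) ∧ (1 < α → Tendsto (deriv g) (𝓝[>] 0) (𝓝 0)) := by
  -- Since `⌈α⌉ < α + 1 ≤ 3`, a remainder of order above `3` can be differentiated `⌈α⌉` times.
  obtain ⟨M, hM⟩ := exists_nat_gt (3 / α)
  have hMα : 3 < (M + 1) * α := by
    rw [div_lt_iff₀ hα] at hM
    linarith
  set f := Φ (M + 1) with hf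
  have hfc : Continuous f := hΦ _
  -- `G i` represents the derivative of order `i` of `g - A 0`. Real `i` are allowed because the
  -- Caputo derivative itself is `G α`, which is also the expansion of `Φ 1`.
  set G := chainDeriv α A f M with hG
  have e0 : ∀ t, 0 < t → g t = A 0 + G 0 t := by
    intro t ht
    rw [hg t ht, fracChain_expand hα hΦ h M 0 ht, Finset.sum_range_succ']
    simp [hG, chainDeriv, normPow, hf]
    ring
  have e1 : ∀ t, 0 < t → Φ 1 t = G α t := by
    intro t ht
    obtain ⟨M', rfl⟩ : ∃ M', M = M' + 1 := by
      refine Nat.exists_eq_succ_of_ne_zero ?_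
      rintro rfl
      norm_num at hMα
      linarith
    rw [fracChain_expand hα hΦ h M' 1 ht]
    simp only [hG, chainDeriv, hf]
    congr 1
    · refine Finset.sum_congr rfl fun n _ => ?_
      rw [add_comm 1 n, show ((n : ℝ) + 1) * α - α = n * α by ring]
    · push_cast
      rw [show ((M' : ℝ) + 1 + 1) * α - α = (M' + 1) * α by ring, show 1 + M' + 1 = M' + 1 + 1 by ring]
  have d1 : ∀ t, 0 < t → HasDerivAt g (G 1 t) t := by
    intro t ht
    have := (hasDerivAt_chainDeriv (A := A) hfc hα (i := 0) hα (by linarith : (0 : ℝ) + 1 < (M + 1) * α) ht).const_add (A 0)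
    rw [zero_add] at this
    refine this.congr_of_eventuallyEq ?_
    filter_upwards [Ioi_mem_nhds ht] with s hs using e0 s hs
  have hd1 : ∀ t, 0 < t → deriv g t = G 1 t := fun t ht => (d1 t ht).deriv
  have hgd : DifferentiableOn ℝ g (Ioi 0) := fun t ht => (d1 t ht).differentiableAt.differentiableWithinAt
  have hlim : Tendsto g (𝓝[>] 0) (𝓝 (A 0)) := by
    have := (tendsto_chainDeriv_zero (A := A) hfc (M := M) hα hα).const_add (A 0)
    rw [add_zero] at this
    refine this.congr' ?_
    filter_upwards [self_mem_nhdsWithin] with s hs using (e0 s hs).symm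
  have hlim' : 1 < α → Tendsto (deriv g) (𝓝[>] 0) (𝓝 0) := by
    intro h1
    refine (tendsto_chainDeriv_zero (A := A) hfc (M := M) hα h1).congr' ?_
    filter_upwards [self_mem_nhdsWithin] with s hs using (hd1 s hs).symm
  -- the derivative of order `⌈α⌉`
  have key : ContDiffOn ℝ ⌈α⌉₊ g (Ioi 0) ∧ ∀ t, 0 < t → iteratedDeriv ⌈α⌉₊ g t = G ⌈α⌉₊ t := by
    rcases le_or_gt α 1 with hle | hlt
    · have hm : ⌈α⌉₊ = 1 := by rw [Nat.ceil_eq_iff one_ne_zero]; simp [hα, hle]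
      rw [hm]
      refine ⟨?_, by simpa using hd1⟩
      refine (contDiffOn_succ_iff_deriv_of_isOpen (n := 0) isOpen_Ioi).2 ⟨hgd, by simp, ?_⟩
      rw [contDiffOn_zero]
      exact (continuousOn_chainDeriv hfc (by linarith)).congr hd1
    · have hm : ⌈α⌉₊ = 2 := by rw [Nat.ceil_eq_iff two_ne_zero]; simp [hlt, hα2]
      rw [hm]
      have d2 : ∀ t, 0 < t → HasDerivAt (deriv g) (G 2 t) t := by
        intro t ht
        have := (hasDerivAt_chainDeriv (A := A) hfc hα (i := 1) hlt (by linarith : (1 : ℝ) + 1 < (M + 1) * α) ht)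
        rw [one_add_one_eq_two] at this
        refine this.congr_of_eventuallyEq ?_
        filter_upwards [Ioi_mem_nhds ht] with s hs using hd1 s hs
      constructor
      · have : ContDiffOn ℝ (1 + 1) g (Ioi 0) := by
          refine (contDiffOn_succ_iff_deriv_of_isOpen (n := 1) isOpen_Ioi).2 ⟨hgd, by simp, ?_⟩
          refine (contDiffOn_succ_iff_deriv_of_isOpen (n := 0) isOpen_Ioi).2
            ⟨fun t ht => (d2 t ht).differentiableAt.differentiableWithinAt, by simp, ?_⟩
          rw [contDiffOn_zero]
          exact (continuousOn_chainDeriv hfc (by linarith)).congr fun t ht => (d2 t ht).deriv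
        simpa [one_add_one_eq_two] using this
      · intro t ht
        rw [iteratedDeriv_succ, iteratedDeriv_one, (d2 t ht).deriv, Nat.cast_ofNat]
  have hm1 : (⌈α⌉₊ : ℝ) < α + 1 := Nat.ceil_lt_add_one hα.le
  have hm2 : (⌈α⌉₊ : ℝ) < (M + 1) * α := by linarith
  refine ⟨⟨key.1, fun t ht => ?_⟩, fun t ht => ?_, hlim, hlim'⟩
  · refine (intervalIntegrable_chainDeriv (A := A) hfc hα hm1 hm2 ht).congr fun s hs => ?_
    rw [uIoc_of_le ht.le] at hs
    exact (key.2 s hs.1).symm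
  · rw [e1 t ht]
    by_cases hc : α = ⌈α⌉₊
    · rw [caputoDeriv, if_pos hc, key.2 t ht, ← hc]
    · have hlt : α < ⌈α⌉₊ := lt_of_le_of_ne (Nat.le_ceil α) hc
      have : caputoDeriv α g t = fracInt (⌈α⌉₊ - α) (iteratedDeriv ⌈α⌉₊ g) t := by
        rw [caputoDeriv, if_neg hc, fracInt]
      rw [this, fracInt_congr ht.le fun s hs _ => key.2 s hs, hG,
        fracInt_chainDeriv hfc hα hm1 hm2 (sub_pos.2 hlt) ht, sub_sub_cancel]

end FracChain

/-! ### Laws on the positive half line with a prescribed Mellin transform. -/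

/-- `μ` is a probability measure on `(0, ∞)` with Mellin transform `∫ x ^ s dμ = f s` for
`s ≥ -1/2`. -/
structure HasMellin (μ : Measure ℝ) (f : ℝ → ℝ) : Prop where
  prob : IsProbabilityMeasure μ
  pos : ∀ᵐ x ∂μ, 0 < x
  nonneg : ∀ s, -(1 / 2) ≤ s → 0 ≤ f s
  mellin : ∀ s, -(1 / 2) ≤ s → ∫⁻ x, ENNReal.ofReal (x ^ s) ∂μ = ENNReal.ofReal (f s)

theorem HasMellin.congr {μ : Measure ℝ} {f g : ℝ → ℝ} (h : HasMellin μ f)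
    (hfg : ∀ s, -(1 / 2) ≤ s → f s = g s) : HasMellin μ g :=
  ⟨h.prob, h.pos, fun s hs => hfg s hs ▸ h.nonneg s hs, fun s hs => hfg s hs ▸ h.mellin s hs⟩

theorem hasMellin_dirac {c : ℝ} (hc : 0 < c) : HasMellin (Measure.dirac c) (fun s => c ^ s) where
  prob := inferInstance
  pos := by rw [ae_dirac_eq]; exact hc
  nonneg s _ := by positivity
  mellin s _ := by simp

/-- The law of a product of two independent variables: moments of any real order multiply. -/
theorem HasMellin.mul {μ ρ : Measure ℝ} {f g : ℝ → ℝ} (hμ : HasMellin μ f) (hρ : HasMellin ρ g) :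
    HasMellin ((μ.prod ρ).map fun p => p.1 * p.2) (fun s => f s * g s) := by
  have := hμ.prob
  have := hρ.prob
  have hm : Measurable fun p : ℝ × ℝ => p.1 * p.2 := by fun_prop
  have hpos : ∀ᵐ p ∂(μ.prod ρ), 0 < p.1 ∧ 0 < p.2 := by
    have h1 : ∀ᵐ p ∂(μ.prod ρ), 0 < p.1 := Measure.quasiMeasurePreserving_fst.ae hμ.pos
    have h2 : ∀ᵐ p ∂(μ.prod ρ), 0 < p.2 := Measure.quasiMeasurePreserving_snd.ae hρ.pos
    exact h1.and h2
  refine ⟨Measure.isProbabilityMeasure_map hm.aemeasurable, ?_,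
    fun s hs => mul_nonneg (hμ.nonneg s hs) (hρ.nonneg s hs), fun s hs => ?_⟩
  · rw [ae_map_iff hm.aemeasurable measurableSet_Ioi]
    filter_upwards [hpos] with p hp using mul_pos hp.1 hp.2
  · rw [lintegral_map (by fun_prop) hm, ENNReal.ofReal_mul (hμ.nonneg s hs), ← hμ.mellin s hs,
      ← hρ.mellin s hs, ← lintegral_prod_mul (by fun_prop) (by fun_prop)]
    refine lintegral_congr_ae ?_
    filter_upwards [hpos] with p hp
    rw [Real.mul_rpow hp.1.le hp.2.le, ENNReal.ofReal_mul (Real.rpow_nonneg hp.1.le _)]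

/-- The law with density `q r ^ (q - 1)` on `(0, 1)`. -/
def powLaw (q : ℝ) : Measure ℝ :=
  (volume.restrict (Ioo (0 : ℝ) 1)).withDensity fun r => ENNReal.ofReal (q * r ^ (q - 1))

theorem powLaw_absolutelyContinuous (q : ℝ) : powLaw q ≪ volume :=
  (withDensity_absolutelyContinuous _ _).trans Measure.absolutelyContinuous_restrict

theorem hasMellin_powLaw {q : ℝ} (hq : 1 ≤ q) : HasMellin (powLaw q) (fun s => q / (q + s)) := by
  have key : ∀ s, -(1 / 2) ≤ s →
      ∫⁻ x, ENNReal.ofReal (x ^ s) ∂(powLaw q) = ENNReal.ofReal (q / (q + s)) := by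
    intro s hs
    have hpos : 0 < q + s := by linarith
    rw [powLaw, lintegral_withDensity_eq_lintegral_mul _ (by fun_prop) (by fun_prop)]
    have e : ∀ x ∈ Ioo (0 : ℝ) 1, ((fun r => ENNReal.ofReal (q * r ^ (q - 1))) *
        fun x => ENNReal.ofReal (x ^ s)) x = ENNReal.ofReal (q * x ^ (q + s - 1)) := by
      intro x hx
      rw [Pi.mul_apply, ← ENNReal.ofReal_mul
        (mul_nonneg (by linarith) (Real.rpow_nonneg hx.1.le _)), mul_assoc, ← Real.rpow_add hx.1]
      ring_nf
    rw [setLIntegral_congr_fun measurableSet_Ioo e, setLIntegral_congr Ioo_ae_eq_Ioc]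
    have hi := (intervalIntegral.intervalIntegrable_rpow' (a := 0) (b := 1) (r := q + s - 1)
      (by linarith)).const_mul q
    rw [intervalIntegrable_iff_integrableOn_Ioc_of_le zero_le_one] at hi
    rw [← ofReal_integral_eq_lintegral_ofReal hi]
    · rw [← intervalIntegral.integral_of_le zero_le_one, intervalIntegral.integral_const_mul,
        integral_rpow (Or.inl (by linarith))]
      simp [Real.zero_rpow hpos.ne', div_eq_mul_inv]
    · filter_upwards [ae_restrict_mem measurableSet_Ioc] with x hx
      exact mul_nonneg (by linarith) (Real.rpow_nonneg hx.1.le _)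
  refine ⟨⟨?_⟩, ?_, fun s hs => div_nonneg (by linarith) (by linarith), key⟩
  · have := key 0 (by norm_num)
    simpa [div_self (by linarith : q ≠ 0)] using this
  · refine (withDensity_absolutelyContinuous _ _).ae_le ?_
    filter_upwards [ae_restrict_mem measurableSet_Ioo] with x hx using hx.1

theorem exists_hasMellin_mixture {q w : ℝ} (hq : 1 ≤ q) (hw : 0 ≤ w) (hw1 : w ≤ 1) :
    ∃ ρ, HasMellin ρ (fun s => (1 - w) + w * (q / (q + s))) := by
  have h1 := hasMellin_dirac one_pos
  have h2 := hasMellin_powLaw hq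
  have := h2.prob
  refine ⟨ENNReal.ofReal (1 - w) • Measure.dirac 1 + ENNReal.ofReal w • powLaw q,
    ⟨?_⟩, ?_, fun s hs => ?_, fun s hs => ?_⟩
  · simp only [Measure.coe_add, Measure.coe_smul, Pi.add_apply, Pi.smul_apply, measure_univ,
      smul_eq_mul, mul_one]
    rw [← ENNReal.ofReal_add (by linarith) hw]
    simp
  · rw [ae_add_measure_iff]
    exact ⟨Measure.ae_smul_measure h1.pos _, Measure.ae_smul_measure h2.pos _⟩
  · have := h2.nonneg s hs
    have : 0 ≤ w * (q / (q + s)) := mul_nonneg hw this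
    linarith
  · rw [lintegral_add_measure, lintegral_smul_measure, lintegral_smul_measure, h1.mellin s hs,
      h2.mellin s hs, Real.one_rpow, smul_eq_mul, smul_eq_mul, ← ENNReal.ofReal_mul (by linarith),
      ← ENNReal.ofReal_mul hw, ← ENNReal.ofReal_add (by linarith)
        (mul_nonneg hw (h2.nonneg s hs)), mul_one]

/-- Each factor is `ν + (1 - ν) (k + 1) / (k + 1 + s)`, the Mellin transform of a mixture of a Dirac
mass at `1` and a power law. -/
theorem exists_hasMellin_prod {ν : ℝ} (hν : 0 < ν) (hν1 : ν < 1) (N : ℕ) :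
    ∃ μ, HasMellin μ (fun s => ∏ k ∈ Finset.range N, ((k + 1 + ν * s) / (k + 1 + s))) := by
  induction N with
  | zero => exact ⟨_, (hasMellin_dirac one_pos).congr fun s _ => by simp⟩
  | succ N ih =>
    obtain ⟨μ, hμ⟩ := ih
    obtain ⟨ρ, hρ⟩ := exists_hasMellin_mixture (q := N + 1) (w := 1 - ν) (by simp)
      (by linarith) (by linarith)
    refine ⟨_, (hμ.mul hρ).congr fun s hs => ?_⟩
    rw [Finset.prod_range_succ]
    have : (N : ℝ) + 1 + s ≠ 0 := by
      have : (0 : ℝ) ≤ N := by positivity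
      linarith
    congr 1
    field_simp
    ring

/-! ### Euler's product for the Gamma quotient. -/

/-- Approximation of the Mellin transform `Γ(1 + s) / Γ(1 + ν s) * (K + s) / K`. -/
def approxMellin (ν : ℝ) (K N : ℕ) (s : ℝ) : ℝ :=
  (N : ℝ) ^ ((1 - ν) * s) * ((∏ k ∈ Finset.range N, ((k + 1 + ν * s) / (k + 1))) *
    (∏ k ∈ Finset.range (N + 1), (((k : ℝ) + 1) / (k + 1 + s))) * ((K + s) / K))

theorem add_one_add_pos {s : ℝ} (hs : -(1 / 2) ≤ s) (k : ℕ) : 0 < (k : ℝ) + 1 + s := by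
  have : (0 : ℝ) ≤ k := k.cast_nonneg
  linarith

/-- The factor `(K + s) / K` is inserted so that an independent variable of law `powLaw K` can later
cancel it and supply a density. It cancels one denominator of the product, so for the remaining
factors the numerator of index `N + 1` is paired with the denominator of index `N + 2`. The pair is
again a mixture, of weight `1 - ν (N + 2) / (N + 1)`, which is nonnegative for large `N`; hence the
choice of `K`. -/
theorem exists_hasMellin_approx {ν : ℝ} (hν : 0 < ν) (hν1 : ν < 1) :
    ∃ K : ℕ, 1 ≤ K ∧ ∀ N : ℕ, K ≤ N → ∃ μ, HasMellin μ (approxMellin ν K N) := by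
  obtain ⟨K, hK⟩ := exists_nat_gt (2 / (1 - ν))
  have h1ν : 0 < 1 - ν := by linarith
  rw [div_lt_iff₀ h1ν] at hK
  have hK0 : (0 : ℝ) ≤ K := K.cast_nonneg
  have main : ∀ N : ℕ, K ≤ N → ∃ μ, HasMellin μ (fun s =>
      (∏ k ∈ Finset.range N, ((k + 1 + ν * s) / (k + 1))) *
      (∏ k ∈ Finset.range (N + 1), (((k : ℝ) + 1) / (k + 1 + s))) * (((K + 1 : ℕ) + s) / (K + 1 : ℕ))) := by
    intro N hN
    induction N, hN using Nat.le_induction with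
    | base =>
      obtain ⟨μ, hμ⟩ := exists_hasMellin_prod hν hν1 K
      refine ⟨μ, hμ.congr fun s hs => ?_⟩
      rw [Finset.prod_range_succ, ← mul_assoc, ← Finset.prod_mul_distrib, mul_assoc]
      have hp := add_one_add_pos hs K
      push_cast
      rw [div_mul_div_cancel₀ hp.ne', div_self (by linarith), mul_one]
      refine Finset.prod_congr rfl fun k _ => ?_
      have := add_one_add_pos hs k
      field_simp
    | succ N hN ih =>
      obtain ⟨μ, hμ⟩ := ih
      have hN0 : (K : ℝ) ≤ N := by exact_mod_cast hN
      have hN1 : (0 : ℝ) < N + 1 := by positivity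
      have hle : ν * (N + 2) / (N + 1) ≤ 1 := by
        rw [div_le_one hN1]
        nlinarith
      obtain ⟨ρ, hρ⟩ := exists_hasMellin_mixture (q := N + 2) (w := 1 - ν * (N + 2) / (N + 1))
        (by linarith) (by linarith) (by
          have : 0 ≤ ν * (N + 2) / (N + 1) := by positivity
          linarith)
      refine ⟨_, (hμ.mul hρ).congr fun s hs => ?_⟩
      have hp := add_one_add_pos hs (N + 1)
      have e : 1 - (1 - ν * (N + 2) / (N + 1)) + (1 - ν * (N + 2) / (N + 1)) * ((N + 2) / (N + 2 + s))
          = ((N + 1 + ν * s) / (N + 1)) * (((N + 1 : ℕ) + 1) / ((N + 1 : ℕ) + 1 + s)) := by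
        push_cast at hp ⊢
        have : (N : ℝ) + 2 + s ≠ 0 := by linarith
        rw [show (N : ℝ) + 1 + 1 = N + 2 by ring]
        field_simp
        ring
      rw [e, Finset.prod_range_succ (fun k : ℕ => ((k : ℝ) + 1 + ν * s) / (k + 1)) N,
        Finset.prod_range_succ (fun k : ℕ => ((k : ℝ) + 1) / (k + 1 + s)) (N + 1)]
      ring
  refine ⟨K + 1, by omega, fun N hN => ?_⟩
  obtain ⟨μ, hμ⟩ := main N (by omega)
  have hN0 : (0 : ℝ) < N := by exact_mod_cast (by omega : 0 < N)
  -- Dilation by `N ^ (1 - ν)` contributes the power of `N` in Euler's formula.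
  refine ⟨_, ((hasMellin_dirac (Real.rpow_pos_of_pos hN0 (1 - ν))).mul hμ).congr fun s hs => ?_⟩
  rw [approxMellin, ← Real.rpow_mul hN0.le]

theorem prod_eq_GammaSeq (s : ℝ) {N : ℕ} (hN : N ≠ 0) :
    ∏ k ∈ Finset.range (N + 1), (((k : ℝ) + 1) / (k + 1 + s)) =
      Real.GammaSeq (s + 1) N * (N + 1) / (N : ℝ) ^ (s + 1) := by
  have hN0 : (0 : ℝ) < N := by exact_mod_cast Nat.pos_of_ne_zero hN
  have : (0 : ℝ) < (N : ℝ) ^ (s + 1) := Real.rpow_pos_of_pos hN0 _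
  rw [Real.GammaSeq, Finset.prod_div_distrib]
  have h1 : ∏ k ∈ Finset.range (N + 1), ((k : ℝ) + 1) = (N.factorial : ℝ) * (N + 1) := by
    have := Finset.prod_range_add_one_eq_factorial (N + 1)
    rw [Nat.factorial_succ] at this
    rw [mul_comm]
    exact_mod_cast this
  have h2 : ∏ k ∈ Finset.range (N + 1), ((k : ℝ) + 1 + s) =
      ∏ k ∈ Finset.range (N + 1), (s + 1 + k) := Finset.prod_congr rfl fun k _ => by ring
  rw [h1, h2]
  field_simp

theorem approxMellin_eq {ν s : ℝ} (hν : 0 < ν) (hν1 : ν < 1) (hs : -(1 / 2) ≤ s) (K : ℕ) {N : ℕ} (hN : N ≠ 0) :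
    approxMellin ν K N s = Real.GammaSeq (s + 1) N / Real.GammaSeq (ν * s + 1) N *
      ((N + 1) / (N + 1 + ν * s)) * ((K + s) / K) := by
  have hN0 : (0 : ℝ) < N := by exact_mod_cast Nat.pos_of_ne_zero hN
  have hνs : -(1 / 2) ≤ ν * s := by nlinarith
  have hp := add_one_add_pos hνs N
  have h1 := prod_eq_GammaSeq s hN
  have h2 := prod_eq_GammaSeq (ν * s) hN
  have h3 : ∏ k ∈ Finset.range N, ((k + 1 + ν * s) / ((k : ℝ) + 1)) =
      (∏ k ∈ Finset.range (N + 1), (((k : ℝ) + 1) / (k + 1 + ν * s)))⁻¹ * ((N + 1) / (N + 1 + ν * s)) := by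
    rw [← Finset.prod_inv_distrib, Finset.prod_range_succ, mul_assoc]
    simp only [inv_div]
    rw [div_mul_div_cancel₀ (by positivity), div_self hp.ne', mul_one]
  rw [approxMellin, h3, h1, h2, inv_div]
  have e : (N : ℝ) ^ ((1 - ν) * s) * (N : ℝ) ^ (ν * s + 1) = (N : ℝ) ^ (s + 1) := by
    rw [← Real.rpow_add hN0]; congr 1; ring
  have hx : (0 : ℝ) < (N : ℝ) ^ (s + 1) := Real.rpow_pos_of_pos hN0 _
  rw [show ∀ a b c d f g h i j k : ℝ, a * (b / (c * d) * f * (g * h / i) * (j / k)) = (a * b) * g * f * h * j / (c * d * i * k) by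
    intros; ring, e]
  have : (N : ℝ) + 1 ≠ 0 := by positivity
  field_simp

theorem tendsto_approxMellin {ν s : ℝ} (hν : 0 < ν) (hν1 : ν < 1) (hs : -(1 / 2) ≤ s) (K : ℕ) :
    Tendsto (fun N => approxMellin ν K N s) atTop
      (𝓝 (Real.Gamma (s + 1) / Real.Gamma (ν * s + 1) * ((K + s) / K))) := by
  have hνs : -(1 / 2) ≤ ν * s := by nlinarith
  have h1 : Tendsto (fun N : ℕ => ((N : ℝ) + 1) / (N + 1 + ν * s)) atTop (𝓝 1) := by
    have h := (tendsto_natCast_atTop_atTop (R := ℝ)).comp (tendsto_add_atTop_nat 1)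
    have h2 : Tendsto (fun x : ℝ => x / (x + ν * s)) atTop (𝓝 1) := by
      have h3 : Tendsto (fun x : ℝ => 1 - ν * s / (x + ν * s)) atTop (𝓝 (1 - 0)) :=
        tendsto_const_nhds.sub (tendsto_const_nhds.div_atTop (tendsto_atTop_add_const_right _ _ tendsto_id))
      rw [sub_zero] at h3
      refine h3.congr' ?_
      filter_upwards [eventually_gt_atTop (-(ν * s))] with x hx
      have : x + ν * s ≠ 0 := by linarith
      field_simp
      ring
    have := h2.comp h
    simpa [Function.comp_def] using this
  have h2 := (((Real.GammaSeq_tendsto_Gamma (s + 1)).div (Real.GammaSeq_tendsto_Gamma (ν * s + 1))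
    (Real.Gamma_pos_of_pos (by linarith)).ne').mul h1).mul_const ((K + s) / K : ℝ)
  rw [mul_one] at h2
  refine h2.congr' ?_
  filter_upwards [eventually_ne_atTop 0] with N hN
  rw [approxMellin_eq hν hν1 hs K hN, Pi.div_apply]

/-- For `s ≥ 0` a slightly larger sequence increases to the same limit, so the limit is a bound
uniform in `N`. It serves both for tightness, at `s = 1`, and as the dominating series for the even
moments. -/
theorem approxMellin_le {ν s : ℝ} (hν : 0 < ν) (hν1 : ν < 1) (hs : 0 ≤ s) (K : ℕ) {N : ℕ} (hN : N ≠ 0) :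
    approxMellin ν K N s ≤ Real.Gamma (s + 1) / Real.Gamma (ν * s + 1) * ((K + s) / K) := by
  set g : ℕ → ℝ := fun N => ((N : ℝ) + 1) ^ ((1 - ν) * s) *
    ∏ k ∈ Finset.range (N + 1), ((k + 1 + ν * s) / ((k : ℝ) + 1 + s)) with hg
  have hgpos : ∀ N, 0 < g N := fun N => mul_pos (by positivity)
    (Finset.prod_pos fun k _ => by positivity)
  have hmono : Monotone g := by
    refine monotone_nat_of_le_succ fun N => ?_
    simp only [hg]
    rw [Finset.prod_range_succ _ (N + 1)]
    set x : ℝ := (N : ℝ) + 2 with hx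
    have hx1 : (N : ℝ) + 1 = x - 1 := by rw [hx]; ring
    have hx0 : 1 < x := by rw [hx]; have : (0 : ℝ) ≤ N := N.cast_nonneg; linarith
    set a := (1 - ν) * s with ha
    have ha0 : 0 ≤ a := mul_nonneg (by linarith) hs
    have has : a ≤ s := by rw [ha]; nlinarith
    -- Monotonicity comes down to `(1 - 1/x)^a ≤ exp(-a/x) ≤ x/(x + a) ≤ (x + νs)/(x + s)` with `a =
    -- (1 - ν) s`.
    have key : (x - 1) ^ a ≤ x ^ a * ((x + ν * s) / (x + s)) := by
      have h1 : (1 - 1 / x) ^ a ≤ Real.exp (-(a / x)) := by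
        have : 1 - 1 / x ≤ Real.exp (-(1 / x)) := by
          have := Real.add_one_le_exp (-(1 / x)); linarith
        calc (1 - 1 / x) ^ a ≤ (Real.exp (-(1 / x))) ^ a :=
              Real.rpow_le_rpow (by rw [sub_nonneg, div_le_one (by linarith)]; exact hx0.le) this ha0
          _ = _ := by rw [← Real.exp_mul]; congr 1; ring
      have h2 : Real.exp (-(a / x)) ≤ x / (x + a) := by
        rw [Real.exp_neg, inv_le_comm₀ (Real.exp_pos _) (by positivity), inv_div]
        have := Real.add_one_le_exp (a / x)
        refine le_trans (le_of_eq ?_) this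
        field_simp
        ring
      have h3 : x / (x + a) ≤ (x + ν * s) / (x + s) := by
        rw [div_le_div_iff₀ (by linarith) (by linarith)]
        have : ν * s = s - a := by rw [ha]; ring
        rw [this]
        nlinarith
      have h4 : (x - 1) ^ a = x ^ a * (1 - 1 / x) ^ a := by
        rw [← Real.mul_rpow (by linarith) (by rw [sub_nonneg, div_le_one (by linarith)]; exact hx0.le)]
        congr 1
        field_simp
      rw [h4]
      gcongr
      exact h1.trans (h2.trans h3)
    have hP : 0 ≤ ∏ k ∈ Finset.range (N + 1), ((k + 1 + ν * s) / ((k : ℝ) + 1 + s)) :=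
      Finset.prod_nonneg fun k _ => by positivity
    push_cast
    rw [hx1, show x - 1 + 1 = x by ring]
    calc _ ≤ _ := mul_le_mul_of_nonneg_right key hP
      _ = _ := by ring
  have hKs : 0 ≤ ((K : ℝ) + s) / K := by positivity
  have hlim : Tendsto (fun N => g N * ((K + s) / K)) atTop
      (𝓝 (Real.Gamma (s + 1) / Real.Gamma (ν * s + 1) * ((K + s) / K))) := by
    have h1 : Tendsto (fun N : ℕ => ((N : ℝ) + 1 + 1 + s) / ((N : ℝ) + 1 + 1)) atTop (𝓝 1) := by
      have h2 : Tendsto (fun N : ℕ => 1 + s / ((N : ℝ) + 1 + 1)) atTop (𝓝 (1 + 0)) :=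
        tendsto_const_nhds.add (tendsto_const_nhds.div_atTop
          (tendsto_atTop_add_const_right _ _ (tendsto_atTop_add_const_right _ _ tendsto_natCast_atTop_atTop)))
      rw [add_zero] at h2
      refine h2.congr fun N => ?_
      have : (N : ℝ) + 1 + 1 ≠ 0 := by positivity
      field_simp
    have h3 := ((tendsto_approxMellin hν hν1 (by linarith : -(1 / 2) ≤ s) K).comp (tendsto_add_atTop_nat 1)).mul h1
    rw [mul_one] at h3
    refine h3.congr fun N => ?_
    simp only [Function.comp_apply, approxMellin, hg]
    rw [Finset.prod_range_succ _ (N + 1), Finset.prod_div_distrib, Finset.prod_div_distrib,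
      Finset.prod_div_distrib]
    push_cast
    have e : ∏ k ∈ Finset.range (N + 1), ((k : ℝ) + 1) ≠ 0 := Finset.prod_ne_zero_iff.2 fun k _ => by positivity
    have e' : ∏ k ∈ Finset.range (N + 1), ((k : ℝ) + 1 + s) ≠ 0 := Finset.prod_ne_zero_iff.2 fun k _ => by positivity
    field_simp
  obtain ⟨M, rfl⟩ := Nat.exists_eq_succ_of_ne_zero hN
  have hle : approxMellin ν K (M + 1) s ≤ g M * ((K + s) / K) := by
    have hs1 : 0 < (M : ℝ) + 1 + 1 + s := by positivity
    have : approxMellin ν K (M + 1) s = g M * ((K + s) / K) * (((M : ℝ) + 1 + 1) / ((M : ℝ) + 1 + 1 + s)) := by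
      simp only [approxMellin, hg]
      rw [Finset.prod_range_succ _ (M + 1), Finset.prod_div_distrib, Finset.prod_div_distrib,
        Finset.prod_div_distrib]
      push_cast
      have e : ∏ k ∈ Finset.range (M + 1), ((k : ℝ) + 1) ≠ 0 := Finset.prod_ne_zero_iff.2 fun k _ => by positivity
      field_simp
    rw [this]
    refine mul_le_of_le_one_right (mul_nonneg (hgpos M).le hKs) ?_
    rw [div_le_one hs1]
    linarith
  exact hle.trans (Monotone.ge_of_tendsto (fun a b h => mul_le_mul_of_nonneg_right (hmono h) hKs) hlim M)

/-! ### The weak limit: a law whose cosine transform is a Mittag-Leffler function. -/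

theorem HasMellin.integrable_rpow {μ : Measure ℝ} {f : ℝ → ℝ} (h : HasMellin μ f) {s : ℝ}
    (hs : -(1 / 2) ≤ s) : Integrable (fun x => x ^ s) μ ∧ ∫ x, x ^ s ∂μ = f s := by
  have hnn : 0 ≤ᵐ[μ] fun x => x ^ s := by
    filter_upwards [h.pos] with x hx using Real.rpow_nonneg hx.le _
  have hm : Measurable fun x : ℝ => x ^ s := by fun_prop
  constructor
  · refine ⟨hm.aestronglyMeasurable, ?_⟩
    rw [hasFiniteIntegral_iff_ofReal hnn, h.mellin s hs]
    exact ENNReal.ofReal_lt_top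
  · rw [integral_eq_lintegral_of_nonneg_ae hnn hm.aestronglyMeasurable, h.mellin s hs,
      ENNReal.toReal_ofReal (h.nonneg s hs)]

theorem HasMellin.integral_cos {μ : Measure ℝ} {f : ℝ → ℝ} (h : HasMellin μ f) (x : ℝ)
    (hsum : Summable fun n : ℕ => |x| ^ (2 * n) / (2 * n).factorial * f (2 * n : ℕ)) :
    ∫ z, Real.cos (x * z) ∂μ =
      ∑' n : ℕ, (-1) ^ n * (x ^ (2 * n) / (2 * n).factorial * f (2 * n : ℕ)) := by
  have hmom : ∀ n : ℕ, Integrable (fun z : ℝ => z ^ n) μ ∧ ∫ z, z ^ n ∂μ = f n := fun n => by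
    have hn : (-(1 / 2) : ℝ) ≤ n := by have : (0 : ℝ) ≤ n := n.cast_nonneg
                                       linarith
    simpa using h.integrable_rpow hn
  set F : ℕ → ℝ → ℝ := fun n z => (-1) ^ n * (x * z) ^ (2 * n) / (2 * n).factorial with hF
  have hFe : ∀ n z, F n z = ((-1) ^ n * (x ^ (2 * n) / (2 * n).factorial)) * z ^ (2 * n) := by
    intro n z; simp only [hF, mul_pow]; ring
  have hFi : ∀ n, Integrable (F n) μ := fun n => by
    simp only [funext (hFe n)]
    exact (hmom (2 * n)).1.const_mul _
  have hFn : ∀ n, ∫ z, ‖F n z‖ ∂μ = |x| ^ (2 * n) / (2 * n).factorial * f (2 * n : ℕ) := fun n => by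
    have : ∀ z, ‖F n z‖ = |x| ^ (2 * n) / (2 * n).factorial * z ^ (2 * n) := by
      intro z
      rw [hFe, norm_mul, norm_mul, norm_div, norm_pow, norm_pow, norm_pow]
      simp [(even_two_mul n).pow_abs]
    simp only [this]
    rw [integral_const_mul, (hmom (2 * n)).2]
  have hs := hasSum_integral_of_summable_integral_norm hFi (by simpa only [hFn] using hsum)
  have e : ∀ z, ∑' n, F n z = Real.cos (x * z) := fun z => (Real.hasSum_cos (x * z)).tsum_eq
  simp only [e] at hs
  rw [← hs.tsum_eq]
  refine tsum_congr fun n => ?_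
  simp only [funext (hFe n)]
  rw [integral_const_mul, (hmom (2 * n)).2]
  ring

/-- Markov's inequality gives tightness and Prokhorov's theorem gives compactness; an ultrafilter
takes the place of a convergent subsequence. -/
theorem exists_weak_limit {Y : ℕ → ProbabilityMeasure ℝ} {C : ℝ}
    (hC : ∀ n, ∫⁻ x, ENNReal.ofReal |x| ∂(Y n : Measure ℝ) ≤ ENNReal.ofReal C) :
    ∃ (U : Ultrafilter ℕ) (μ : ProbabilityMeasure ℝ), (U : Filter ℕ) ≤ atTop ∧ Tendsto Y U (𝓝 μ) := by
  have ht : IsTightMeasureSet {((μ : ProbabilityMeasure ℝ) : Measure ℝ) | μ ∈ range Y} := by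
    apply isTightMeasureSet_of_tendsto_measure_norm_gt
    have hlim : Tendsto (fun r : ℝ => ENNReal.ofReal (C / r)) atTop (𝓝 0) := by
      have : Tendsto (fun r : ℝ => C / r) atTop (𝓝 0) := tendsto_const_nhds.div_atTop tendsto_id
      simpa using ENNReal.tendsto_ofReal this
    refine tendsto_of_tendsto_of_tendsto_of_le_of_le' tendsto_const_nhds hlim
      (Eventually.of_forall fun _ => zero_le) ?_
    filter_upwards [eventually_gt_atTop 0] with r hr
    refine iSup₂_le fun μ hμ => ?_
    obtain ⟨_, ⟨n, rfl⟩, rfl⟩ := hμ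
    have hmk := mul_meas_ge_le_lintegral₀ (μ := (Y n : Measure ℝ))
      (f := fun x => ENNReal.ofReal |x|) (by fun_prop) (ENNReal.ofReal r)
    rw [ENNReal.ofReal_div_of_pos hr, ENNReal.le_div_iff_mul_le (by simp [hr]) (by simp), mul_comm]
    refine le_trans ?_ (hmk.trans (hC n))
    gcongr
    intro hx
    exact ENNReal.ofReal_le_ofReal (le_of_lt hx)
  obtain ⟨μ, -, hμ⟩ := (isCompact_closure_of_isTightMeasureSet ht).exists_mapClusterPt
    (f := atTop) (u := Y) (by
      rw [le_principal_iff, mem_map]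
      exact univ_mem' fun n => subset_closure (mem_range_self n))
  obtain ⟨U, hU, hUμ⟩ := mapClusterPt_iff_ultrafilter.1 hμ
  exact ⟨U, μ, hU, hUμ⟩

/-- The negative moment of order `1/2` is lower semicontinuous under weak convergence. -/
theorem lintegral_abs_rpow_neg_half_le {Y : ℕ → ProbabilityMeasure ℝ} {C : ℝ}
    {U : Ultrafilter ℕ} {μ : ProbabilityMeasure ℝ} (hU : Tendsto Y U (𝓝 μ))
    (hpos : ∀ n, ∀ᵐ x ∂(Y n : Measure ℝ), 0 < x)
    (hC : ∀ᶠ n in (U : Filter ℕ), Integrable (fun x : ℝ => x ^ (-(1 / 2) : ℝ)) (Y n : Measure ℝ) ∧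
      ∫ x, x ^ (-(1 / 2) : ℝ) ∂(Y n : Measure ℝ) ≤ C) :
    ∫⁻ x, ENNReal.ofReal (|x| ^ (-(1 / 2) : ℝ)) ∂(μ : Measure ℝ) ≤ ENNReal.ofReal C ∧
      ∀ᵐ x ∂(μ : Measure ℝ), x ≠ 0 := by
  -- The function `|y| ^ (-1/2)` truncated near `0`: bounded and continuous, hence a legitimate test
  -- function for weak convergence.
  set b : ℕ → ℝ → ℝ := fun M y => (max |y| (1 / ((M : ℝ) + 1))) ^ (-(1 / 2) : ℝ) with hb
  have hb0 : ∀ M y, 0 ≤ b M y := fun M y => by simp only [hb]; positivity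
  have hpos' : ∀ (M : ℕ) (y : ℝ), 0 < max |y| (1 / ((M : ℝ) + 1)) := fun M y =>
    lt_max_of_lt_right (by positivity)
  have hbc : ∀ M, Continuous (b M) := fun M => by
    refine Continuous.rpow_const (by fun_prop) fun y => Or.inl (hpos' M y).ne'
  have hbb : ∀ M y, ‖b M y‖ ≤ (1 / ((M : ℝ) + 1)) ^ (-(1 / 2) : ℝ) := fun M y => by
    rw [Real.norm_of_nonneg (hb0 M y)]
    exact Real.rpow_le_rpow_of_nonpos (by positivity) (le_max_right _ _) (by norm_num)
  have hle : ∀ M, ∫ y, b M y ∂(μ : Measure ℝ) ≤ C := fun M => by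
    have := (ProbabilityMeasure.tendsto_iff_forall_integral_tendsto.1 hU)
      (BoundedContinuousFunction.ofNormedAddCommGroup (b M) (hbc M) _ (hbb M))
    simp only [BoundedContinuousFunction.coe_ofNormedAddCommGroup] at this
    refine le_of_tendsto this ?_
    filter_upwards [hC] with n hn
    refine le_trans (integral_mono_of_nonneg (Eventually.of_forall (hb0 M)) hn.1 ?_) hn.2
    filter_upwards [hpos n] with y hy
    refine Real.rpow_le_rpow_of_nonpos hy ?_ (by norm_num)
    exact (le_abs_self y).trans (le_max_left _ _)
  have hbi : ∀ M, Integrable (b M) (μ : Measure ℝ) := fun M =>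
    Integrable.of_bound (hbc M).aestronglyMeasurable _ (Eventually.of_forall (hbb M))
  have hle' : ∀ M, ∫⁻ y, ENNReal.ofReal (b M y) ∂(μ : Measure ℝ) ≤ ENNReal.ofReal C := fun M => by
    rw [← ofReal_integral_eq_lintegral_ofReal (hbi M) (Eventually.of_forall (hb0 M))]
    exact ENNReal.ofReal_le_ofReal (hle M)
  constructor
  · have hF := lintegral_liminf_le (u := atTop) (μ := (μ : Measure ℝ)) (f := fun M y => ENNReal.ofReal (b M y))
      (fun M => ENNReal.measurable_ofReal.comp (hbc M).measurable)
    have h2 : liminf (fun M => ∫⁻ y, ENNReal.ofReal (b M y) ∂(μ : Measure ℝ)) atTop ≤ ENNReal.ofReal C := by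
      refine liminf_le_of_le (by isBoundedDefault) fun c hc => ?_
      obtain ⟨M, hM⟩ := hc.exists
      exact hM.trans (hle' M)
    refine le_trans (lintegral_mono fun y => ?_) (hF.trans h2)
    refine le_liminf_of_le (by isBoundedDefault) ?_
    rcases eq_or_ne y 0 with rfl | hy
    · refine Eventually.of_forall fun M => ENNReal.ofReal_le_ofReal ?_
      rw [abs_zero, Real.zero_rpow (by norm_num)]
      exact hb0 M 0
    · have h0 : 0 < |y| := abs_pos.2 hy
      have h3 : ∀ᶠ M : ℕ in atTop, 1 / ((M : ℝ) + 1) < |y| :=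
        (tendsto_one_div_add_atTop_nhds_zero_nat (𝕜 := ℝ)).eventually (gt_mem_nhds h0)
      filter_upwards [h3] with M hM
      simp only [hb]
      rw [max_eq_left hM.le]
  -- As `0 ^ (-1/2) = 0` by convention, the moment bound says nothing about an atom at `0`. The
  -- truncations do: `b M 0 = √(M + 1)` is unbounded in `M`.
  · have h0 : ∀ M : ℕ, (μ : Measure ℝ).real {0} * √((M : ℝ) + 1) ≤ C := fun M => by
      have h1 : ∫ y in {0}, b M y ∂(μ : Measure ℝ) ≤ ∫ y, b M y ∂(μ : Measure ℝ) :=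
        setIntegral_le_integral (hbi M) (Eventually.of_forall (hb0 M))
      rw [integral_singleton] at h1
      refine le_trans (le_of_eq ?_) (h1.trans (hle M))
      simp only [hb, abs_zero, smul_eq_mul]
      rw [max_eq_right (by positivity), Real.rpow_neg (by positivity), ← Real.sqrt_eq_rpow,
        Real.sqrt_div (by positivity)]
      simp
    have h1 : (μ : Measure ℝ).real {0} = 0 := by
      by_contra hne
      have hp : 0 < (μ : Measure ℝ).real {0} := lt_of_le_of_ne measureReal_nonneg (Ne.symm hne)
      have ht : Tendsto (fun M : ℕ => (μ : Measure ℝ).real {0} * √((M : ℝ) + 1)) atTop atTop :=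
        Tendsto.const_mul_atTop hp (Real.tendsto_sqrt_atTop.comp
          (tendsto_atTop_add_const_right _ _ tendsto_natCast_atTop_atTop))
      obtain ⟨M, hM⟩ := (ht.eventually_gt_atTop C).exists
      exact absurd (h0 M) (not_le.2 hM)
    rw [measureReal_eq_zero_iff] at h1
    rw [ae_iff]
    simpa using h1

/-- For fixed `y ≠ 0`, dilation by `y` preserves null sets, and Fubini does the rest. -/
theorem absolutelyContinuous_map_mul {μ ρ : Measure ℝ} [SFinite μ] [SFinite ρ]
    (hμ : ∀ᵐ y ∂μ, y ≠ 0) (hρ : ρ ≪ volume) :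
    (μ.prod ρ).map (fun p => p.1 * p.2) ≪ volume := by
  refine Measure.AbsolutelyContinuous.mk fun A hA h0 => ?_
  have hm : Measurable fun p : ℝ × ℝ => p.1 * p.2 := by fun_prop
  rw [Measure.map_apply hm hA, Measure.prod_apply (hm hA), lintegral_eq_zero_iff
    (measurable_measure_prodMk_left (hm hA))]
  filter_upwards [hμ] with y hy
  refine hρ ?_
  change volume ((fun r => y * r) ⁻¹' A) = 0
  rw [Real.volume_preimage_mul_left hy, h0, mul_zero]

/-- The data of a law on `(0, ∞)` whose cosine transform is a Mittag-Leffler function. -/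
structure IsMittagLefflerLaw (ν : ℝ) (μ : Measure ℝ) : Prop where
  prob : IsProbabilityMeasure μ
  pos : ∀ᵐ x ∂μ, 0 < x
  lintegral_rpow_lt_top : ∫⁻ x, ENNReal.ofReal (x ^ (-(1 / 2) : ℝ)) ∂μ < ⊤
  integral_cos : ∀ x, ∫ z, Real.cos (x * z) ∂μ =
    ∑' n : ℕ, (-x ^ 2) ^ n / Real.Gamma (n * (2 * ν) + 1)

/-- At `ν = 1` the quotient `Γ(1 + s)/Γ(1 + νs)` is `1` and the series is that of the cosine. -/
theorem isMittagLefflerLaw_one : IsMittagLefflerLaw 1 (Measure.dirac 1) where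
  prob := inferInstance
  pos := by rw [ae_dirac_eq]; exact (one_pos : (0 : ℝ) < 1)
  lintegral_rpow_lt_top := by
    rw [lintegral_dirac' _ (by fun_prop)]
    exact ENNReal.ofReal_lt_top
  integral_cos x := by
    rw [integral_dirac, mul_one, ← (Real.hasSum_cos x).tsum_eq]
    refine tsum_congr fun n => ?_
    rw [show (n : ℝ) * (2 * 1) + 1 = ((2 * n : ℕ) : ℝ) + 1 by push_cast; ring,
      Real.Gamma_nat_eq_factorial, neg_pow (x ^ 2), ← pow_mul]

/-- The law is that of `|Y| R`, with `Y` a weak limit of the approximating laws and `R` independent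
of law `powLaw K`. The factor `R` removes `(K + s) / K` and makes the law absolutely continuous. The
Mellin transform of `Y` itself is never needed, only its moment of order `-1/2` and the cosine
transform of the product. -/
theorem exists_isMittagLefflerLaw {ν : ℝ} (hν : 0 < ν) (hν1 : ν < 1) :
    ∃ μ : Measure ℝ, IsMittagLefflerLaw ν μ ∧ μ ≪ volume := by
  obtain ⟨K, hK1, hK⟩ := exists_hasMellin_approx hν hν1
  have hK1' : (1 : ℝ) ≤ K := by exact_mod_cast hK1
  have hY : ∀ n : ℕ, ∃ μ : ProbabilityMeasure ℝ, HasMellin (μ : Measure ℝ) (approxMellin ν K (n + K)) := fun n => by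
    obtain ⟨μ, hμ⟩ := hK (n + K) (by omega)
    exact ⟨⟨μ, hμ.prob⟩, hμ⟩
  choose Y hY using hY
  have hne : ∀ n, n + K ≠ 0 := fun n => by omega
  have habs : ∀ n, ∫⁻ x, ENNReal.ofReal |x| ∂(Y n : Measure ℝ) ≤
      ENNReal.ofReal (Real.Gamma (1 + 1) / Real.Gamma (ν * 1 + 1) * ((K + 1) / K)) := fun n => by
    have h1 := (hY n).mellin 1 (by norm_num)
    simp only [Real.rpow_one] at h1
    have : ∫⁻ x, ENNReal.ofReal |x| ∂(Y n : Measure ℝ) = ∫⁻ x, ENNReal.ofReal x ∂(Y n : Measure ℝ) := by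
      refine lintegral_congr_ae ?_
      filter_upwards [(hY n).pos] with x hx
      rw [abs_of_pos hx]
    rw [this, h1]
    exact ENNReal.ofReal_le_ofReal (approxMellin_le hν hν1 zero_le_one K (hne n))
  obtain ⟨U, μ, hU, hUμ⟩ := exists_weak_limit habs
  have hshift : Tendsto (fun n => n + K) (U : Filter ℕ) atTop := (tendsto_add_atTop_nat K).mono_left hU
  have hhalf := (tendsto_approxMellin hν hν1 (le_refl (-(1 / 2) : ℝ)) K).comp hshift
  obtain ⟨hμ1, hμ2⟩ := lintegral_abs_rpow_neg_half_le hUμ (fun n => (hY n).pos)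
    (C := Real.Gamma (-(1 / 2) + 1) / Real.Gamma (ν * (-(1 / 2)) + 1) * ((K + -(1 / 2)) / K) + 1) (by
      filter_upwards [hhalf.eventually (gt_mem_nhds (lt_add_one _))] with n hn
      obtain ⟨h1, h2⟩ := (hY n).integrable_rpow (le_refl (-(1 / 2) : ℝ))
      exact ⟨h1, h2.le.trans (le_of_lt hn)⟩)
  have hR := hasMellin_powLaw hK1'
  have := hR.prob
  have hm : Measurable fun p : ℝ × ℝ => |p.1| * p.2 := by fun_prop
  have hma : Measurable fun y : ℝ => |y| := by fun_prop
  -- Passing to `|y|` avoids proving that the limit is carried by `[0, ∞)`; cosine transforms do not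
  -- see the sign.
  set μa : Measure ℝ := (μ : Measure ℝ).map fun y => |y| with hμa
  have hprob : IsProbabilityMeasure μa := Measure.isProbabilityMeasure_map hma.aemeasurable
  have hapos : ∀ᵐ y ∂μa, 0 < y := by
    rw [hμa, ae_map_iff hma.aemeasurable measurableSet_Ioi]
    filter_upwards [hμ2] with y hy using abs_pos.2 hy
  have hmm : Measurable fun p : ℝ × ℝ => p.1 * p.2 := by fun_prop
  have hpp : ∀ᵐ p ∂(μa.prod (powLaw K)), 0 < p.1 ∧ 0 < p.2 :=
    (Measure.quasiMeasurePreserving_fst.ae hapos).and (Measure.quasiMeasurePreserving_snd.ae hR.pos)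
  refine ⟨(μa.prod (powLaw K)).map fun p => p.1 * p.2,
    ⟨Measure.isProbabilityMeasure_map hmm.aemeasurable, ?_, ?_, fun x => ?_⟩,
    absolutelyContinuous_map_mul (hapos.mono fun y hy => hy.ne') (powLaw_absolutelyContinuous _)⟩
  · rw [ae_map_iff hmm.aemeasurable measurableSet_Ioi]
    filter_upwards [hpp] with p hp using mul_pos hp.1 hp.2
  · rw [lintegral_map (by fun_prop) hmm]
    have : ∫⁻ p, ENNReal.ofReal ((p.1 * p.2) ^ (-(1 / 2) : ℝ)) ∂(μa.prod (powLaw K)) =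
        ∫⁻ p, ENNReal.ofReal (p.1 ^ (-(1 / 2) : ℝ)) * ENNReal.ofReal (p.2 ^ (-(1 / 2) : ℝ)) ∂(μa.prod (powLaw K)) := by
      refine lintegral_congr_ae ?_
      filter_upwards [hpp] with p hp
      rw [Real.mul_rpow hp.1.le hp.2.le, ENNReal.ofReal_mul (Real.rpow_nonneg hp.1.le _)]
    rw [this, lintegral_prod_mul (f := fun y => ENNReal.ofReal (y ^ (-(1 / 2) : ℝ)))
      (g := fun y => ENNReal.ofReal (y ^ (-(1 / 2) : ℝ))) (by fun_prop) (by fun_prop), hR.mellin _ le_rfl, hμa,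
      lintegral_map (by fun_prop) hma]
    exact ENNReal.mul_lt_top (hμ1.trans_lt ENNReal.ofReal_lt_top) ENNReal.ofReal_lt_top
  · -- the cosine transform
    -- Integrating out the power law leaves a bounded continuous even function of `y`, to which weak
    -- convergence applies.
    set G : ℝ → ℝ := fun y => ∫ r, Real.cos (x * (y * r)) ∂(powLaw K) with hG
    have hGc : Continuous G := by
      refine continuous_of_dominated (bound := fun _ => 1) (fun y => ?_) (fun y => ?_)
        (integrable_const _) ?_
      · exact Continuous.aestronglyMeasurable (by fun_prop)
      · exact Eventually.of_forall fun r => Real.abs_cos_le_one _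
      · exact Eventually.of_forall fun r => by fun_prop
    have hGb : ∀ y, ‖G y‖ ≤ 1 := fun y => by
      refine (norm_integral_le_of_norm_le_const (C := 1)
        (Eventually.of_forall fun r => Real.abs_cos_le_one _)).trans ?_
      simp
    have hGabs : ∀ y, G |y| = G y := fun y => by
      rcases abs_choice y with h | h
      · rw [h]
      · rw [h]
        simp only [hG]
        congr 1
        ext r
        rw [← Real.cos_neg]
        congr 1; ring
    have hprod : ∀ (ρ : Measure ℝ) [IsProbabilityMeasure ρ],
        ∫ z, Real.cos (x * z) ∂((ρ.prod (powLaw K)).map fun p => p.1 * p.2) = ∫ y, G y ∂ρ := by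
      intro ρ _
      rw [integral_map hmm.aemeasurable (Continuous.aestronglyMeasurable (by fun_prop)),
        integral_prod _ (Integrable.of_bound (C := 1)
          (Continuous.aestronglyMeasurable (by fun_prop))
          (Eventually.of_forall fun p => Real.abs_cos_le_one _))]
    rw [hprod μa, hμa, integral_map hma.aemeasurable hGc.aestronglyMeasurable]
    simp only [hGabs]
    have hlim1 := (ProbabilityMeasure.tendsto_iff_forall_integral_tendsto.1 hUμ)
      (BoundedContinuousFunction.ofNormedAddCommGroup G hGc _ hGb)
    simp only [BoundedContinuousFunction.coe_ofNormedAddCommGroup] at hlim1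
    refine tendsto_nhds_unique hlim1 ?_
    -- The power law contributes `K / (K + 2k)`, which cancels `(K + 2k) / K`; what is left is the
    -- general term of the Mittag-Leffler series, independent of `n`.
    have hbound : ∀ n k : ℕ, |x| ^ (2 * k) / (2 * k).factorial *
        (approxMellin ν K (n + K) (2 * k : ℕ) * (K / (K + (2 * k : ℕ)))) ≤
          |x ^ 2| ^ k / Real.Gamma (k * (2 * ν) + 1) := fun n k => by
      have h1 := approxMellin_le hν hν1 (Nat.cast_nonneg (2 * k)) K (hne n)
      have hKk : (0 : ℝ) < K + (2 * k : ℕ) := by positivity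
      calc _ ≤ |x| ^ (2 * k) / (2 * k).factorial *
          (Real.Gamma ((2 * k : ℕ) + 1) / Real.Gamma (ν * (2 * k : ℕ) + 1) * ((K + (2 * k : ℕ)) / K) * (K / (K + (2 * k : ℕ)))) := by
            gcongr
        _ = _ := by
            rw [Real.Gamma_nat_eq_factorial, abs_pow, ← pow_mul,
              show (k : ℝ) * (2 * ν) + 1 = ν * (2 * k : ℕ) + 1 by push_cast; ring]
            have : Real.Gamma (ν * (2 * k : ℕ) + 1) ≠ 0 := (Real.Gamma_pos_of_pos (by positivity)).ne'
            field_simp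
    have hsummable := summable_pow_div_Gamma (α := 2 * ν) (by positivity) (x ^ 2)
    have hnn : ∀ n k : ℕ, 0 ≤ approxMellin ν K (n + K) (2 * k : ℕ) := fun n k =>
      (hY n).nonneg _ (by have : (0 : ℝ) ≤ (2 * k : ℕ) := Nat.cast_nonneg _
                          linarith)
    have hYn : ∀ n, ∫ y, G y ∂(Y n : Measure ℝ) = ∑' k : ℕ, (-1) ^ k * (x ^ (2 * k) / (2 * k).factorial *
        (approxMellin ν K (n + K) (2 * k : ℕ) * (K / (K + (2 * k : ℕ))))) := fun n => by
      rw [← hprod, ((hY n).mul hR).integral_cos x]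
      refine Summable.of_nonneg_of_le (fun k => ?_) (hbound n) hsummable
      have := hnn n k
      positivity
    simp only [hYn]
    have hzero : ∀ k : ℕ, (-(1 / 2) : ℝ) ≤ (2 * k : ℕ) := fun k => by
      have : (0 : ℝ) ≤ (2 * k : ℕ) := Nat.cast_nonneg _
      linarith
    refine tendsto_tsum_of_dominated_convergence hsummable (fun k => ?_) ?_
    · have h := ((((tendsto_approxMellin hν hν1 (hzero k) K).comp hshift).mul_const
        ((K : ℝ) / (K + (2 * k : ℕ)))).const_mul (x ^ (2 * k) / (2 * k).factorial)).const_mul ((-1 : ℝ) ^ k)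
      refine (h.congr fun n => rfl).trans_eq ?_
      congr 1
      rw [Real.Gamma_nat_eq_factorial, neg_pow (x ^ 2), ← pow_mul,
        show (k : ℝ) * (2 * ν) + 1 = ν * (2 * k : ℕ) + 1 by push_cast; ring]
      have : Real.Gamma (ν * (2 * k : ℕ) + 1) ≠ 0 := (Real.Gamma_pos_of_pos (by positivity)).ne'
      have hKk : (0 : ℝ) < K + (2 * k : ℕ) := by positivity
      field_simp
    · refine Eventually.of_forall fun n k => ?_
      refine le_trans (le_of_eq ?_) (hbound n k)
      have h2 := hnn n k
      have h3 : 0 ≤ (K : ℝ) / (K + (2 * k : ℕ)) := by positivity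
      rw [norm_mul, norm_mul, norm_div, norm_pow, norm_pow, Real.norm_of_nonneg (mul_nonneg h2 h3)]
      simp

/-! ### Series of Schwartz functions and uniform boundedness. -/

section SchwartzSeries

variable {e : ℕ → 𝓢(ℝ, ℂ)}

/-- The sum of a series of Schwartz functions, all of whose seminorms are summable. -/
def schwartzSum (e : ℕ → 𝓢(ℝ, ℂ)) (h : ∀ k l, Summable fun n => SchwartzMap.seminorm ℂ k l (e n)) :
    𝓢(ℝ, ℂ) where
  toFun x := ∑' n, e n x
  smooth' := contDiff_tsum (v := fun l n => SchwartzMap.seminorm ℂ 0 l (e n))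
    (fun n => (e n).smooth ⊤) (fun l _ => h 0 l)
    fun l n x _ => (e n).norm_iteratedFDeriv_le_seminorm ℂ l x
  decay' k l := by
    refine ⟨∑' n, SchwartzMap.seminorm ℂ k l (e n), fun x => ?_⟩
    rw [iteratedFDeriv_tsum_apply (N := ⊤) (v := fun l n => SchwartzMap.seminorm ℂ 0 l (e n))
      (fun n => (e n).smooth ⊤) (fun l _ => h 0 l)
      (fun l n x _ => (e n).norm_iteratedFDeriv_le_seminorm ℂ l x) le_top]
    have h0 : Summable fun n => ‖iteratedFDeriv ℝ l (e n) x‖ :=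
      Summable.of_nonneg_of_le (fun n => norm_nonneg _)
        (fun n => (e n).norm_iteratedFDeriv_le_seminorm ℂ l x) (h 0 l)
    calc ‖x‖ ^ k * ‖∑' n, iteratedFDeriv ℝ l (e n) x‖
        ≤ ‖x‖ ^ k * ∑' n, ‖iteratedFDeriv ℝ l (e n) x‖ := by
          gcongr; exact norm_tsum_le_tsum_norm h0
      _ = ∑' n, ‖x‖ ^ k * ‖iteratedFDeriv ℝ l (e n) x‖ := tsum_mul_left.symm
      _ ≤ _ := (h0.mul_left _).tsum_le_tsum (fun n => (e n).le_seminorm ℂ k l x) (h k l)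

theorem schwartzSum_apply (h : ∀ k l, Summable fun n => SchwartzMap.seminorm ℂ k l (e n)) (x : ℝ) :
    schwartzSum e h x = ∑' n, e n x := rfl

theorem seminorm_schwartzSum_le (h : ∀ k l, Summable fun n => SchwartzMap.seminorm ℂ k l (e n))
    (k l : ℕ) :
    SchwartzMap.seminorm ℂ k l (schwartzSum e h) ≤ ∑' n, SchwartzMap.seminorm ℂ k l (e n) := by
  refine SchwartzMap.seminorm_le_bound ℂ k l _ (tsum_nonneg fun n => apply_nonneg _ _) fun x => ?_
  have hfun : (schwartzSum e h : ℝ → ℂ) = fun x => ∑' n, e n x := rfl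
  rw [hfun, iteratedFDeriv_tsum_apply (N := ⊤) (v := fun l n => SchwartzMap.seminorm ℂ 0 l (e n))
      (fun n => (e n).smooth ⊤) (fun l _ => h 0 l)
      (fun l n x _ => (e n).norm_iteratedFDeriv_le_seminorm ℂ l x) le_top]
  have h0 : Summable fun n => ‖iteratedFDeriv ℝ l (e n) x‖ :=
    Summable.of_nonneg_of_le (fun n => norm_nonneg _)
      (fun n => (e n).norm_iteratedFDeriv_le_seminorm ℂ l x) (h 0 l)
  calc ‖x‖ ^ k * ‖∑' n, iteratedFDeriv ℝ l (e n) x‖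
      ≤ ‖x‖ ^ k * ∑' n, ‖iteratedFDeriv ℝ l (e n) x‖ := by
        gcongr; exact norm_tsum_le_tsum_norm h0
    _ = ∑' n, ‖x‖ ^ k * ‖iteratedFDeriv ℝ l (e n) x‖ := tsum_mul_left.symm
    _ ≤ _ := (h0.mul_left _).tsum_le_tsum (fun n => (e n).le_seminorm ℂ k l x) (h k l)

theorem hasSum_schwartzSum (h : ∀ k l, Summable fun n => SchwartzMap.seminorm ℂ k l (e n)) :
    Tendsto (fun m => ∑ n ∈ Finset.range m, e n) atTop (𝓝 (schwartzSum e h)) := by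
  rw [(schwartz_withSeminorms ℂ ℝ ℂ).tendsto_nhds]
  rintro ⟨k, l⟩ ε hε
  have ht := tendsto_sum_nat_add fun n => SchwartzMap.seminorm ℂ k l (e n)
  filter_upwards [ht.eventually (gt_mem_nhds hε)] with m hm
  have hsh : ∀ k l, Summable fun n => SchwartzMap.seminorm ℂ k l (e (n + m)) := fun k l =>
    (summable_nat_add_iff m).2 (h k l)
  have heq : ∑ n ∈ Finset.range m, e n - schwartzSum e h = -schwartzSum (fun n => e (n + m)) hsh := by
    ext x
    have hx : Summable fun n => e n x := Summable.of_norm_bounded (h 0 0) fun n =>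
      (e n).norm_le_seminorm ℂ x
    have := hx.sum_add_tsum_nat_add m
    simp only [sub_apply, neg_apply, sum_apply, schwartzSum_apply]
    rw [← this]
    ring
  rw [heq, map_neg_eq_map, SchwartzMap.schwartzSeminormFamily_apply]
  exact (seminorm_schwartzSum_le hsh k l).trans_lt hm

theorem exists_seminorm_bound (L : 𝓢'(ℝ, ℂ)) : ∃ (s : Finset (ℕ × ℕ)) (C : ℝ), 0 ≤ C ∧
    ∀ φ, ‖L φ‖ ≤ C * ∑ p ∈ s, SchwartzMap.seminorm ℂ p.1 p.2 φ := by
  have hc : Continuous L := map_continuous L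
  set q : Seminorm ℂ 𝓢(ℝ, ℂ) := (normSeminorm ℂ ℂ).comp (L : 𝓢(ℝ, ℂ) →ₗ[ℂ] ℂ)
  have hq : Continuous q := continuous_norm.comp hc
  obtain ⟨s, C, -, hC⟩ := Seminorm.bound_of_continuous (schwartz_withSeminorms ℂ ℝ ℂ) q hq
  refine ⟨s, C, C.2, fun φ => (hC φ).trans ?_⟩
  rw [smul_apply, NNReal.smul_def, smul_eq_mul]
  refine mul_le_mul_of_nonneg_left ((Seminorm.finset_sup_le_sum _ s φ).trans (le_of_eq ?_)) C.2
  rw [sum_apply]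
  rfl

theorem summable_norm_apply (h : ∀ k l, Summable fun n => SchwartzMap.seminorm ℂ k l (e n))
    (L : 𝓢'(ℝ, ℂ)) : Summable fun n => ‖L (e n)‖ := by
  obtain ⟨s, C, -, hC⟩ := exists_seminorm_bound L
  refine Summable.of_nonneg_of_le (fun n => norm_nonneg _) (fun n => hC (e n)) (Summable.mul_left _ ?_)
  exact summable_sum fun p _ => h p.1 p.2

/-- Uniform boundedness for pointwise bounded families of tempered distributions along a
rapidly decreasing sequence of Schwartz functions. -/
theorem exists_uniform_bound {ι : Type*} (L : ι → 𝓢'(ℝ, ℂ)) (hL : ∀ φ, ∃ C, ∀ i, ‖L i φ‖ ≤ C)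
    (h : ∀ k l, Summable fun n => SchwartzMap.seminorm ℂ k l (e n)) :
    ∃ C, ∀ i n, ‖L i (e n)‖ ≤ C := by
  have hae : ∀ (a : BoundedContinuousFunction ℕ ℂ) (k l : ℕ),
      Summable fun n => SchwartzMap.seminorm ℂ k l (a n • e n) := fun a k l => by
    refine Summable.of_nonneg_of_le (fun n => apply_nonneg _ _) (fun n => ?_) ((h k l).mul_left ‖a‖)
    rw [map_smul_eq_mul]
    gcongr
    exact a.norm_coe_le_norm n
  have hs : ∀ (i : ι) (a : BoundedContinuousFunction ℕ ℂ), Summable fun n => a n * L i (e n) := by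
    intro i a
    refine Summable.of_norm_bounded ((summable_norm_apply h (L i)).mul_left ‖a‖) fun n => ?_
    rw [norm_mul]
    gcongr
    exact a.norm_coe_le_norm n
  -- `a ↦ L i (∑ a n • e n)` is a bounded functional on the Banach space of bounded sequences, so
  -- the usual Banach-Steinhaus theorem applies there instead of on the Schwartz space. Unit
  -- sequences recover `L i (e n)`.
  let Λ : ι → BoundedContinuousFunction ℕ ℂ →L[ℂ] ℂ := fun i =>
    LinearMap.mkContinuous
      { toFun := fun a => ∑' n, a n * L i (e n)
        map_add' := fun a b => by
          simp only [BoundedContinuousFunction.coe_add, Pi.add_apply, add_mul]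
          exact (hs i a).tsum_add (hs i b)
        map_smul' := fun c a => by
          simp only [BoundedContinuousFunction.coe_smul, smul_eq_mul, mul_assoc, RingHom.id_apply]
          exact tsum_mul_left }
      (∑' n, ‖L i (e n)‖) fun a => by
        have hb := summable_norm_apply h (L i)
        calc ‖∑' n, a n * L i (e n)‖ ≤ ∑' n, ‖a n * L i (e n)‖ := norm_tsum_le_tsum_norm (hs i a).norm
          _ ≤ ∑' n, ‖L i (e n)‖ * ‖a‖ := by
            refine (hs i a).norm.tsum_le_tsum (fun n => ?_) (hb.mul_right _)
            rw [norm_mul, mul_comm]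
            gcongr
            exact a.norm_coe_le_norm n
          _ = _ := tsum_mul_right
  have hΛ : ∀ i a, Λ i a = L i (schwartzSum (fun n => a n • e n) (hae a)) := by
    intro i a
    have h1 := ((map_continuous (L i)).tendsto _).comp (hasSum_schwartzSum (hae a))
    have h2 := (hs i a).hasSum.tendsto_sum_nat
    refine tendsto_nhds_unique h2 (h1.congr fun m => ?_)
    simp only [Function.comp_apply, map_sum, map_smul, smul_eq_mul]
  obtain ⟨C, hC⟩ := banach_steinhaus (g := Λ) fun a => by
    obtain ⟨C, hC⟩ := hL (schwartzSum (fun n => a n • e n) (hae a))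
    exact ⟨C, fun i => by rw [hΛ]; exact hC i⟩
  refine ⟨C, fun i n => ?_⟩
  let a : BoundedContinuousFunction ℕ ℂ :=
    BoundedContinuousFunction.ofNormedAddCommGroupDiscrete (fun m => if m = n then (1 : ℂ) else 0) 1
      fun m => by split_ifs <;> simp
  have ha : Λ i a = L i (e n) := by
    change ∑' m, (if m = n then (1 : ℂ) else 0) * L i (e m) = _
    rw [tsum_eq_single n fun m hm => by simp [hm]]
    simp
  have ha1 : ‖a‖ ≤ 1 := (BoundedContinuousFunction.norm_le zero_le_one).2 fun m => by
    change ‖if m = n then (1 : ℂ) else 0‖ ≤ 1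
    split_ifs <;> simp
  rw [← ha]
  have hC0 : 0 ≤ C := (norm_nonneg _).trans (hC i)
  calc ‖Λ i a‖ ≤ ‖Λ i‖ * ‖a‖ := (Λ i).le_opNorm a
    _ ≤ C * 1 := mul_le_mul (hC i) ha1 (norm_nonneg _) hC0
    _ = C := mul_one C

end SchwartzSeries

/-! ### Multiplication estimates and reduction to compactly supported test functions. -/

section Leibniz

theorem norm_iteratedFDeriv_mul_le_of_bound {f g : ℝ → ℂ} (hf : ContDiff ℝ (⊤ : ℕ∞) f) (hg : ContDiff ℝ (⊤ : ℕ∞) g)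
    {x B : ℝ} {l j : ℕ} (hj : j ≤ l) (hB : ∀ i ≤ l, ‖iteratedFDeriv ℝ i f x‖ ≤ B) :
    ‖iteratedFDeriv ℝ j (fun y => f y * g y) x‖ ≤
      (l + 1) * (2 ^ l * B) * ∑ i ∈ Finset.range (l + 1), ‖iteratedFDeriv ℝ i g x‖ := by
  have hB0 : 0 ≤ B := (norm_nonneg _).trans (hB 0 (zero_le))
  refine (norm_iteratedFDeriv_mul_le (N := ((⊤ : ℕ∞) : WithTop ℕ∞)) hf hg x (by exact_mod_cast le_top)).trans ?_
  set S := ∑ i ∈ Finset.range (l + 1), ‖iteratedFDeriv ℝ i g x‖ with hS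
  have hS0 : 0 ≤ S := Finset.sum_nonneg fun i _ => norm_nonneg _
  have hterm : ∀ i ∈ Finset.range (j + 1), (j.choose i : ℝ) * ‖iteratedFDeriv ℝ i f x‖ *
      ‖iteratedFDeriv ℝ (j - i) g x‖ ≤ 2 ^ l * B * S := by
    intro i hi
    have hil : i ≤ j := Nat.lt_succ_iff.1 (Finset.mem_range.1 hi)
    have h1 : (j.choose i : ℝ) ≤ 2 ^ l := by
      calc (j.choose i : ℝ) ≤ 2 ^ j := by exact_mod_cast Nat.choose_le_two_pow j i
        _ ≤ 2 ^ l := pow_le_pow_right₀ (by norm_num) hj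
    have h2 : ‖iteratedFDeriv ℝ (j - i) g x‖ ≤ S :=
      Finset.single_le_sum (f := fun i => ‖iteratedFDeriv ℝ i g x‖) (fun i _ => norm_nonneg _)
        (Finset.mem_range.2 (by omega))
    have := hB i (hil.trans hj)
    gcongr
  refine (Finset.sum_le_card_nsmul _ _ _ hterm).trans ?_
  rw [Finset.card_range, nsmul_eq_mul, ← mul_assoc]
  have : ((j + 1 : ℕ) : ℝ) ≤ l + 1 := by exact_mod_cast Nat.succ_le_succ hj
  gcongr

theorem iteratedFDeriv_eq_zero_of_notMem_tsupport {g : ℝ → ℂ} {x : ℝ} (hx : x ∉ tsupport g) (i : ℕ) :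
    iteratedFDeriv ℝ i g x = 0 := by
  by_contra h
  exact hx (support_iteratedFDeriv_subset (𝕜 := ℝ) i h)

/-- Multiplication by a smooth function is bounded, with respect to each family of Schwartz seminorms
of bounded order, on functions supported in a fixed compact set. -/
theorem exists_seminorm_smulLeftCLM_le {f : ℝ → ℂ} (hf : f.HasTemperateGrowth) (R : ℝ) (l : ℕ) :
    ∃ B : ℝ, 0 ≤ B ∧ ∀ (k : ℕ) (ψ : 𝓢(ℝ, ℂ)), tsupport ψ ⊆ Metric.closedBall 0 R →
      ∑ j ∈ Finset.range (l + 1), SchwartzMap.seminorm ℂ k j (SchwartzMap.smulLeftCLM ℂ f ψ) ≤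
        B * ∑ j ∈ Finset.range (l + 1), SchwartzMap.seminorm ℂ k j ψ := by
  have hsm : ContDiff ℝ (⊤ : ℕ∞) f := hf.1
  have hb : ∃ B : ℝ, 0 ≤ B ∧ ∀ i ≤ l, ∀ x ∈ Metric.closedBall (0 : ℝ) R, ‖iteratedFDeriv ℝ i f x‖ ≤ B := by
    have h1 : ∀ i, ∃ B, ∀ x ∈ Metric.closedBall (0 : ℝ) R, ‖iteratedFDeriv ℝ i f x‖ ≤ B := fun i =>
      (isCompact_closedBall 0 R).exists_bound_of_continuousOn
        (hsm.continuous_iteratedFDeriv (by exact_mod_cast le_top)).continuousOn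
    choose b hb using h1
    refine ⟨∑ i ∈ Finset.range (l + 1), |b i|, Finset.sum_nonneg fun i _ => abs_nonneg _,
      fun i hi x hx => ((hb i x hx).trans (le_abs_self _)).trans ?_⟩
    exact Finset.single_le_sum (f := fun i => |b i|) (fun i _ => abs_nonneg _)
      (Finset.mem_range.2 (Nat.lt_succ_of_le hi))
  obtain ⟨B, hB0, hB⟩ := hb
  refine ⟨(l + 1) * ((l + 1) * (2 ^ l * B)), by positivity, fun k ψ hψ => ?_⟩
  set Q := ∑ j ∈ Finset.range (l + 1), SchwartzMap.seminorm ℂ k j ψ with hQ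
  have hQ0 : 0 ≤ Q := Finset.sum_nonneg fun i _ => apply_nonneg _ _
  have hterm : ∀ j ∈ Finset.range (l + 1),
      SchwartzMap.seminorm ℂ k j (SchwartzMap.smulLeftCLM ℂ f ψ) ≤ (l + 1) * (2 ^ l * B) * Q := by
    intro j hj
    refine SchwartzMap.seminorm_le_bound ℂ k j _ (by positivity) fun x => ?_
    rw [SchwartzMap.smulLeftCLM_apply hf]
    simp only [smul_eq_mul]
    by_cases hx : x ∈ tsupport ψ
    · have := norm_iteratedFDeriv_mul_le_of_bound hsm (ψ.smooth ⊤) (x := x)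
        (Nat.lt_succ_iff.1 (Finset.mem_range.1 hj)) fun i hi => hB i hi x (hψ hx)
      calc _ ≤ ‖x‖ ^ k * ((l + 1) * (2 ^ l * B) * ∑ i ∈ Finset.range (l + 1), ‖iteratedFDeriv ℝ i ψ x‖) := by
            gcongr
        _ = (l + 1) * (2 ^ l * B) * ∑ i ∈ Finset.range (l + 1), ‖x‖ ^ k * ‖iteratedFDeriv ℝ i ψ x‖ := by
            rw [← Finset.mul_sum]; ring
        _ ≤ _ := by
            exact mul_le_mul_of_nonneg_left (Finset.sum_le_sum fun i _ => ψ.le_seminorm ℂ k i x)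
              (by positivity)
    · rw [iteratedFDeriv_eq_zero_of_notMem_tsupport fun h => hx (tsupport_mul_subset_right h)]
      simp only [norm_zero, mul_zero]
      positivity
  refine (Finset.sum_le_card_nsmul _ _ _ hterm).trans (le_of_eq ?_)
  rw [Finset.card_range, nsmul_eq_mul]
  push_cast
  ring

/-- A tempered distribution that vanishes on compactly supported functions is zero. -/
theorem eq_zero_of_forall_compactSupport {L : 𝓢'(ℝ, ℂ)}
    (hL : ∀ ψ : 𝓢(ℝ, ℂ), HasCompactSupport ψ → L ψ = 0) : L = 0 := by
  let χ : ContDiffBump (0 : ℝ) := ⟨1, 2, by norm_num, by norm_num⟩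
  have hχs : ContDiff ℝ (⊤ : ℕ∞) fun x => (χ x : ℂ) := Complex.ofRealCLM.contDiff.comp χ.contDiff
  have hχc : HasCompactSupport fun x => (χ x : ℂ) := χ.hasCompactSupport.comp_left Complex.ofReal_zero
  set χS : 𝓢(ℝ, ℂ) := hχc.toSchwartzMap hχs with hχS
  have hχSa : ∀ x, χS x = χ x := fun x => rfl
  let g : ℕ → ℝ → ℂ := fun n x => χS (((n : ℝ) + 1)⁻¹ * x)
  have hgs : ∀ n, ContDiff ℝ (⊤ : ℕ∞) (g n) := fun n => (χS.smooth ⊤).comp (contDiff_const.mul contDiff_id)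
  have hgc : ∀ n, HasCompactSupport (g n) := fun n => by
    have hc : HasCompactSupport χS := hχc
    exact hc.comp_homeomorph (Homeomorph.mulLeft₀ (((n : ℝ) + 1)⁻¹) (by positivity))
  have hgt : ∀ n, (g n).HasTemperateGrowth := fun n =>
    ((hgc n).toSchwartzMap (hgs n)).hasTemperateGrowth
  have hgb : ∀ (l n : ℕ) (x : ℝ), ∀ i ≤ l, ‖iteratedFDeriv ℝ i (fun y => 1 - g n y) x‖ ≤
      1 + ∑ j ∈ Finset.range (l + 1), SchwartzMap.seminorm ℂ 0 j χS := by
    intro l n x i hi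
    have h1 : iteratedFDeriv ℝ i (fun y => 1 - g n y) x =
        iteratedFDeriv ℝ i (fun _ : ℝ => (1 : ℂ)) x - iteratedFDeriv ℝ i (g n) x :=
      iteratedFDeriv_sub_apply contDiffAt_const ((hgs n).contDiffAt.of_le (by exact_mod_cast le_top))
    rw [h1]
    refine (norm_sub_le _ _).trans (add_le_add ?_ ?_)
    · rcases Nat.eq_zero_or_pos i with rfl | hi
      · simp
      · rw [iteratedFDeriv_const_of_ne hi.ne']
        simp
    · refine le_trans ?_ (Finset.single_le_sum (f := fun j => SchwartzMap.seminorm ℂ 0 j χS)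
        (fun j _ => apply_nonneg _ _) (Finset.mem_range.2 (Nat.lt_succ_of_le hi)))
      rw [norm_iteratedFDeriv_eq_norm_iteratedDeriv]
      have : iteratedDeriv i (g n) =
          fun x => (((n : ℝ) + 1)⁻¹) ^ i • iteratedDeriv i χS (((n : ℝ) + 1)⁻¹ * x) :=
        iteratedDeriv_comp_const_smul ((χS.smooth ⊤).of_le (by exact_mod_cast le_top)) _
      rw [this, norm_smul, norm_pow]
      have h2 : ‖((n : ℝ) + 1)⁻¹‖ ^ i ≤ 1 := by
        refine pow_le_one₀ (norm_nonneg _) ?_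
        rw [norm_inv, Real.norm_of_nonneg (by positivity)]
        exact inv_le_one_of_one_le₀ (by simp)
      have h3 := χS.norm_iteratedFDeriv_le_seminorm ℂ i (((n : ℝ) + 1)⁻¹ * x)
      rw [norm_iteratedFDeriv_eq_norm_iteratedDeriv] at h3
      calc _ ≤ 1 * SchwartzMap.seminorm ℂ 0 i χS := mul_le_mul h2 h3 (norm_nonneg _) zero_le_one
        _ = _ := one_mul _
  have hone : ∀ (n : ℕ) (x : ℝ), |x| < n + 1 → ∀ᶠ y in 𝓝 x, g n y = 1 := by
    intro n x hx
    filter_upwards [continuous_abs.continuousAt.eventually (gt_mem_nhds hx)] with y hy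
    simp only [g, hχSa]
    rw [χ.one_of_mem_closedBall, Complex.ofReal_one]
    rw [mem_closedBall_zero_iff, norm_mul, norm_inv, Real.norm_of_nonneg (by positivity : (0 : ℝ) ≤ n + 1),
      inv_mul_le_iff₀ (by positivity)]
    simpa [χ] using hy.le
  ext φ
  have hlim : Tendsto (fun n => SchwartzMap.smulLeftCLM ℂ (g n) φ) atTop (𝓝 φ) := by
    rw [(schwartz_withSeminorms ℂ ℝ ℂ).tendsto_nhds]
    rintro ⟨k, l⟩ ε hε
    set B := 1 + ∑ j ∈ Finset.range (l + 1), SchwartzMap.seminorm ℂ 0 j χS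
    have hB0 : 0 ≤ B := add_nonneg zero_le_one (Finset.sum_nonneg fun i _ => apply_nonneg _ _)
    -- The weight `k + 1` in place of `k`: the cutoff error lives on `|x| ≥ n + 1`, where the
    -- additional power of `|x|` buys the factor `1 / (n + 1)`.
    set Q := ∑ j ∈ Finset.range (l + 1), SchwartzMap.seminorm ℂ (k + 1) j φ
    have hQ0 : 0 ≤ Q := Finset.sum_nonneg fun i _ => apply_nonneg _ _
    set D := (l + 1) * (2 ^ l * B) * Q with hD
    have hD0 : 0 ≤ D := by positivity
    have hsem : ∀ n : ℕ, SchwartzMap.seminorm ℂ k l (SchwartzMap.smulLeftCLM ℂ (g n) φ - φ) ≤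
        D / ((n : ℝ) + 1) := by
      intro n
      rw [← map_neg_eq_map, neg_sub]
      refine SchwartzMap.seminorm_le_bound ℂ k l _ (by positivity) fun x => ?_
      have hcoe : ((φ - SchwartzMap.smulLeftCLM ℂ (g n) φ : 𝓢(ℝ, ℂ)) : ℝ → ℂ) =
          fun y => (1 - g n y) * φ y := by
        ext y
        rw [sub_apply, SchwartzMap.smulLeftCLM_apply_apply (hgt n), smul_eq_mul]
        ring
      rw [hcoe]
      rcases lt_or_ge |x| ((n : ℝ) + 1) with hx | hx
      · have : (fun y => (1 - g n y) * φ y) =ᶠ[𝓝 x] fun _ => (0 : ℂ) := by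
          filter_upwards [hone n x hx] with y hy
          rw [hy]; ring
        rw [this.iteratedFDeriv ℝ l |>.eq_of_nhds]
        have h0 : iteratedFDeriv ℝ l (fun _ : ℝ => (0 : ℂ)) x = 0 := by
          have := congrFun (iteratedFDeriv_fun_zero (𝕜 := ℝ) (E := ℝ) (F := ℂ) (n := l)) x
          exact this
        rw [h0, norm_zero, mul_zero]
        positivity
      · have h1 := norm_iteratedFDeriv_mul_le_of_bound (contDiff_const.sub (hgs n)) (φ.smooth ⊤) (x := x)
          le_rfl (hgb l n x)
        rw [le_div_iff₀ (by positivity)]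
        calc ‖x‖ ^ k * ‖iteratedFDeriv ℝ l (fun y => (1 - g n y) * φ y) x‖ * (n + 1)
            ≤ ‖x‖ ^ k * ((l + 1) * (2 ^ l * B) * ∑ i ∈ Finset.range (l + 1), ‖iteratedFDeriv ℝ i φ x‖) * ‖x‖ := by
              gcongr
              exact hx
          _ = (l + 1) * (2 ^ l * B) * ∑ i ∈ Finset.range (l + 1), ‖x‖ ^ (k + 1) * ‖iteratedFDeriv ℝ i φ x‖ := by
              rw [← Finset.mul_sum]; ring
          _ ≤ D := by
              rw [hD]
              exact mul_le_mul_of_nonneg_left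
                (Finset.sum_le_sum fun i _ => φ.le_seminorm ℂ (k + 1) i x) (by positivity)
    have ht : Tendsto (fun n : ℕ => D / ((n : ℝ) + 1)) atTop (𝓝 0) :=
      tendsto_const_nhds.div_atTop (tendsto_atTop_add_const_right _ _ tendsto_natCast_atTop_atTop)
    filter_upwards [ht.eventually (gt_mem_nhds hε)] with n hn
    exact (hsem n).trans_lt hn
  have h1 := ((map_continuous L).tendsto _).comp hlim
  refine tendsto_nhds_unique h1 ?_
  refine tendsto_const_nhds.congr fun n => ?_
  rw [Function.comp_apply, hL]
  · rfl
  · rw [SchwartzMap.smulLeftCLM_apply (hgt n)]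
    exact (hgc n).mul_right

end Leibniz

/-! ### The equation on the Fourier side and uniqueness. -/

open scoped FourierTransform NNReal ENNReal

/-- The Fourier symbol `2πiξ` of the derivative. -/
def freq (ξ : ℝ) : ℂ := 2 * Real.pi * Complex.I * ξ

theorem hasTemperateGrowth_freq_pow (k : ℕ) : Function.HasTemperateGrowth fun ξ => freq ξ ^ k := by
  have h1 : Function.HasTemperateGrowth freq := by
    have h : Function.HasTemperateGrowth fun ξ : ℝ => (Complex.ofRealCLM ξ) :=
      Complex.ofRealCLM.hasTemperateGrowth
    exact (Function.HasTemperateGrowth.const (2 * Real.pi * Complex.I)).mul h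
  induction k with
  | zero => simp
  | succ k ih => simp only [pow_succ]; exact ih.mul h1

/-- The minus sign in the definition of the distributional derivative cancels the one in `(𝓕 ψ)' = 𝓕
(-2πiξ ψ)`. -/
theorem derivCLM_iterate_fourier (T : 𝓢'(ℝ, ℂ)) (k : ℕ) (ψ : 𝓢(ℝ, ℂ)) :
    ((TemperedDistribution.derivCLM ℂ)^[k] T) (𝓕 ψ) =
      T (𝓕 (SchwartzMap.smulLeftCLM ℂ (fun ξ => freq ξ ^ k) ψ)) := by
  induction k generalizing ψ with
  | zero =>
    have : SchwartzMap.smulLeftCLM ℂ (fun ξ => freq ξ ^ 0) ψ = ψ := by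
      ext x; rw [SchwartzMap.smulLeftCLM_apply_apply (hasTemperateGrowth_freq_pow 0)]; simp
    rw [this]; rfl
  | succ k ih =>
    rw [Function.iterate_succ_apply', TemperedDistribution.derivCLM_apply_apply]
    have h1 : -SchwartzMap.derivCLM ℂ ℂ (𝓕 ψ) =
        𝓕 (SchwartzMap.smulLeftCLM ℂ (fun ξ => freq ξ ^ 1) ψ) := by
      have h := SchwartzMap.lineDerivOp_fourier_eq ψ (1 : ℝ)
      have h2 : SchwartzMap.derivCLM ℂ ℂ (𝓕 ψ) = LineDeriv.lineDerivOp (1 : ℝ) (𝓕 ψ) := by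
        ext x
        rw [SchwartzMap.derivCLM_apply, SchwartzMap.lineDerivOp_apply_eq_fderiv,
          fderiv_apply_one_eq_deriv]
      rw [h2, h, ← FourierTransform.fourier_neg]
      congr 1
      ext x
      have ht : Function.HasTemperateGrowth fun ξ : ℝ => inner ℝ ξ (1 : ℝ) := by fun_prop
      rw [SchwartzMap.smulLeftCLM_apply_apply (hasTemperateGrowth_freq_pow 1)]
      rw [neg_apply, smul_apply, SchwartzMap.smulLeftCLM_apply_apply ht]
      simp [freq]
      ring
    change ((TemperedDistribution.derivCLM ℂ)^[k] T) (-SchwartzMap.derivCLM ℂ ℂ (𝓕 ψ)) = _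
    rw [h1, ih]
    congr 2
    ext x
    simp only [SchwartzMap.smulLeftCLM_apply_apply (hasTemperateGrowth_freq_pow _), smul_eq_mul]
    ring

/-- Continuous functions on `(0, ∞)` with a limit at `0` are integrable against the kernel of the
fractional integral. -/
theorem intervalIntegrable_kernel_smul_of_tendsto {a t : ℝ} {f : ℝ → ℂ} {f0 : ℂ} (ha : 0 < a) (ht : 0 ≤ t)
    (hf : ContinuousOn f (Ioi 0)) (h0 : Tendsto f (𝓝[>] 0) (𝓝 f0)) :
    IntervalIntegrable (fun s => (t - s) ^ (a - 1) • f s) volume 0 t := by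
  have hg : ContinuousOn (Function.update f 0 f0) (Ici 0) := by
    rw [continuousOn_update_iff, Ici_sdiff_left]
    exact ⟨hf, fun _ => h0⟩
  refine (intervalIntegrable_kernel_smul ha ht hg).congr fun s hs => ?_
  rw [uIoc_of_le ht] at hs
  simp only [Function.update_of_ne hs.1.ne']

theorem exists_bound_of_tendsto {f : ℝ → ℂ} {f0 : ℂ} (τ : ℝ)
    (hf : ContinuousOn f (Ioi 0)) (h0 : Tendsto f (𝓝[>] 0) (𝓝 f0)) :
    ∃ C, ∀ t ∈ Ioc 0 τ, ‖f t‖ ≤ C := by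
  have hg : ContinuousOn (Function.update f 0 f0) (Ici 0) := by
    rw [continuousOn_update_iff, Ici_sdiff_left]
    exact ⟨hf, fun _ => h0⟩
  obtain ⟨C, hC⟩ := (isCompact_Icc (a := (0 : ℝ)) (b := τ)).exists_bound_of_continuousOn
    (hg.mono Icc_subset_Ici_self)
  refine ⟨C, fun t ht => ?_⟩
  have := hC t ⟨ht.1.le, ht.2⟩
  rwa [Function.update_of_ne ht.1.ne'] at this

theorem IsFundamentalSolution.continuousOn {α c : ℝ} {k : ℕ} {T : ℝ → 𝓢'(ℝ, ℂ)}
    (hT : IsFundamentalSolution α c k T) (φ : 𝓢(ℝ, ℂ)) : ContinuousOn (fun t => T t φ) (Ioi 0) :=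
  (hT.regular φ).1.continuousOn

/-- The integral equation satisfied by a fundamental solution, on the Fourier side. -/
theorem IsFundamentalSolution.integral_equation {α c : ℝ} {k : ℕ} {T : ℝ → 𝓢'(ℝ, ℂ)} (hα : 0 < α)
    (hα2 : α ≤ 2) (hT : IsFundamentalSolution α c k T) (ψ : 𝓢(ℝ, ℂ)) {t : ℝ} (ht : 0 < t) :
    T t (𝓕 ψ) = TemperedDistribution.delta (0 : ℝ) (𝓕 ψ) + fracInt α (fun s => (c : ℂ) *
      T s (𝓕 (SchwartzMap.smulLeftCLM ℂ (fun ξ => freq ξ ^ k) ψ))) t := by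
  rw [eq_add_fracInt_caputoDeriv hα hα2 (hT.regular (𝓕 ψ)) (hT.initial_value (𝓕 ψ))
    (fun h => hT.initial_velocity h (𝓕 ψ)) ht]
  congr 1
  refine fracInt_congr ht.le fun s hs _ => ?_
  rw [hT.equation _ s hs, derivCLM_iterate_fourier]

/-- One step of the Volterra iteration: the bound by a normalised power gains `a` in the exponent
and keeps its constant. -/
theorem norm_fracInt_le {a t B γ : ℝ} {f : ℝ → ℂ} (ha : 0 < a) (hγ : 0 ≤ γ) (ht : 0 < t)
    (hf : ∀ s, 0 < s → s ≤ t → ‖f s‖ ≤ B * normPow γ s) :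
    ‖fracInt a f t‖ ≤ B * normPow (γ + a) t := by
  have hG := Real.Gamma_pos_of_pos ha
  have hnn : ∀ s, 0 < s → s ≤ t → 0 ≤ (t - s) ^ (a - 1) := fun s _ h =>
    Real.rpow_nonneg (by linarith) _
  have h1 := fracInt_normPow (γ := γ) ha (by linarith) ht
  have e : ∀ s : ℝ, (t - s) ^ (a - 1) • ((normPow γ s : ℝ) : ℂ) =
      (((t - s) ^ (a - 1) * normPow γ s : ℝ) : ℂ) := by
    intro s; simp
  simp only [fracInt, e, intervalIntegral.integral_ofReal] at h1
  rw [Complex.real_smul, ← Complex.ofReal_mul] at h1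
  have h2 : (Real.Gamma a)⁻¹ * ∫ s in (0 : ℝ)..t, (t - s) ^ (a - 1) * normPow γ s =
    normPow (γ + a) t := by exact_mod_cast h1
  rw [← h2, fracInt, norm_smul, Real.norm_of_nonneg (by positivity), mul_left_comm,
    ← intervalIntegral.integral_const_mul]
  gcongr
  refine intervalIntegral.norm_integral_le_of_norm_le ht.le ?_ ?_
  · refine Eventually.of_forall fun s hs => ?_
    rw [norm_smul, Real.norm_of_nonneg (hnn s hs.1 hs.2), mul_left_comm]
    exact mul_le_mul_of_nonneg_left (hf s hs.1 hs.2) (hnn s hs.1 hs.2)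
  · have := (intervalIntegrable_sub_rpow (t := t) ha).mul_continuousOn
      (continuous_normPow hγ).continuousOn
    exact this.const_mul B

theorem tsupport_smulLeftCLM_iterate (f : ℝ → ℂ) (ψ : 𝓢(ℝ, ℂ)) (n : ℕ) :
    tsupport ((SchwartzMap.smulLeftCLM ℂ f)^[n] ψ : 𝓢(ℝ, ℂ)) ⊆ tsupport ψ := by
  induction n with
  | zero => exact subset_rfl
  | succ n ih =>
    rw [Function.iterate_succ_apply']
    exact ((SchwartzMap.tsupport_smulLeftCLM_subset f _).trans inter_subset_left).trans ih

/-- The growth of Gamma is split in the uniqueness proof: one square root makes a series of test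
functions summable, the other still forces the Volterra iteration to `0`. -/
theorem exists_sqrt_pow_div_Gamma_le {α : ℝ} (hα : 0 < α) (B : ℝ) (hB : 0 < B) :
    ∃ C : ℝ, 0 < C ∧ ∀ n : ℕ, B ^ n / √(Real.Gamma (n * α + 1)) ≤ C * (1 / 2) ^ n := by
  obtain ⟨C, hC, h⟩ := exists_pow_div_Gamma_le hα (2 * B ^ 2) (by positivity)
  refine ⟨√C, by positivity, fun n => ?_⟩
  have hG : 0 < Real.Gamma (n * α + 1) := Real.Gamma_pos_of_pos (by positivity)
  have h1 : B ^ n / √(Real.Gamma (n * α + 1)) = √((B ^ 2) ^ n / Real.Gamma (n * α + 1)) := by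
    rw [Real.sqrt_div (by positivity), ← pow_mul, mul_comm 2 n, pow_mul, Real.sqrt_sq (by positivity)]
  have h2 : √C * (1 / 2) ^ n = √(C * ((1 / 2) ^ n) ^ 2) := by
    rw [Real.sqrt_mul hC.le, Real.sqrt_sq (by positivity)]
  rw [h1, h2]
  apply Real.sqrt_le_sqrt
  have h3 := h n
  rw [mul_pow] at h3
  have : (B ^ 2) ^ n / Real.Gamma (n * α + 1) = (1 / 2) ^ n * (2 ^ n * (B ^ 2) ^ n / Real.Gamma (n * α + 1)) := by
    rw [one_div, inv_pow]; field_simp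
  rw [this]
  calc (1 / 2) ^ n * (2 ^ n * (B ^ 2) ^ n / Real.Gamma (n * α + 1)) ≤ (1 / 2) ^ n * (C * (1 / 2) ^ n) := by
        gcongr
    _ = _ := by ring

/-- Fundamental solutions are unique. -/
theorem IsFundamentalSolution.unique {α c : ℝ} {k : ℕ} {T T' : ℝ → 𝓢'(ℝ, ℂ)} (hα : 0 < α)
    (hα2 : α ≤ 2) (hT : IsFundamentalSolution α c k T) (hT' : IsFundamentalSolution α c k T')
    {τ : ℝ} (hτ : 0 < τ) : T τ = T' τ := by
  set N : 𝓢(ℝ, ℂ) →L[ℂ] 𝓢(ℝ, ℂ) := SchwartzMap.smulLeftCLM ℂ (fun ξ => freq ξ ^ k) with hN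
  have hft := hasTemperateGrowth_freq_pow k
  set L : ℝ → 𝓢'(ℝ, ℂ) := fun t => 𝓕 (T t) - 𝓕 (T' t) with hL
  have hLa : ∀ t ψ, L t ψ = T t (𝓕 ψ) - T' t (𝓕 ψ) := fun t ψ => rfl
  -- the homogeneous integral equation
  have hvolt : ∀ (ψ : 𝓢(ℝ, ℂ)) (t : ℝ), 0 < t → L t ψ = fracInt α (fun s => (c : ℂ) * L s (N ψ)) t := by
    intro ψ t ht
    rw [hLa, hT.integral_equation hα hα2 ψ ht, hT'.integral_equation hα hα2 ψ ht, add_sub_add_left_eq_sub]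
    have hi : ∀ {S : ℝ → 𝓢'(ℝ, ℂ)}, IsFundamentalSolution α c k S → ∀ d : ℂ, IntervalIntegrable
        (fun s => (t - s) ^ (α - 1) • (d * S s (𝓕 (N ψ)))) volume 0 t := fun hS d =>
      intervalIntegrable_kernel_smul_of_tendsto hα ht.le
        (continuousOn_const.mul (hS.continuousOn _)) ((hS.initial_value _).const_mul d)
    have h1 := fracInt_add (hi hT c) (hi hT' (-c))
    have h2 : fracInt α (fun s => -(c : ℂ) * T' s (𝓕 (N ψ))) t =
        -fracInt α (fun s => (c : ℂ) * T' s (𝓕 (N ψ))) t := by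
      simp only [fracInt, neg_mul, smul_neg, intervalIntegral.integral_neg]
    rw [h2, ← sub_eq_add_neg] at h1
    rw [← h1]
    congr 1
    ext s
    rw [hLa]
    ring
  suffices hz : L τ = 0 by
    have h1 : 𝓕 (T τ) = 𝓕 (T' τ) := sub_eq_zero.1 hz
    have h2 := congrArg (fun S : 𝓢'(ℝ, ℂ) => 𝓕⁻ S) h1
    simpa using h2
  refine eq_zero_of_forall_compactSupport fun ψ hψ => ?_
  obtain ⟨R, hR⟩ := hψ.isBounded.subset_closedBall 0
  -- On the support of `ψ` the symbol is bounded, so the seminorms of `N^[n] ψ` grow geometrically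
  -- at most and the weights `w n` make them summable. Uniform boundedness in `t ∈ (0, τ]` then
  -- gives `‖L t (N^[n] ψ)‖ ≤ C / w n`.
  set w : ℕ → ℝ := fun n => (√(Real.Gamma (n * α + 1)))⁻¹ with hw
  have hG : ∀ n : ℕ, 0 < Real.Gamma (n * α + 1) := fun n => Real.Gamma_pos_of_pos (by positivity)
  have hw0 : ∀ n, 0 < w n := fun n => by have := hG n; simp only [hw]; positivity
  have hsum : ∀ k l, Summable fun n => SchwartzMap.seminorm ℂ k l ((w n : ℂ) • (N^[n] ψ)) := by
    intro k l
    obtain ⟨B, hB0, hB⟩ := exists_seminorm_smulLeftCLM_le hft R l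
    set Q := ∑ j ∈ Finset.range (l + 1), SchwartzMap.seminorm ℂ k j ψ
    have hQ0 : 0 ≤ Q := Finset.sum_nonneg fun i _ => apply_nonneg _ _
    have hb : ∀ n : ℕ, ∑ j ∈ Finset.range (l + 1), SchwartzMap.seminorm ℂ k j (N^[n] ψ) ≤ B ^ n * Q := by
      intro n
      induction n with
      | zero => simp [Q]
      | succ n ih =>
        rw [Function.iterate_succ_apply']
        refine (hB k _ ((tsupport_smulLeftCLM_iterate _ ψ n).trans hR)).trans ?_
        rw [pow_succ', mul_assoc]
        gcongr
    obtain ⟨C, hC0, hC⟩ := exists_sqrt_pow_div_Gamma_le hα (B + 1) (by positivity)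
    refine Summable.of_nonneg_of_le (fun n => apply_nonneg _ _) (fun n => ?_)
      ((summable_geometric_of_lt_one (r := 1 / 2) (by norm_num) (by norm_num)).mul_left (C * Q))
    rw [map_smul_eq_mul, Complex.norm_of_nonneg (hw0 n).le]
    calc w n * SchwartzMap.seminorm ℂ k l (N^[n] ψ) ≤ w n * ((B + 1) ^ n * Q) := by
          have h1 := Finset.single_le_sum (f := fun j => SchwartzMap.seminorm ℂ k j (N^[n] ψ))
            (fun j _ => apply_nonneg _ _) (Finset.self_mem_range_succ l)
          have h2 : B ^ n ≤ (B + 1) ^ n := by gcongr; linarith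
          have := hw0 n
          gcongr
          exact h1.trans ((hb n).trans (by gcongr))
      _ = ((B + 1) ^ n / √(Real.Gamma (n * α + 1))) * Q := by simp only [hw]; ring
      _ ≤ C * (1 / 2) ^ n * Q := by gcongr; exact hC n
      _ = _ := by ring
  obtain ⟨C, hC⟩ := exists_uniform_bound (fun t : Ioc (0 : ℝ) τ => L t) (fun φ => by
    obtain ⟨C1, h1⟩ := exists_bound_of_tendsto τ (hT.continuousOn (𝓕 φ)) (hT.initial_value (𝓕 φ))
    obtain ⟨C2, h2⟩ := exists_bound_of_tendsto τ (hT'.continuousOn (𝓕 φ)) (hT'.initial_value (𝓕 φ))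
    refine ⟨C1 + C2, fun t => ?_⟩
    rw [hLa]
    exact (norm_sub_le _ _).trans (add_le_add (h1 t t.2) (h2 t t.2))) hsum
  have hC' : ∀ t ∈ Ioc 0 τ, ∀ n : ℕ, ‖L t (N^[n] ψ)‖ ≤ C * √(Real.Gamma (n * α + 1)) := by
    intro t ht n
    have := hC ⟨t, ht⟩ n
    simp only [map_smul, norm_smul, Complex.norm_of_nonneg (hw0 n).le] at this
    have hs : 0 < √(Real.Gamma (n * α + 1)) := Real.sqrt_pos.2 (hG n)
    rwa [hw, inv_mul_le_iff₀ hs, mul_comm] at this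
  -- Applying the integral equation `n` times yields `t ^ (nα) / Γ(nα + 1)`; at `j = 0` this beats
  -- the loss `√Γ(nα + 1)`.
  have hiter : ∀ (n j : ℕ) (t : ℝ), t ∈ Ioc 0 τ →
      ‖L t (N^[j] ψ)‖ ≤ |c| ^ n * (C * √(Real.Gamma ((n + j : ℕ) * α + 1))) * normPow (n * α) t := by
    intro n
    induction n with
    | zero =>
      intro j t ht
      simpa [normPow] using hC' t ht j
    | succ n ih =>
      intro j t ht
      rw [hvolt _ t ht.1]
      have := norm_fracInt_le (a := α) (γ := n * α) (t := t)
        (B := |c| * (|c| ^ n * (C * √(Real.Gamma ((n + (j + 1) : ℕ) * α + 1)))))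
        (f := fun s => (c : ℂ) * L s (N (N^[j] ψ))) hα (by positivity) ht.1 (fun s hs hst => by
          rw [norm_mul, Complex.norm_real, Real.norm_eq_abs, mul_assoc]
          have := ih (j + 1) s ⟨hs, hst.trans ht.2⟩
          rw [Function.iterate_succ_apply'] at this
          gcongr)
      refine this.trans (le_of_eq ?_)
      rw [show n + (j + 1) = n + 1 + j by ring]
      push_cast
      rw [show (n : ℝ) * α + α = (n + 1) * α by ring, pow_succ']
      ring
  obtain ⟨D, hD0, hD⟩ := exists_sqrt_pow_div_Gamma_le hα (|c| * τ ^ α + 1) (by positivity)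
  have hC0 : 0 ≤ C := (norm_nonneg _).trans (hC ⟨τ, hτ, le_rfl⟩ 0)
  have hfin : ∀ n : ℕ, ‖L τ ψ‖ ≤ C * D * (1 / 2) ^ n := by
    intro n
    have h1 := hiter n 0 τ ⟨hτ, le_rfl⟩
    simp only [Function.iterate_zero, id_eq, add_zero] at h1
    have hs : 0 < √(Real.Gamma (n * α + 1)) := Real.sqrt_pos.2 (hG n)
    have h2 : √(Real.Gamma (n * α + 1)) * normPow (n * α) τ = (τ ^ α) ^ n / √(Real.Gamma (n * α + 1)) := by
      rw [normPow, mul_comm (n : ℝ) α, Real.rpow_mul hτ.le, Real.rpow_natCast, mul_comm α n]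
      rw [eq_div_iff hs.ne']
      have := Real.mul_self_sqrt (hG n).le
      have hg := (hG n).ne'
      rw [mul_right_comm, this]
      field_simp
    calc ‖L τ ψ‖ ≤ |c| ^ n * C * (√(Real.Gamma (n * α + 1)) * normPow (n * α) τ) := by
          refine h1.trans (le_of_eq (by ring))
      _ = C * ((|c| * τ ^ α) ^ n / √(Real.Gamma (n * α + 1))) := by rw [h2, mul_pow]; ring
      _ ≤ C * ((|c| * τ ^ α + 1) ^ n / √(Real.Gamma (n * α + 1))) := by
          gcongr; linarith
      _ ≤ C * (D * (1 / 2) ^ n) := by gcongr; exact hD n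
      _ = _ := by ring
  have hlim : Tendsto (fun n : ℕ => C * D * (1 / 2 : ℝ) ^ n) atTop (𝓝 0) := by
    simpa using (tendsto_pow_atTop_nhds_zero_of_lt_one (r := (1 / 2 : ℝ)) (by norm_num) (by norm_num)).const_mul (C * D)
  exact norm_le_zero_iff.1 (ge_of_tendsto' hlim hfin)

/-! ### Existence: Mittag-Leffler multipliers solve the Caputo problem. -/

/-- The cosine transform of a measure on the line. -/
def cosTransform (μ : Measure ℝ) (x : ℝ) : ℝ := ∫ z, Real.cos (x * z) ∂μ

theorem continuous_cosTransform (μ : Measure ℝ) [IsFiniteMeasure μ] : Continuous (cosTransform μ) := by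
  refine continuous_of_dominated (bound := fun _ => 1) (fun x => ?_) (fun x => ?_) (by simp) ?_
  · exact (by fun_prop : Continuous fun z => Real.cos (x * z)).aestronglyMeasurable
  · exact Eventually.of_forall fun z => by simpa using Real.abs_cos_le_one _
  · exact Eventually.of_forall fun z => by fun_prop

theorem abs_cosTransform_le (μ : Measure ℝ) [IsProbabilityMeasure μ] (x : ℝ) :
    |cosTransform μ x| ≤ 1 := by
  have := norm_integral_le_of_norm_le_const (μ := μ) (f := fun z => Real.cos (x * z)) (C := 1)
    (Eventually.of_forall fun z => by simpa using Real.abs_cos_le_one _)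
  simpa [cosTransform] using this

section

variable {ν : ℝ} {μ : Measure ℝ}

theorem IsMittagLefflerLaw.hasSum_cosTransform (h : IsMittagLefflerLaw ν μ) (hν : 0 < ν) (b : ℝ)
    {t : ℝ} (ht : 0 < t) : HasSum (fun n : ℕ => (-b ^ 2) ^ n * normPow (n * (2 * ν)) t)
      (cosTransform μ (b * t ^ ν)) := by
  have e : ∀ n : ℕ, (-b ^ 2) ^ n * normPow (n * (2 * ν)) t =
      (-(b * t ^ ν) ^ 2) ^ n / Real.Gamma (n * (2 * ν) + 1) := by
    intro n
    have h1 : t ^ ((n : ℝ) * (2 * ν)) = ((t ^ ν) ^ 2) ^ n := by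
      rw [← pow_mul, ← Real.rpow_natCast (t ^ ν), ← Real.rpow_mul ht.le]
      congr 1; push_cast; ring
    rw [normPow, h1, mul_pow, ← neg_mul, mul_pow]
    ring
  simp only [e, cosTransform, h.integral_cos]
  refine Summable.hasSum (Summable.of_norm ?_)
  refine (summable_pow_div_Gamma (α := 2 * ν) (by positivity) ((b * t ^ ν) ^ 2)).congr fun n => ?_
  rw [norm_div, norm_pow, norm_neg, Real.norm_eq_abs, Real.norm_of_nonneg]
  exact (Real.Gamma_pos_of_pos (by positivity)).le

/-- Fractional integration of order `2ν` shifts the series in the normalised powers `t ^ (2νn) /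
Γ(2νn + 1)` by one index. -/
theorem IsMittagLefflerLaw.cosTransform_integral_equation (h : IsMittagLefflerLaw ν μ) (hν : 0 < ν)
    (b : ℝ) {t : ℝ} (ht : 0 < t) : (cosTransform μ (b * t ^ ν) : ℂ) =
      1 + ((-b ^ 2 : ℝ) : ℂ) * fracInt (2 * ν) (fun s => (cosTransform μ (b * s ^ ν) : ℂ)) t := by
  have hα : 0 < 2 * ν := by positivity
  have h1 : HasSum (fun n : ℕ => (((-b ^ 2) ^ n : ℝ) : ℂ) * (normPow ((n + 1 : ℕ) * (2 * ν)) t : ℂ))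
      (fracInt (2 * ν) (fun s => (cosTransform μ (b * s ^ ν) : ℂ)) t) := by
    have hnp : ∀ n : ℕ, (0 : ℝ) ≤ n * (2 * ν) := fun n => by positivity
    have hS : Summable fun n : ℕ => |b ^ 2 * (t ^ ν) ^ 2| ^ n / Real.Gamma (n * (2 * ν) + 1) :=
      summable_pow_div_Gamma hα _
    -- Each power on `(0, t]` is dominated by its value at `t`, times the integrable kernel.
    have h2 := intervalIntegral.hasSum_integral_of_dominated_convergence (a := 0) (b := t)
      (μ := volume)
      (F := fun (n : ℕ) s => (t - s) ^ (2 * ν - 1) •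
        ((((-b ^ 2) ^ n : ℝ) : ℂ) * (normPow (n * (2 * ν)) s : ℂ)))
      (f := fun s => (t - s) ^ (2 * ν - 1) • (cosTransform μ (b * s ^ ν) : ℂ))
      (fun n s => (t - s) ^ (2 * ν - 1) * (|b ^ 2 * (t ^ ν) ^ 2| ^ n / Real.Gamma (n * (2 * ν) + 1)))
      (fun n => ?_) (fun n => ?_) ?_ ?_ ?_
    · refine (h2.const_smul (Real.Gamma (2 * ν))⁻¹).congr_fun fun n => ?_
      have h3 := fracInt_sum_const_mul (a := 2 * ν) (t := t) {()} (fun _ => (((-b ^ 2) ^ n : ℝ) : ℂ))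
        (f := fun _ s => (normPow (n * (2 * ν)) s : ℂ)) fun _ _ =>
          intervalIntegrable_kernel_smul hα ht.le
            (Complex.continuous_ofReal.comp (continuous_normPow (hnp n))).continuousOn
      simp only [Finset.sum_singleton] at h3
      rw [fracInt_normPow hα (by linarith [hnp n]) ht] at h3
      rw [show ((n + 1 : ℕ) : ℝ) * (2 * ν) = n * (2 * ν) + 2 * ν by push_cast; ring, ← h3, fracInt]
    · have := (intervalIntegrable_kernel_smul (t := t) hα ht.le
        (f := fun s => (((-b ^ 2) ^ n : ℝ) : ℂ) * (normPow (n * (2 * ν)) s : ℂ))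
        (continuous_const.mul (Complex.continuous_ofReal.comp
          (continuous_normPow (hnp n)))).continuousOn)
      exact this.def'.aestronglyMeasurable
    · refine Eventually.of_forall fun s hs => ?_
      rw [uIoc_of_le ht.le] at hs
      have hk : 0 ≤ (t - s) ^ (2 * ν - 1) := Real.rpow_nonneg (sub_nonneg.2 hs.2) _
      have hG : 0 < Real.Gamma (n * (2 * ν) + 1) := Real.Gamma_pos_of_pos (by linarith [hnp n])
      rw [norm_smul, Real.norm_of_nonneg hk, norm_mul, Complex.norm_real, Complex.norm_real,
        norm_pow, norm_neg, normPow, norm_div, Real.norm_of_nonneg hG.le, mul_div_assoc']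
      gcongr
      rw [abs_mul, mul_pow, Real.norm_eq_abs, Real.norm_of_nonneg (Real.rpow_nonneg hs.1.le _),
        abs_of_nonneg (by positivity : 0 ≤ (t ^ ν) ^ 2)]
      gcongr
      have : ((t ^ ν) ^ 2) ^ n = t ^ ((n : ℝ) * (2 * ν)) := by
        rw [← pow_mul, ← Real.rpow_natCast (t ^ ν), ← Real.rpow_mul ht.le]
        congr 1; push_cast; ring
      rw [this]
      exact Real.rpow_le_rpow hs.1.le hs.2 (hnp n)
    · exact Eventually.of_forall fun s hs => hS.mul_left _
    · simp only [tsum_mul_left]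
      exact (intervalIntegrable_sub_rpow hα).mul_const _
    · refine Eventually.of_forall fun s hs => ?_
      rw [uIoc_of_le ht.le] at hs
      have := Complex.hasSum_ofReal.2 (h.hasSum_cosTransform hν b hs.1)
      push_cast at this ⊢
      exact this.const_smul _
  have h3 := Complex.hasSum_ofReal.2 (h.hasSum_cosTransform hν b ht)
  have h4 := (hasSum_nat_add_iff' 1).2 h3
  have h5 := h1.mul_left ((-b ^ 2 : ℝ) : ℂ)
  have h6 := h4.unique (h5.congr_fun fun n => by push_cast; ring)
  rw [← h6]
  simp [normPow]

/-- Pairing of a test function with the multiplier `cosTransform μ (b ξ t^ν)`. -/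
def multiplierPairing (μ : Measure ℝ) (ν : ℝ) (b : ℝ → ℝ) (ψ : 𝓢(ℝ, ℂ)) (t : ℝ) : ℂ :=
  ∫ ξ, ψ ξ * (cosTransform μ (b ξ * |t| ^ ν) : ℂ)

/-- The `|t|` in `multiplierPairing` makes continuity hold on the whole line, as `caputo_fracChain`
demands. -/
theorem continuous_multiplierPairing [IsProbabilityMeasure μ] (hν : 0 < ν) {b : ℝ → ℝ}
    (hb : Continuous b) (ψ : 𝓢(ℝ, ℂ)) : Continuous (multiplierPairing μ ν b ψ) := by
  have hc := continuous_cosTransform μ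
  have hp : Continuous fun t : ℝ => |t| ^ ν := continuous_abs.rpow_const fun _ => Or.inr hν.le
  refine continuous_of_dominated (bound := fun ξ => ‖ψ ξ‖) (fun t => ?_) (fun t => ?_)
    ψ.integrable.norm ?_
  · exact (by fun_prop : Continuous fun ξ =>
      ψ ξ * (cosTransform μ (b ξ * |t| ^ ν) : ℂ)).aestronglyMeasurable
  · refine Eventually.of_forall fun ξ => ?_
    rw [norm_mul, Complex.norm_real]
    exact mul_le_of_le_one_right (norm_nonneg _) (abs_cosTransform_le μ _)
  · exact Eventually.of_forall fun ξ => by fun_prop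

theorem IsMittagLefflerLaw.multiplierPairing_integral_equation (h : IsMittagLefflerLaw ν μ)
    (hν : 0 < ν) {b : ℝ → ℝ} (hb : Continuous b) {ψ χ : 𝓢(ℝ, ℂ)}
    (hχ : ∀ ξ, χ ξ = ((-b ξ ^ 2 : ℝ) : ℂ) * ψ ξ) {t : ℝ} (ht : 0 < t) :
    multiplierPairing μ ν b ψ t = (∫ ξ, ψ ξ) + fracInt (2 * ν) (multiplierPairing μ ν b χ) t := by
  have := h.prob
  have hα : 0 < 2 * ν := by positivity
  have hc := continuous_cosTransform μ
  have hp : Continuous fun t : ℝ => |t| ^ ν := continuous_abs.rpow_const fun _ => Or.inr hν.le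
  set m := volume.restrict (Ioc 0 t)
  have hker : IntegrableOn (fun s => (t - s) ^ (2 * ν - 1)) (Ioc 0 t) :=
    (intervalIntegrable_iff_integrableOn_Ioc_of_le ht.le).1 (intervalIntegrable_sub_rpow hα)
  have hcont : Continuous fun p : ℝ × ℝ => χ p.2 * (cosTransform μ (b p.2 * |p.1| ^ ν) : ℂ) := by
    have : Continuous fun p : ℝ × ℝ => |p.1| ^ ν := hp.comp continuous_fst
    fun_prop
  have hprod : Integrable (fun p : ℝ × ℝ => (t - p.1) ^ (2 * ν - 1) •
      (χ p.2 * (cosTransform μ (b p.2 * |p.1| ^ ν) : ℂ))) (m.prod volume) := by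
    refine (Integrable.mul_prod hker.norm χ.integrable.norm).mono' ?_ ?_
    · exact (hker.aestronglyMeasurable.comp_fst).smul hcont.aestronglyMeasurable
    · refine Eventually.of_forall fun p => ?_
      rw [norm_smul, norm_mul, Complex.norm_real]
      gcongr
      exact mul_le_of_le_one_right (norm_nonneg _) (abs_cosTransform_le μ _)
  have hfub : fracInt (2 * ν) (multiplierPairing μ ν b χ) t =
      ∫ ξ, χ ξ * fracInt (2 * ν) (fun s => (cosTransform μ (b ξ * s ^ ν) : ℂ)) t := by
    simp only [fracInt, multiplierPairing, ← integral_smul]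
    rw [intervalIntegral.integral_of_le ht.le]
    simp only [← integral_smul]
    rw [integral_integral_swap (hprod.smul (Real.Gamma (2 * ν))⁻¹)]
    congr 1
    ext ξ
    rw [intervalIntegral.integral_of_le ht.le, ← integral_smul, ← integral_const_mul]
    refine setIntegral_congr_fun measurableSet_Ioc fun s hs => ?_
    simp only [abs_of_pos hs.1, mul_smul_comm]
  rw [hfub]
  have h1 : Integrable fun ξ => ψ ξ * (cosTransform μ (b ξ * |t| ^ ν) : ℂ) := by
    refine ψ.integrable.norm.mono' (by fun_prop : Continuous _).aestronglyMeasurable ?_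
    refine Eventually.of_forall fun ξ => ?_
    rw [norm_mul, Complex.norm_real]
    exact mul_le_of_le_one_right (norm_nonneg _) (abs_cosTransform_le μ _)
  have h2 : ∀ ξ, χ ξ * fracInt (2 * ν) (fun s => (cosTransform μ (b ξ * s ^ ν) : ℂ)) t =
      ψ ξ * (cosTransform μ (b ξ * |t| ^ ν) : ℂ) - ψ ξ := by
    intro ξ
    rw [abs_of_pos ht, h.cosTransform_integral_equation hν (b ξ) ht, hχ]
    ring
  simp only [h2]
  rw [integral_sub h1 ψ.integrable, multiplierPairing]
  ring

/-- A family of tempered distributions whose Fourier transforms are the multipliers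
`cosTransform μ (b ξ t^ν)` solves the equation with symbol `-b²`. -/
theorem IsMittagLefflerLaw.isFundamentalSolution (h : IsMittagLefflerLaw ν μ) (hν : 0 < ν)
    (hν1 : ν ≤ 1) {b : ℝ → ℝ} (hb : Continuous b) {c : ℝ} {k : ℕ}
    (hbk : ∀ ξ, (c : ℂ) * freq ξ ^ k = ((-b ξ ^ 2 : ℝ) : ℂ)) {T : ℝ → 𝓢'(ℝ, ℂ)}
    (hT : ∀ t, 0 < t → ∀ ψ : 𝓢(ℝ, ℂ), T t (𝓕 ψ) = ∫ ξ, ψ ξ * (cosTransform μ (b ξ * t ^ ν) : ℂ)) :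
    IsFundamentalSolution (2 * ν) c k T := by
  have := h.prob
  have hα : 0 < 2 * ν := by positivity
  set N : 𝓢(ℝ, ℂ) →L[ℂ] 𝓢(ℝ, ℂ) := SchwartzMap.smulLeftCLM ℂ (fun ξ => freq ξ ^ k) with hN
  set D : 𝓢(ℝ, ℂ) → 𝓢(ℝ, ℂ) := fun ψ => (c : ℂ) • N ψ with hD
  have hDξ : ∀ ψ ξ, D ψ ξ = ((-b ξ ^ 2 : ℝ) : ℂ) * ψ ξ := by
    intro ψ ξ
    rw [← hbk, hD, smul_apply, hN,
      SchwartzMap.smulLeftCLM_apply_apply (hasTemperateGrowth_freq_pow k), smul_eq_mul, smul_eq_mul,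
      mul_assoc]
  have hTS : ∀ t, 0 < t → ∀ ψ : 𝓢(ℝ, ℂ), T t (𝓕 ψ) = multiplierPairing μ ν b ψ t := by
    intro t ht ψ
    rw [hT t ht, multiplierPairing, abs_of_pos ht]
  -- The chain pairs the multiplier with the iterates `D^[j] ψ`, where `D` multiplies by `c * freq ξ
  -- ^ k = -b ξ ^ 2`.
  have key : ∀ ψ : 𝓢(ℝ, ℂ), _ := fun ψ => caputo_fracChain (α := 2 * ν)
    (Φ := fun j => multiplierPairing μ ν b (D^[j] ψ)) (A := fun j => ∫ ξ, (D^[j] ψ) ξ)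
    hα (by linarith) (fun j => continuous_multiplierPairing hν hb _)
    (fun j t ht => h.multiplierPairing_integral_equation hν hb
      (fun ξ => by rw [Function.iterate_succ_apply', hDξ]) ht)
    (g := fun t => T t (𝓕 ψ)) (fun t ht => hTS t ht ψ)
  have hsurj : ∀ φ : 𝓢(ℝ, ℂ), ∃ ψ : 𝓢(ℝ, ℂ), φ = 𝓕 ψ := fun φ => ⟨𝓕⁻ φ, by simp⟩
  refine ⟨fun φ => ?_, fun φ t ht => ?_, fun φ => ?_, fun h1 φ => ?_⟩ <;>
    obtain ⟨ψ, rfl⟩ := hsurj φ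
  · exact (key ψ).1
  · rw [(key ψ).2.1 t ht, derivCLM_iterate_fourier, ← hN, ← smul_eq_mul (c : ℂ), ← map_smul,
      ← FourierTransform.fourier_smul]
    exact (hTS t ht _).symm
  · have e : TemperedDistribution.delta (0 : ℝ) (𝓕 ψ) = ∫ ξ, ψ ξ := by
      rw [TemperedDistribution.delta_apply, SchwartzMap.fourier_coe, Real.fourier_eq]
      simp
    rw [e]
    exact (key ψ).2.2.1
  · exact (key ψ).2.2.2 h1

end

/-! ### Complex Gaussians and the Fourier transform of the Fresnel function. -/

theorem integral_fourier_mul_gaussian {b : ℂ} (hb : 0 < b.re) (ψ : 𝓢(ℝ, ℂ)) :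
    ∫ x : ℝ, (𝓕 ψ) x * Complex.exp (-(Real.pi : ℂ) * b⁻¹ * x ^ 2) =
      b ^ (1 / 2 : ℂ) * ∫ ξ : ℝ, ψ ξ * Complex.exp (-(Real.pi : ℂ) * b * ξ ^ 2) := by
  have hb' : 0 < (b⁻¹).re := by
    rw [Complex.inv_re]
    have : 0 < Complex.normSq b := Complex.normSq_pos.2 fun h => by simp [h] at hb
    positivity
  have hint : Integrable fun x : ℝ => Complex.exp (-(Real.pi : ℂ) * b⁻¹ * x ^ 2) := by
    have := integrable_cexp_neg_mul_sq (b := Real.pi * b⁻¹)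
      (by rw [Complex.re_ofReal_mul]; have := Real.pi_pos; positivity)
    simpa [neg_mul] using this
  -- The transform is moved from `ψ` to the Gaussian, where it is explicit.
  have h := VectorFourier.integral_fourierIntegral_smul_eq_flip (L := innerₗ ℝ) (μ := volume)
    (ν := volume) Real.continuous_fourierChar continuous_inner ψ.integrable hint
  rw [flip_innerₗ] at h
  have h2 := fourier_gaussian_pi hb'
  have harg : b.arg ≠ Real.pi := by
    intro h
    rw [Complex.arg_eq_pi_iff] at h
    linarith [h.1]
  rw [Complex.inv_cpow _ _ harg] at h2
  rw [← integral_const_mul]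
  refine h.trans ?_
  congr 1
  ext ξ
  have h3 := congrFun h2 ξ
  rw [smul_eq_mul]
  change ψ ξ * (𝓕 (fun x : ℝ => Complex.exp (-(Real.pi : ℂ) * b⁻¹ * x ^ 2))) ξ = _
  rw [h3, div_inv_eq_mul, div_inv_eq_mul]
  ring

theorem norm_exp_neg_pi_mul_le {b : ℂ} (hb : 0 ≤ b.re) (x : ℝ) :
    ‖Complex.exp (-(Real.pi : ℂ) * b * x ^ 2)‖ ≤ 1 := by
  rw [Complex.norm_exp, Real.exp_le_one_iff]
  have : (-(Real.pi : ℂ) * b * x ^ 2).re = -(Real.pi * b.re * x ^ 2) := by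
    rw [← Complex.ofReal_neg, ← Complex.ofReal_pow, mul_comm, Complex.re_ofReal_mul,
      Complex.re_ofReal_mul]
    ring
  rw [this]
  have := Real.pi_pos
  have : 0 ≤ Real.pi * b.re * x ^ 2 := by positivity
  linarith

/-- The Gaussian identity extends to the boundary of the half plane. -/
theorem integral_fourier_mul_gaussian_of_re_nonneg {b : ℂ} (hb : 0 ≤ b.re) (hb0 : b ≠ 0)
    (ψ : 𝓢(ℝ, ℂ)) :
    ∫ x : ℝ, (𝓕 ψ) x * Complex.exp (-(Real.pi : ℂ) * b⁻¹ * x ^ 2) =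
      b ^ (1 / 2 : ℂ) * ∫ ξ : ℝ, ψ ξ * Complex.exp (-(Real.pi : ℂ) * b * ξ ^ 2) := by
  have hlim : Tendsto (fun ε : ℝ => b + ε) (𝓝[>] 0) (𝓝 b) := by
    have : Continuous fun ε : ℝ => b + ε := by fun_prop
    simpa using (this.tendsto 0).mono_left nhdsWithin_le_nhds
  have hre : ∀ ε : ℝ, 0 < ε → 0 < (b + ε).re := fun ε hε => by simp; linarith
  -- A nonzero `b` in the closed right half plane stays off the branch cut, so the square root is
  -- continuous there.
  have hslit : b ∈ Complex.slitPlane := by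
    rw [Complex.mem_slitPlane_iff]
    rcases hb.lt_or_eq with h | h
    · exact Or.inl h
    · exact Or.inr fun h' => hb0 (Complex.ext h.symm h')
  have key : ∀ (χ : 𝓢(ℝ, ℂ)) (f : ℝ → ℂ) (z : ℂ), Tendsto f (𝓝[>] 0) (𝓝 z) →
      (∀ ε, 0 < ε → 0 ≤ (f ε).re) →
      Tendsto (fun ε => ∫ x, χ x * Complex.exp (-(Real.pi : ℂ) * f ε * x ^ 2)) (𝓝[>] 0)
        (𝓝 (∫ x, χ x * Complex.exp (-(Real.pi : ℂ) * z * x ^ 2))) := by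
    intro χ f z hf hr
    refine tendsto_integral_filter_of_dominated_convergence (fun x => ‖χ x‖) ?_ ?_
      χ.integrable.norm ?_
    · exact Eventually.of_forall fun ε => (by fun_prop : Continuous _).aestronglyMeasurable
    · filter_upwards [self_mem_nhdsWithin] with ε hε
      refine Eventually.of_forall fun x => ?_
      rw [norm_mul]
      exact mul_le_of_le_one_right (norm_nonneg _) (norm_exp_neg_pi_mul_le (hr ε hε) x)
    · refine Eventually.of_forall fun x => ?_
      exact (((hf.const_mul _).mul_const _).cexp).const_mul _
  have h1 := key (𝓕 ψ) (fun ε => (b + ε)⁻¹) b⁻¹ (hlim.inv₀ hb0) fun ε hε => by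
    rw [Complex.inv_re]; exact div_nonneg (hre ε hε).le (Complex.normSq_nonneg _)
  have h2 := key ψ (fun ε => b + ε) b hlim fun ε hε => (hre ε hε).le
  have h3 : Tendsto (fun ε : ℝ => (b + ε) ^ (1 / 2 : ℂ)) (𝓝[>] 0) (𝓝 (b ^ (1 / 2 : ℂ))) :=
    hlim.cpow tendsto_const_nhds hslit
  refine tendsto_nhds_unique h1 ((h3.mul h2).congr' ?_)
  filter_upwards [self_mem_nhdsWithin] with ε hε
  exact (integral_fourier_mul_gaussian (hre ε hε) ψ).symm

theorem ofReal_mul_cpow_half {r : ℝ} (hr : 0 < r) {z : ℂ} (hz : z ≠ 0) :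
    ((r : ℂ) * z) ^ (1 / 2 : ℂ) = √r * Complex.exp (Complex.log z / 2) := by
  rw [Complex.cpow_def_of_ne_zero (mul_ne_zero (by exact_mod_cast hr.ne') hz),
    Complex.log_ofReal_mul hr hz, Real.sqrt_eq_rpow, Real.rpow_def_of_pos hr, Complex.ofReal_exp,
    ← Complex.exp_add]
  congr 1
  push_cast
  ring

theorem ofReal_fresnel {x s : ℝ} : (fresnel x s : ℂ) =
    1 / (2 * √(2 * Real.pi * s)) * (Complex.exp (-(Complex.I * Real.pi / 4)) *
      Complex.exp (Complex.I * (x ^ 2 / (2 * s))) +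
      Complex.exp (Complex.I * Real.pi / 4) * Complex.exp (-(Complex.I * (x ^ 2 / (2 * s))))) := by
  rw [fresnel, Complex.ofReal_mul, Complex.ofReal_cos, Complex.cos, ← Complex.exp_add,
    ← Complex.exp_add]
  push_cast
  rw [show ((x : ℂ) ^ 2 / (2 * s) - Real.pi / 4) * Complex.I =
      -(Complex.I * Real.pi / 4) + Complex.I * (x ^ 2 / (2 * s)) by ring,
    show -((x : ℂ) ^ 2 / (2 * s) - Real.pi / 4) * Complex.I =
      Complex.I * Real.pi / 4 + -(Complex.I * (x ^ 2 / (2 * s))) by ring]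
  ring

/-- The Fresnel function has Fourier transform `cos((2πξ)² s / 2)`. -/
theorem integral_fourier_mul_fresnel {s : ℝ} (hs : 0 < s) (ψ : 𝓢(ℝ, ℂ)) :
    ∫ x, (𝓕 ψ) x * (fresnel x s : ℂ) =
      ∫ ξ, ψ ξ * (Real.cos ((2 * Real.pi * ξ) ^ 2 / 2 * s) : ℂ) := by
  have hpi := Real.pi_pos
  have hr : 0 < 2 * Real.pi * s := by positivity
  have hre : ∀ z : ℂ, z.re = 0 → 0 ≤ (((2 * Real.pi * s : ℝ) : ℂ) * z).re := by
    intro z hz; rw [Complex.re_ofReal_mul, hz, mul_zero]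
  have hr' : ((2 * Real.pi * s : ℝ) : ℂ) ≠ 0 := by exact_mod_cast hr.ne'
  have hint : ∀ (χ : 𝓢(ℝ, ℂ)) (z : ℂ), 0 ≤ z.re →
      Integrable fun x : ℝ => χ x * Complex.exp (-(Real.pi : ℂ) * z * x ^ 2) := by
    intro χ z hz
    refine χ.integrable.norm.mono' (by fun_prop : Continuous _).aestronglyMeasurable ?_
    refine Eventually.of_forall fun x => ?_
    rw [norm_mul]
    exact mul_le_of_le_one_right (norm_nonneg _) (norm_exp_neg_pi_mul_le hz x)
  -- At `b = ±2πs i` the Gaussian exponent `-π b⁻¹ x²` is `±i x² / (2s)`, the two halves of the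
  -- cosine in `fresnel`.
  have h1 := integral_fourier_mul_gaussian_of_re_nonneg (hre Complex.I (by simp))
    (mul_ne_zero hr' Complex.I_ne_zero) ψ
  have h2 := integral_fourier_mul_gaussian_of_re_nonneg (hre (-Complex.I) (by simp))
    (mul_ne_zero hr' (neg_ne_zero.2 Complex.I_ne_zero)) ψ
  rw [ofReal_mul_cpow_half hr Complex.I_ne_zero, Complex.log_I] at h1
  rw [ofReal_mul_cpow_half hr (neg_ne_zero.2 Complex.I_ne_zero), Complex.log_neg_I] at h2
  have i1 := hint (𝓕 ψ) (((2 * Real.pi * s : ℝ) : ℂ) * Complex.I)⁻¹ (by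
    rw [Complex.inv_re, Complex.re_ofReal_mul]; simp)
  have i2 := hint (𝓕 ψ) (((2 * Real.pi * s : ℝ) : ℂ) * -Complex.I)⁻¹ (by
    rw [Complex.inv_re, Complex.re_ofReal_mul]; simp)
  have j1 := hint ψ (((2 * Real.pi * s : ℝ) : ℂ) * Complex.I) (hre _ (by simp))
  have j2 := hint ψ (((2 * Real.pi * s : ℝ) : ℂ) * -Complex.I) (hre _ (by simp))
  have hsq : (√(2 * Real.pi * s) : ℂ) ≠ 0 := by
    exact_mod_cast (Real.sqrt_pos.2 hr).ne'
  have hs0 : (s : ℂ) ≠ 0 := by exact_mod_cast hs.ne'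
  have hpi0 : (Real.pi : ℂ) ≠ 0 := by exact_mod_cast hpi.ne'
  have e1 : ∀ x : ℝ, (𝓕 ψ) x * (fresnel x s : ℂ) = 1 / (2 * √(2 * Real.pi * s)) *
      (Complex.exp (-(Complex.I * Real.pi / 4)) * ((𝓕 ψ) x *
        Complex.exp (-(Real.pi : ℂ) * (((2 * Real.pi * s : ℝ) : ℂ) * Complex.I)⁻¹ * x ^ 2)) +
      Complex.exp (Complex.I * Real.pi / 4) * ((𝓕 ψ) x *
        Complex.exp (-(Real.pi : ℂ) * (((2 * Real.pi * s : ℝ) : ℂ) * -Complex.I)⁻¹ * x ^ 2))) := by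
    intro x
    have a1 : -(Real.pi : ℂ) * (((2 * Real.pi * s : ℝ) : ℂ) * Complex.I)⁻¹ * x ^ 2 =
        Complex.I * (x ^ 2 / (2 * s)) := by
      rw [mul_inv, Complex.inv_I]; push_cast; field_simp
    have a2 : -(Real.pi : ℂ) * (((2 * Real.pi * s : ℝ) : ℂ) * -Complex.I)⁻¹ * x ^ 2 =
        -(Complex.I * (x ^ 2 / (2 * s))) := by
      rw [mul_inv, inv_neg, Complex.inv_I]; push_cast; field_simp
    rw [ofReal_fresnel, a1, a2]
    ring
  have e2 : ∀ ξ : ℝ, ψ ξ * (Real.cos ((2 * Real.pi * ξ) ^ 2 / 2 * s) : ℂ) = 1 / 2 *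
      (ψ ξ * Complex.exp (-(Real.pi : ℂ) * (((2 * Real.pi * s : ℝ) : ℂ) * Complex.I) * ξ ^ 2) +
      ψ ξ * Complex.exp (-(Real.pi : ℂ) * (((2 * Real.pi * s : ℝ) : ℂ) * -Complex.I) * ξ ^ 2)) := by
    intro ξ
    rw [Complex.ofReal_cos, Complex.cos]
    push_cast
    rw [show (2 * (Real.pi : ℂ) * ξ) ^ 2 / 2 * s * Complex.I =
      -(Real.pi : ℂ) * (2 * Real.pi * s * -Complex.I) * ξ ^ 2 by ring,
      show -((2 * (Real.pi : ℂ) * ξ) ^ 2 / 2 * s) * Complex.I =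
      -(Real.pi : ℂ) * (2 * Real.pi * s * Complex.I) * ξ ^ 2 by ring]
    ring
  simp only [e1, e2]
  rw [integral_const_mul, integral_const_mul, integral_add (i1.const_mul _) (i2.const_mul _),
    integral_add j1 j2, integral_const_mul, integral_const_mul, h1, h2]
  -- The shift `π/4` in `fresnel` exactly cancels the phases of the square roots of `±i`.
  have c1 : Complex.exp (-(Complex.I * Real.pi / 4)) * Complex.exp (Real.pi / 2 * Complex.I / 2) = 1 := by
    rw [← Complex.exp_add, ← Complex.exp_zero]; congr 1; ring
  have c2 : Complex.exp (Complex.I * Real.pi / 4) * Complex.exp (-(Real.pi / 2) * Complex.I / 2) = 1 := by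
    rw [← Complex.exp_add, ← Complex.exp_zero]; congr 1; ring
  have c3 : 1 / (2 * (√(2 * Real.pi * s) : ℂ)) * √(2 * Real.pi * s) = 1 / 2 := by field_simp
  generalize (∫ ξ : ℝ, ψ ξ * Complex.exp (-(Real.pi : ℂ) *
    (((2 * Real.pi * s : ℝ) : ℂ) * Complex.I) * ξ ^ 2)) = A
  generalize (∫ ξ : ℝ, ψ ξ * Complex.exp (-(Real.pi : ℂ) *
    (((2 * Real.pi * s : ℝ) : ℂ) * -Complex.I) * ξ ^ 2)) = B
  linear_combination (Complex.exp (-(Complex.I * Real.pi / 4)) *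
    Complex.exp (Real.pi / 2 * Complex.I / 2) * A + Complex.exp (Complex.I * Real.pi / 4) *
    Complex.exp (-(Real.pi / 2) * Complex.I / 2) * B) * c3 + 1 / 2 * A * c1 + 1 / 2 * B * c2

/-! ### Symmetrised dilations and their folding. -/

/-- The law of `± c Z` with a fair independent sign, where `Z` has law `μ`. -/
def symDilation (μ : Measure ℝ) (c : ℝ) : Measure ℝ :=
  (2⁻¹ : ℝ≥0) • (μ.map (fun z => c * z) + μ.map (fun z => -c * z))

instance (μ : Measure ℝ) [IsFiniteMeasure μ] (c : ℝ) : IsFiniteMeasure (symDilation μ c) := by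
  unfold symDilation; infer_instance

theorem integral_mul_cos_integral (μ : Measure ℝ) [IsFiniteMeasure μ] (ψ : 𝓢(ℝ, ℂ)) {h : ℝ → ℝ}
    (hh : Continuous h) : ∫ z, (∫ ξ, ψ ξ * (Real.cos (h ξ * z) : ℂ)) ∂μ =
      ∫ ξ, ψ ξ * (cosTransform μ (h ξ) : ℂ) := by
  rw [integral_integral_swap]
  · congr 1
    ext ξ
    rw [integral_const_mul, cosTransform, integral_complex_ofReal]
  · have := (integrable_const (μ := μ) (1 : ℝ)).mul_prod (ψ.integrable (μ := volume)).norm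
    refine this.mono' ?_ (Eventually.of_forall fun p => ?_)
    · exact (by fun_prop : Continuous fun p : ℝ × ℝ =>
        ψ p.2 * (Real.cos (h p.2 * p.1) : ℂ)).aestronglyMeasurable
    · rw [Function.uncurry, norm_mul, Complex.norm_real, one_mul]
      exact mul_le_of_le_one_right (norm_nonneg _) (Real.abs_cos_le_one _)

theorem fourier_add_fourier_neg (ψ : 𝓢(ℝ, ℂ)) (x : ℝ) :
    (𝓕 ψ) x + (𝓕 ψ) (-x) = 2 * ∫ ξ, ψ ξ * (Real.cos (2 * Real.pi * ξ * x) : ℂ) := by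
  have hi : ∀ y : ℝ, Integrable fun ξ : ℝ => Complex.exp (↑(-2 * Real.pi * ξ * y) * Complex.I) * ψ ξ := by
    intro y
    refine ψ.integrable.norm.mono' (by fun_prop : Continuous _).aestronglyMeasurable ?_
    refine Eventually.of_forall fun ξ => ?_
    rw [norm_mul, Complex.norm_exp_ofReal_mul_I, one_mul]
  rw [SchwartzMap.fourier_coe, Real.fourier_real_eq_integral_exp_smul,
    Real.fourier_real_eq_integral_exp_smul]
  simp only [smul_eq_mul]
  rw [← integral_add (hi x) (hi (-x)), ← integral_const_mul]
  congr 1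
  ext ξ
  rw [Complex.ofReal_cos, Complex.cos]
  push_cast
  rw [show -2 * (Real.pi : ℂ) * ξ * x * Complex.I = -(2 * Real.pi * ξ * x) * Complex.I by ring,
    show -2 * (Real.pi : ℂ) * ξ * -x * Complex.I = 2 * Real.pi * ξ * x * Complex.I by ring]
  ring

theorem integral_symDilation (μ : Measure ℝ) [IsFiniteMeasure μ] (c : ℝ) (φ : 𝓢(ℝ, ℂ)) :
    ∫ x, φ x ∂(symDilation μ c) = ∫ z, (φ (c * z) + φ (-(c * z))) / 2 ∂μ := by
  have hm1 : Measurable fun z : ℝ => c * z := by fun_prop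
  have hm2 : Measurable fun z : ℝ => -c * z := by fun_prop
  have hφ : ∀ (ρ : Measure ℝ) [IsFiniteMeasure ρ], Integrable φ ρ := fun ρ _ => φ.integrable
  rw [symDilation, integral_smul_nnreal_measure, integral_add_measure (hφ _) (hφ _),
    integral_map hm1.aemeasurable φ.continuous.aestronglyMeasurable,
    integral_map hm2.aemeasurable φ.continuous.aestronglyMeasurable, ← integral_add,
    integral_div, NNReal.smul_def, Complex.real_smul]
  · simp only [neg_mul]
    push_cast
    ring
  · exact (integrable_map_measure φ.continuous.aestronglyMeasurable hm1.aemeasurable).1 (hφ _)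
  · exact (integrable_map_measure φ.continuous.aestronglyMeasurable hm2.aemeasurable).1 (hφ _)

/-- The fair sign turns the exponentials of the Fourier transform into cosines. -/
theorem integral_fourier_symDilation (μ : Measure ℝ) [IsFiniteMeasure μ] (c : ℝ) (ψ : 𝓢(ℝ, ℂ)) :
    ∫ x, (𝓕 ψ) x ∂(symDilation μ c) =
      ∫ ξ, ψ ξ * (cosTransform μ (2 * Real.pi * ξ * c) : ℂ) := by
  rw [integral_symDilation, ← integral_mul_cos_integral μ ψ (by fun_prop)]
  congr 1
  ext z
  rw [fourier_add_fourier_neg, mul_div_cancel_left₀ _ two_ne_zero]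
  simp only [mul_assoc]

/-- Folding forgets the sign, and both signs contribute the same image because `μ` is carried by
`(0, ∞)`. -/
theorem folded_symDilation {μ : Measure ℝ} (hμ : ∀ᵐ x ∂μ, 0 < x) {c : ℝ} (hc : 0 ≤ c) :
    folded (symDilation μ c) = μ.map fun z => c * z := by
  have habs : Measurable fun s : ℝ => |s| := measurable_abs
  have e : ∀ d : ℝ, |d| = c → (μ.map fun z => d * z).map (fun s => |s|) = μ.map fun z => c * z := by
    intro d hd
    rw [Measure.map_map habs (by fun_prop)]
    refine Measure.map_congr ?_
    filter_upwards [hμ] with z hz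
    simp [abs_mul, hd, abs_of_pos hz]
  rw [folded, symDilation, Measure.map_smul, Measure.map_add _ _ habs, e c (abs_of_nonneg hc),
    e (-c) (by rw [abs_neg, abs_of_nonneg hc]), ← two_nsmul, ← Nat.cast_smul_eq_nsmul ℝ≥0, smul_smul]
  simp

/-! ### Averaging the Fresnel function over the dilated law. -/

section Fresnel

variable {ν : ℝ} {μ : Measure ℝ} {c : ℝ}

theorem measurable_fresnel : Measurable fun p : ℝ × ℝ => fresnel p.1 p.2 := by
  unfold fresnel; fun_prop

/-- This bound is the reason for the moment of order `-1/2` in `IsMittagLefflerLaw`: it gives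
absolute convergence, continuity in `x` and the use of Fubini. -/
theorem abs_fresnel_le {s : ℝ} (hs : 0 < s) (x : ℝ) : |fresnel x s| ≤ s ^ (-(1 / 2) : ℝ) := by
  have hpi := Real.pi_gt_three
  rw [fresnel, abs_mul, Real.rpow_neg hs.le, ← Real.sqrt_eq_rpow, abs_of_nonneg (by positivity),
    one_div]
  refine (mul_le_of_le_one_right (by positivity) (Real.abs_cos_le_one _)).trans ?_
  gcongr
  nlinarith

theorem continuous_fresnel (s : ℝ) : Continuous fun x => fresnel x s := by
  unfold fresnel; fun_prop

theorem IsMittagLefflerLaw.integrable_rpow (h : IsMittagLefflerLaw ν μ) (hc : 0 < c) :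
    Integrable (fun z => (c * z) ^ (-(1 / 2) : ℝ)) μ := by
  have h1 : Integrable (fun z : ℝ => z ^ (-(1 / 2) : ℝ)) μ := by
    refine ⟨(by fun_prop : Measurable _).aestronglyMeasurable, ?_⟩
    rw [hasFiniteIntegral_iff_ofReal]
    · exact h.lintegral_rpow_lt_top
    · filter_upwards [h.pos] with z hz using by positivity
  refine (h1.const_mul (c ^ (-(1 / 2) : ℝ))).congr ?_
  filter_upwards [h.pos] with z hz
  rw [Real.mul_rpow hc.le hz.le]

theorem IsMittagLefflerLaw.restrict_map (h : IsMittagLefflerLaw ν μ) (hc : 0 < c) :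
    (μ.map fun z => c * z).restrict (Ioi 0) = μ.map fun z => c * z := by
  refine Measure.restrict_eq_self_of_ae_mem ?_
  refine (ae_map_iff (by fun_prop) measurableSet_Ioi).2 ?_
  filter_upwards [h.pos] with z hz using mul_pos hc hz

theorem IsMittagLefflerLaw.abs_fresnel_le (h : IsMittagLefflerLaw ν μ) (hc : 0 < c) (x : ℝ) :
    ∀ᵐ z ∂μ, ‖fresnel x (c * z)‖ ≤ (c * z) ^ (-(1 / 2) : ℝ) := by
  filter_upwards [h.pos] with z hz using FracRod.abs_fresnel_le (mul_pos hc hz) x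

theorem aestronglyMeasurable_fresnel (x : ℝ) (ρ : Measure ℝ) :
    AEStronglyMeasurable (fresnel x) ρ :=
  (measurable_fresnel.comp measurable_prodMk_left).aestronglyMeasurable

theorem IsMittagLefflerLaw.integrable_fresnel (h : IsMittagLefflerLaw ν μ) (hc : 0 < c) (x : ℝ) :
    Integrable (fun z => fresnel x (c * z)) μ :=
  (h.integrable_rpow hc).mono'
    ((aestronglyMeasurable_fresnel x _).comp_measurable (by fun_prop)) (h.abs_fresnel_le hc x)

theorem IsMittagLefflerLaw.integrableOn_fresnel (h : IsMittagLefflerLaw ν μ) (hc : 0 < c) (x : ℝ) :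
    IntegrableOn (fresnel x) (Ioi 0) (folded (symDilation μ c)) := by
  rw [folded_symDilation h.pos hc.le]
  refine Integrable.integrableOn ?_
  exact (integrable_map_measure (aestronglyMeasurable_fresnel x _) (by fun_prop)).2
    (h.integrable_fresnel hc x)

theorem IsMittagLefflerLaw.setIntegral_fresnel (h : IsMittagLefflerLaw ν μ) (hc : 0 < c) (x : ℝ) :
    ∫ s in Ioi 0, fresnel x s ∂(folded (symDilation μ c)) = ∫ z, fresnel x (c * z) ∂μ := by
  rw [folded_symDilation h.pos hc.le, h.restrict_map hc,
    integral_map (by fun_prop) (aestronglyMeasurable_fresnel x _)]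

theorem IsMittagLefflerLaw.continuous_integral_fresnel (h : IsMittagLefflerLaw ν μ) (hc : 0 < c) :
    Continuous fun x => ∫ z, fresnel x (c * z) ∂μ :=
  continuous_of_dominated (fun x => (h.integrable_fresnel hc x).aestronglyMeasurable)
    (fun x => h.abs_fresnel_le hc x) (h.integrable_rpow hc)
    (Eventually.of_forall fun _ => continuous_fresnel _)

theorem IsMittagLefflerLaw.norm_integral_fresnel_le (h : IsMittagLefflerLaw ν μ) (hc : 0 < c)
    (x : ℝ) : ‖∫ z, fresnel x (c * z) ∂μ‖ ≤ ∫ z, (c * z) ^ (-(1 / 2) : ℝ) ∂μ :=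
  norm_integral_le_of_norm_le (h.integrable_rpow hc) (h.abs_fresnel_le hc x)

/-- After Fubini, `integral_fourier_mul_fresnel` applies for each `z`, and the cosines average to
the same transform of `μ` that solves the diffusion equation, at a frequency quadratic in `ξ`. -/
theorem IsMittagLefflerLaw.integral_fourier_mul_integral_fresnel (h : IsMittagLefflerLaw ν μ)
    (hc : 0 < c) (ψ : 𝓢(ℝ, ℂ)) :
    ∫ x, (𝓕 ψ) x * ((∫ z, fresnel x (c * z) ∂μ : ℝ) : ℂ) =
      ∫ ξ, ψ ξ * (cosTransform μ ((2 * Real.pi * ξ) ^ 2 / 2 * c) : ℂ) := by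
  have := h.prob
  rw [← integral_mul_cos_integral μ ψ (by fun_prop)]
  have h1 : ∀ x, (𝓕 ψ) x * ((∫ z, fresnel x (c * z) ∂μ : ℝ) : ℂ) =
      ∫ z, (𝓕 ψ) x * (fresnel x (c * z) : ℂ) ∂μ := fun x => by
    rw [integral_const_mul, integral_complex_ofReal]
  simp only [h1]
  rw [integral_integral_swap]
  · refine integral_congr_ae ?_
    filter_upwards [h.pos] with z hz
    rw [integral_fourier_mul_fresnel (mul_pos hc hz)]
    simp only [mul_assoc]
  · refine ((𝓕 ψ).integrable.norm.mul_prod (h.integrable_rpow hc)).mono' ?_ ?_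
    · have h2 : Measurable fun p : ℝ × ℝ => fresnel p.1 (c * p.2) :=
        measurable_fresnel.comp
          (by fun_prop : Measurable fun p : ℝ × ℝ => (p.1, c * p.2))
      have h3 : Continuous fun p : ℝ × ℝ => (𝓕 ψ) p.1 := (𝓕 ψ).continuous.comp continuous_fst
      exact (h3.measurable.mul (Complex.measurable_ofReal.comp h2)).aestronglyMeasurable
    · have h2 : ∀ᵐ p ∂((volume : Measure ℝ).prod μ), 0 < p.2 :=
        Measure.quasiMeasurePreserving_snd.ae h.pos
      filter_upwards [h2] with p hp
      rw [Function.uncurry, norm_mul, Complex.norm_real]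
      gcongr
      exact FracRod.abs_fresnel_le (mul_pos hc hp) _

end Fresnel

/-! ### The solutions of the two equations. -/

variable {ν lam : ℝ} {μ : Measure ℝ}

/-- The solution of the fractional diffusion equation built from the Mittag-Leffler law. -/
def diffusionSolution (μ : Measure ℝ) [IsFiniteMeasure μ] (ν lam t : ℝ) : FiniteMeasure ℝ :=
  ⟨symDilation μ (|lam| * |t| ^ ν), inferInstance⟩

theorem IsMittagLefflerLaw.isFundamentalSolution_diffusion [IsFiniteMeasure μ]
    (h : IsMittagLefflerLaw ν μ) (hν : 0 < ν) (hν1 : ν ≤ 1) :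
    IsFundamentalSolution (2 * ν) (lam ^ 2) 2
      (fun t => (diffusionSolution μ ν lam t : Measure ℝ).toTemperedDistribution) := by
  -- This `b` satisfies `-b² = λ² (2πiξ)²`.
  refine h.isFundamentalSolution hν hν1 (b := fun ξ => 2 * Real.pi * ξ * |lam|) (by fun_prop)
    (fun ξ => ?_) fun t ht ψ => ?_
  · rw [freq, mul_pow _ |lam|, sq_abs]
    push_cast
    rw [mul_pow, mul_pow, Complex.I_sq]
    ring
  · change ∫ x, (𝓕 ψ) x ∂(symDilation μ (|lam| * |t| ^ ν)) = _
    rw [integral_fourier_symDilation, abs_of_pos ht]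
    simp only [mul_assoc]

theorem IsMittagLefflerLaw.subordinated_eq [IsFiniteMeasure μ] (h : IsMittagLefflerLaw ν μ)
    (hlam : lam ≠ 0) {t : ℝ} (ht : 0 < t) (x : ℝ) :
    subordinated (diffusionSolution μ ν lam) x t = ∫ z, fresnel x (|lam| * |t| ^ ν * z) ∂μ :=
  h.setIntegral_fresnel (by positivity) x

/-- A bounded continuous function as a tempered distribution. -/
theorem exists_isGivenBy {f : ℝ → ℝ} (hf : Continuous f) {C : ℝ} (hC : ∀ x, ‖f x‖ ≤ C) :
    ∃ T : 𝓢'(ℝ, ℂ), IsGivenBy T f := by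
  have hm : MemLp (fun x => (f x : ℂ)) ⊤ (volume : Measure ℝ) :=
    memLp_top_of_bound (by fun_prop : Continuous _).aestronglyMeasurable C
      (Eventually.of_forall fun x => by simpa using hC x)
  refine ⟨Lp.toTemperedDistribution (hm.toLp _), fun φ => ⟨?_, ?_⟩⟩
  · exact φ.integrable.mul_of_top_left hm
  · rw [Lp.toTemperedDistribution_apply]
    refine integral_congr_ae ?_
    filter_upwards [hm.coeFn_toLp] with x hx
    rw [hx, smul_eq_mul]

theorem IsMittagLefflerLaw.exists_rod_solution [IsFiniteMeasure μ] (h : IsMittagLefflerLaw ν μ)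
    (hν : 0 < ν) (hν1 : ν ≤ 1) (hlam : lam ≠ 0) :
    ∃ u : ℝ → 𝓢'(ℝ, ℂ), IsFundamentalSolution (2 * ν) (-(lam ^ 2 / 2 ^ 2)) 4 u ∧
      ∀ t, 0 < t → IsGivenBy (u t) fun x => subordinated (diffusionSolution μ ν lam) x t := by
  have hex : ∀ t : ℝ, ∃ T : 𝓢'(ℝ, ℂ), 0 < t → IsGivenBy T fun x =>
      subordinated (diffusionSolution μ ν lam) x t := by
    intro t
    rcases lt_or_ge 0 t with ht | ht
    · have hc : 0 < |lam| * |t| ^ ν := by positivity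
      simp only [h.subordinated_eq hlam ht]
      obtain ⟨T, hT⟩ := exists_isGivenBy (h.continuous_integral_fresnel hc)
        (h.norm_integral_fresnel_le hc)
      exact ⟨T, fun _ => hT⟩
    · exact ⟨0, fun h' => absurd h' ht.not_gt⟩
  choose u hu using hex
  refine ⟨u, ?_, hu⟩
  -- This `b` satisfies `-b² = -(λ²/4) (2πiξ)⁴`.
  refine h.isFundamentalSolution hν hν1 (b := fun ξ => (2 * Real.pi * ξ) ^ 2 / 2 * |lam|)
    (by fun_prop) (fun ξ => ?_) fun t ht ψ => ?_
  · rw [freq, mul_pow _ |lam|, sq_abs]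
    push_cast
    rw [mul_pow, mul_pow, Complex.I_pow_four]
    ring
  · have hc : 0 < |lam| * |t| ^ ν := by positivity
    rw [(hu t ht (𝓕 ψ)).2]
    simp only [h.subordinated_eq hlam ht]
    rw [h.integral_fourier_mul_integral_fresnel hc, abs_of_pos ht]
    simp only [mul_assoc]

/-! ### Densities for `ν < 1`. -/

section Density

/-- The density is arranged to vanish at every `x ≤ 0`, not just almost everywhere, so that at each
point at most one of the two dilates in `symDilation` contributes. -/
theorem exists_density [IsFiniteMeasure μ] (hμ : ∀ᵐ x ∂μ, 0 < x) (hac : μ ≪ volume) :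
    ∃ f : ℝ → ℝ, Measurable f ∧ (∀ x, 0 ≤ f x) ∧ (∀ x ≤ 0, f x = 0) ∧
      μ = volume.withDensity fun x => ENNReal.ofReal (f x) := by
  refine ⟨(Ioi 0).indicator fun x => (μ.rnDeriv volume x).toReal,
    (μ.measurable_rnDeriv volume).ennreal_toReal.indicator measurableSet_Ioi,
    indicator_nonneg fun _ _ => ENNReal.toReal_nonneg,
    fun x hx => indicator_of_notMem (by simpa using hx) _, ?_⟩
  have e : (fun x => ENNReal.ofReal ((Ioi 0).indicator (fun x => (μ.rnDeriv volume x).toReal) x))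
      =ᵐ[volume] (Ioi 0).indicator (μ.rnDeriv volume) := by
    filter_upwards [μ.rnDeriv_lt_top volume] with x hx
    by_cases h : x ∈ Ioi (0 : ℝ)
    · rw [indicator_of_mem h, indicator_of_mem h, ENNReal.ofReal_toReal hx.ne]
    · rw [indicator_of_notMem h, indicator_of_notMem h, ENNReal.ofReal_zero]
  rw [withDensity_congr_ae e, withDensity_indicator measurableSet_Ioi,
    ← restrict_withDensity measurableSet_Ioi, Measure.withDensity_rnDeriv_eq _ _ hac,
    Measure.restrict_eq_self_of_ae_mem (s := Ioi 0) hμ]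

theorem map_mul_withDensity {g : ℝ → ℝ≥0∞} (hg : Measurable g) {d : ℝ} (hd : d ≠ 0) :
    (volume.withDensity g).map (fun z => d * z) =
      volume.withDensity fun s => ENNReal.ofReal |d⁻¹| * g (d⁻¹ * s) := by
  have hm : Measurable fun z : ℝ => d * z := by fun_prop
  ext A hA
  have hG : Measurable fun s => g (d⁻¹ * s) := by fun_prop
  rw [Measure.map_apply hm hA, withDensity_apply _ (hm hA), withDensity_apply _ hA,
    lintegral_const_mul _ hG, ← smul_eq_mul, ← lintegral_smul_measure, ← Measure.restrict_smul,
    ← Real.map_volume_mul_left hd, setLIntegral_map hA hG hm]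
  refine lintegral_congr fun z => ?_
  rw [inv_mul_cancel_left₀ hd]

theorem symDilation_withDensity {f : ℝ → ℝ} (hf : Measurable f) (h0 : ∀ x, 0 ≤ f x)
    (hneg : ∀ x ≤ 0, f x = 0) {c : ℝ} (hc : 0 < c) :
    symDilation (volume.withDensity fun x => ENNReal.ofReal (f x)) c =
      volume.withDensity fun s => ENNReal.ofReal ((2 * c)⁻¹ * f (c⁻¹ * |s|)) := by
  have hg : Measurable fun x => ENNReal.ofReal (f x) := hf.ennreal_ofReal
  have e : ∀ M : Measure ℝ, (2⁻¹ : ℝ≥0) • M = ENNReal.ofReal 2⁻¹ • M := fun M => by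
    ext A hA
    rw [Measure.smul_apply, Measure.smul_apply, ENNReal.smul_def, smul_eq_mul, smul_eq_mul,
      ENNReal.ofReal]
    congr 2
    ext
    simp
  rw [symDilation, map_mul_withDensity hg hc.ne', map_mul_withDensity hg (neg_ne_zero.2 hc.ne'),
    ← withDensity_add_left (by fun_prop), e, ← withDensity_smul _ (by fun_prop)]
  congr 1
  ext s
  have hc' : 0 < c⁻¹ := by positivity
  simp only [Pi.smul_apply, Pi.add_apply]
  rw [inv_neg, abs_neg, abs_of_pos hc', ← ENNReal.ofReal_mul hc'.le, ← ENNReal.ofReal_mul hc'.le,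
    ← ENNReal.ofReal_add (mul_nonneg hc'.le (h0 _)) (mul_nonneg hc'.le (h0 _)), smul_eq_mul,
    ← ENNReal.ofReal_mul (by norm_num), mul_inv]
  congr 1
  rcases le_total 0 s with hs | hs
  · rw [hneg (-c⁻¹ * s) (by nlinarith), abs_of_nonneg hs]
    ring
  · rw [hneg (c⁻¹ * s) (by nlinarith), abs_of_nonpos hs, mul_neg, neg_mul]
    ring

theorem IsMittagLefflerLaw.exists_density_diffusion [IsFiniteMeasure μ]
    (h : IsMittagLefflerLaw ν μ) (hac : μ ≪ volume) (hlam : lam ≠ 0) :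
    ∃ p : ℝ → ℝ → ℝ, ∀ t : ℝ, 0 < t →
        Integrable (fun s => p s t) ∧ (∀ s : ℝ, 0 ≤ p s t) ∧ (∀ s : ℝ, p (-s) t = p s t) ∧
        (diffusionSolution μ ν lam t : Measure ℝ) =
          volume.withDensity (fun s => ENNReal.ofReal (p s t)) ∧
        ∀ x : ℝ, IntegrableOn (fun s => fresnel x s * (2 * p s t)) (Ioi 0) ∧
          subordinated (diffusionSolution μ ν lam) x t =
            ∫ s in Ioi 0, fresnel x s * (2 * p s t) := by
  obtain ⟨f, hf, h0, hneg, hμ⟩ := exists_density h.pos hac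
  refine ⟨fun s t => (2 * (|lam| * |t| ^ ν))⁻¹ * f ((|lam| * |t| ^ ν)⁻¹ * |s|), fun t ht => ?_⟩
  beta_reduce
  set c := |lam| * |t| ^ ν with hcdef
  have hc : 0 < c := by positivity
  have hpm : Measurable fun s => (2 * c)⁻¹ * f (c⁻¹ * |s|) := by fun_prop
  have hp0 : ∀ s, 0 ≤ (2 * c)⁻¹ * f (c⁻¹ * |s|) := fun s => mul_nonneg (by positivity) (h0 _)
  have hv : (diffusionSolution μ ν lam t : Measure ℝ) =
      volume.withDensity fun s => ENNReal.ofReal ((2 * c)⁻¹ * f (c⁻¹ * |s|)) := by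
    rw [← symDilation_withDensity hf h0 hneg hc, ← hμ]
    rfl
  refine ⟨⟨hpm.aestronglyMeasurable, ?_⟩, hp0, fun s => by rw [abs_neg], hv, fun x => ?_⟩
  · rw [hasFiniteIntegral_iff_ofReal (Eventually.of_forall hp0), ← setLIntegral_univ,
      ← withDensity_apply _ MeasurableSet.univ, ← hv]
    exact measure_lt_top _ _
  have hfold : (folded (symDilation μ c)).restrict (Ioi 0) = (volume.restrict (Ioi 0)).withDensity
      fun s => ENNReal.ofReal (2 * ((2 * c)⁻¹ * f (c⁻¹ * |s|))) := by
    rw [folded_symDilation h.pos hc.le, hμ, map_mul_withDensity hf.ennreal_ofReal hc.ne',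
      restrict_withDensity measurableSet_Ioi]
    refine withDensity_congr_ae ?_
    filter_upwards [ae_restrict_mem measurableSet_Ioi] with s hs
    rw [abs_of_pos (by positivity : 0 < c⁻¹), abs_of_pos hs, ← ENNReal.ofReal_mul (by positivity)]
    congr 1
    field_simp
  have hq : Measurable fun s => ENNReal.ofReal (2 * ((2 * c)⁻¹ * f (c⁻¹ * |s|))) := by fun_prop
  have e : ∀ s, (ENNReal.ofReal (2 * ((2 * c)⁻¹ * f (c⁻¹ * |s|)))).toReal =
      2 * ((2 * c)⁻¹ * f (c⁻¹ * |s|)) := fun s =>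
    ENNReal.toReal_ofReal (mul_nonneg zero_le_two (hp0 s))
  constructor
  · have h1 := h.integrableOn_fresnel hc x
    rw [IntegrableOn, hfold, integrable_withDensity_iff hq
      (Eventually.of_forall fun s => ENNReal.ofReal_lt_top)] at h1
    simpa only [e, IntegrableOn] using h1
  · change ∫ s in Ioi 0, fresnel x s ∂(folded (symDilation μ c)) = _
    rw [hfold, integral_withDensity_eq_integral_toReal_smul hq
      (Eventually.of_forall fun s => ENNReal.ofReal_lt_top)]
    simp only [e, smul_eq_mul, mul_comm (fresnel x _)]

end Density

end FracRod

end

/-! ### The theorem. -/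

theorem theorem3p3 (ν lam : ℝ) (hν : 0 < ν) (hν1 : ν ≤ 1) (hlam : lam ≠ 0) :
    -- the fundamental solution `v` of the fractional diffusion equation exists, as a finite measure
    -- in `x`, and is unique among all tempered distributions
    ∃ v : ℝ → FiniteMeasure ℝ,
      FracRod.IsFundamentalSolution (2 * ν) (lam ^ 2) 2
        (fun t => (v t : Measure ℝ).toTemperedDistribution) ∧
      (∀ w : ℝ → 𝓢'(ℝ, ℂ), FracRod.IsFundamentalSolution (2 * ν) (lam ^ 2) 2 w →
        ∀ t : ℝ, 0 < t → w t = (v t : Measure ℝ).toTemperedDistribution) ∧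
      -- the subordination integral converges absolutely and is continuous in `x`
      (∀ t : ℝ, 0 < t → ∀ x : ℝ,
        IntegrableOn (FracRod.fresnel x) (Ioi 0) (FracRod.folded (v t : Measure ℝ))) ∧
      (∀ t : ℝ, 0 < t → Continuous (fun x => FracRod.subordinated v x t)) ∧
      -- the rod equation has a solution, and every solution is the subordination integral
      (∃ u : ℝ → 𝓢'(ℝ, ℂ),
        FracRod.IsFundamentalSolution (2 * ν) (-(lam ^ 2 / 2 ^ 2)) 4 u) ∧
      (∀ u : ℝ → 𝓢'(ℝ, ℂ), FracRod.IsFundamentalSolution (2 * ν) (-(lam ^ 2 / 2 ^ 2)) 4 u →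
        ∀ t : ℝ, 0 < t → FracRod.IsGivenBy (u t) (fun x => FracRod.subordinated v x t)) ∧
      -- for `ν < 1` the solution `v` is an even density `p`, with folding `2 p` on `(0, ∞)`
      (ν < 1 → ∃ p : ℝ → ℝ → ℝ, ∀ t : ℝ, 0 < t →
        Integrable (fun s => p s t) ∧ (∀ s : ℝ, 0 ≤ p s t) ∧ (∀ s : ℝ, p (-s) t = p s t) ∧
        (v t : Measure ℝ) = volume.withDensity (fun s => ENNReal.ofReal (p s t)) ∧
        ∀ x : ℝ, IntegrableOn (fun s => FracRod.fresnel x s * (2 * p s t)) (Ioi 0) ∧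
          FracRod.subordinated v x t =
            ∫ s in Ioi 0, FracRod.fresnel x s * (2 * p s t)) := by
  -- At `ν = 1` the law is a Dirac mass, so a density is claimed only for `ν < 1`.
  obtain ⟨μ, hμ, hac⟩ : ∃ μ, FracRod.IsMittagLefflerLaw ν μ ∧ (ν < 1 → μ ≪ volume) := by
    rcases hν1.lt_or_eq with h | rfl
    · obtain ⟨μ, hμ, hac⟩ := FracRod.exists_isMittagLefflerLaw hν h
      exact ⟨μ, hμ, fun _ => hac⟩
    · exact ⟨_, FracRod.isMittagLefflerLaw_one, fun h => absurd h (lt_irrefl _)⟩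
  have := hμ.prob
  have hα : 0 < 2 * ν := by positivity
  have hα2 : 2 * ν ≤ 2 := by linarith
  have hv := hμ.isFundamentalSolution_diffusion (lam := lam) hν hν1
  obtain ⟨u, hu, hug⟩ := hμ.exists_rod_solution hν hν1 hlam
  refine ⟨FracRod.diffusionSolution μ ν lam, hv,
    fun w hw t ht => hw.unique hα hα2 hv ht, fun t ht x => ?_, fun t ht => ?_, ⟨u, hu⟩,
    fun u' hu' t ht => ?_, fun h1 => hμ.exists_density_diffusion (hac h1) hlam⟩
  · exact hμ.integrableOn_fresnel (by positivity) x
  · simp only [hμ.subordinated_eq hlam ht]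
    exact hμ.continuous_integral_fresnel (by positivity)
  -- By uniqueness it suffices to know the solution constructed from the subordination integral.
  · rw [hu'.unique hα hα2 hu ht]
    exact hug t ht
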